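/- A signed graph $G=(V,E^+,E^-)$ consists of a finite vertex set $V$ and two disjoint sets $E^+,E^-\subseteq\binom V2$ of positive and negative edges; $G_0=(V,E^+\cup E^-)$ is its underlying graph, and $n=|V|$. For $S\subseteq V$ and $v\in V$ let $\deg_S^+(v)$ and $\deg_S^-(v)$ be the numbers of positive and negative neighbours of $v$ in $S$, let $\overline S=V\setminus S$, and let $\partial S$ be the set of vertices outside $S$ that have a neighbour in $S$ in $G_0$. The set $S$ is an offensive alliance if every $v\in\partial S$ satisfies $\deg_S^-(v)\ge\deg_S^+(v)$ and $\deg_S^-(v)\ge\deg_{\overline S}^+(v)+1$. The problem Offensive Alliance asks, given $G$ and an integer $k\ge1$, whether $G$ has an offensive alliance $S$ with $1\le|S|\le k$. Let $a_{so}(G)$ be the smallest size of a non-empty offensive alliance of $G$ (it exists when $V\neq\emptyset$). A tree decomposition $(T,\{X_t\}_{t\in V_T})$ of a graph consists of a tree $T$ and bags $X_t\subseteq V$ that cover $V$, such that each edge lies in some bag and, for each vertex $v$, the nodes $t$ with $v\in X_t$ induce a connected subgraph of $T$. Its width is $\max_t|X_t|-1$ (read as $0$ if all bags are empty). It is a domino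 tree decomposition if $X_i\cap X_j=\emptyset$ for all distinct non-adjacent nodes $i,j$ of $T$. **Theorem.** Offensive Alliance on signed graphs is fixed-parameter tractable when parameterized by the width $d$ of a given domino tree decomposition of the underlying graph. More precisely, there are one algorithm (a program of a uniform-cost random access machine with addition, truncated subtraction, comparison and indirect addressing) and one constant $C$ such that the following holds. Given a signed graph $G$ by adjacency lists, an integer $k\ge1$, and a domino tree decomposition $(T,\{X_t\}_{t\in V_T})$ of $G_0$ of width $d$ by lists of the bags and adjacency lists of the (unrooted) tree, the algorithm decides whether $G$ has an offensive alliance $S$ with $1\le|S|\le k$ and, if $n\ge 1$, also computes $a_{so}(G)$. With $\hat d=\max\{d,1\}$, its number of steps is at most $$C\,\hat d^{\,2}\,2^{C\hat d^{\,2}}\,(n+|V_T|),$$ and if no bag is empty, it is at most $$C\,\hat d^{\,2}\,2^{C\hat d^{\,2}}\,n ,$$ that is, $O(d^2\,2^{O(d^2)}\,n)$ for $d\ge1$. -/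

import Mathlib

/-! ## Signed graphs and offensive alliances -/

/-- A signed graph: a positive and a negative simple graph on the same vertex set,
without a common edge. -/
structure SignedGraph (V : Type*) where
  /-- the graph of the positive edges -/
  pos : SimpleGraph V
  /-- the graph of the negative edges -/
  neg : SimpleGraph V
  disjoint : Disjoint pos neg

namespace SignedGraph

variable {V : Type*}

/-- The underlying unsigned graph. -/
def underlying (G : SignedGraph V) : SimpleGraph V := G.pos ⊔ G.neg

open Classical in
/-- The positive degree of `v` with respect to `S`. -/
noncomputable def posDeg (G : SignedGraph V) (S : Finset V) (v : V) : ℕ :=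
  (S.filter fun u => G.pos.Adj v u).card

open Classical in
/-- The negative degree of `v` with respect to `S`. -/
noncomputable def negDeg (G : SignedGraph V) (S : Finset V) (v : V) : ℕ :=
  (S.filter fun u => G.neg.Adj v u).card

/-- The boundary of `S`: the vertices outside `S` with a neighbour in `S`. -/
def boundary (G : SignedGraph V) (S : Finset V) : Set V :=
  {v | v ∉ S ∧ ∃ u ∈ S, G.underlying.Adj u v}

/-- `S` successfully attacks each vertex of its boundary. -/
def IsOffensiveAlliance [Fintype V] [DecidableEq V] (G : SignedGraph V) (S : Finset V) : Prop :=
  ∀ v ∈ G.boundary S,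
    G.posDeg S v ≤ G.negDeg S v ∧ G.posDeg Sᶜ v + 1 ≤ G.negDeg S v

/-- The question of the problem Offensive Alliance on the instance `(G, k)`. -/
def HasOffensiveAlliance [Fintype V] [DecidableEq V] (G : SignedGraph V) (k : ℕ) : Prop :=
  ∃ S : Finset V, G.IsOffensiveAlliance S ∧ 1 ≤ S.card ∧ S.card ≤ k

/-- `m` is the smallest size of a non-empty offensive alliance of `G`. -/
def IsAllianceNumber [Fintype V] [DecidableEq V] (G : SignedGraph V) (m : ℕ) : Prop :=
  IsLeast {s : ℕ | ∃ S : Finset V, S.Nonempty ∧ G.IsOffensiveAlliance S ∧ S.card = s} m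

end SignedGraph

/-! ## Domino tree decompositions -/

/-- A tree decomposition of the graph `G` with node set `ι`. -/
structure TreeDecomposition {V : Type*} (G : SimpleGraph V) (ι : Type*) where
  tree : SimpleGraph ι
  isTree : tree.IsTree
  bag : ι → Finset V
  vertex_mem : ∀ v, ∃ t, v ∈ bag t
  edge_mem : ∀ u v, G.Adj u v → ∃ t, u ∈ bag t ∧ v ∈ bag t
  connected : ∀ v, (tree.induce {t | v ∈ bag t}).Connected

namespace TreeDecomposition

variable {V ι : Type*} {G : SimpleGraph V}

/-- Bags of distinct, non-adjacent nodes are disjoint. -/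
def IsDomino (D : TreeDecomposition G ι) : Prop :=
  ∀ i j, i ≠ j → ¬ D.tree.Adj i j → Disjoint (D.bag i) (D.bag j)

/-- The width: the largest size of a bag, minus one (and `0` if all bags are empty). -/
def width [Fintype ι] (D : TreeDecomposition G ι) : ℕ :=
  (Finset.univ.sup fun t => (D.bag t).card) - 1

end TreeDecomposition

/-! ## Random access machines with uniform cost -/

namespace RAM

/-- A configuration: registers and memory cells, each holding a natural number. -/
structure State where
  reg : ℕ → ℕ
  mem : ℕ → ℕ

/-- Programs. The arguments `r`, `a`, `b` are (fixed) names of registers. A program mentions only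
finitely many registers; the memory is accessed by indirect addressing. -/
inductive Prog where
  /-- do nothing -/
  | skip : Prog
  /-- register `r` becomes the constant `c` -/
  | const (r c : ℕ) : Prog
  /-- register `r` becomes the sum of registers `a` and `b` -/
  | sum (r a b : ℕ) : Prog
  /-- register `r` becomes the truncated difference of registers `a` and `b` -/
  | diff (r a b : ℕ) : Prog
  /-- register `r` becomes the content of the memory cell whose address is in register `a` -/
  | load (r a : ℕ) : Prog
  /-- the memory cell whose address is in register `a` gets the content of register `b` -/
  | store (a b : ℕ) : Prog
  /-- run `p`, then `q` -/
  | seq (p q : Prog) : Prog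
  /-- run `p` if register `a` is less than register `b`, and `q` otherwise -/
  | ifLt (a b : ℕ) (p q : Prog) : Prog
  /-- repeat `p` as long as register `a` is less than register `b` -/
  | whileLt (a b : ℕ) (p : Prog) : Prog

/-- `Exec p σ t τ`: started in `σ`, the program `p` halts in `τ` after exactly `t` steps. Every
elementary instruction and every evaluation of a test is one step. -/
inductive Exec : Prog → State → ℕ → State → Prop where
  | skip (σ : State) : Exec Prog.skip σ 1 σ
  | const (r c : ℕ) (σ : State) :
      Exec (Prog.const r c) σ 1 ⟨Function.update σ.reg r c, σ.mem⟩
  | sum (r a b : ℕ) (σ : State) :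
      Exec (Prog.sum r a b) σ 1 ⟨Function.update σ.reg r (σ.reg a + σ.reg b), σ.mem⟩
  | diff (r a b : ℕ) (σ : State) :
      Exec (Prog.diff r a b) σ 1 ⟨Function.update σ.reg r (σ.reg a - σ.reg b), σ.mem⟩
  | load (r a : ℕ) (σ : State) :
      Exec (Prog.load r a) σ 1 ⟨Function.update σ.reg r (σ.mem (σ.reg a)), σ.mem⟩
  | store (a b : ℕ) (σ : State) :
      Exec (Prog.store a b) σ 1 ⟨σ.reg, Function.update σ.mem (σ.reg a) (σ.reg b)⟩
  | seq {p q : Prog} {σ σ' τ : State} {s t : ℕ} :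
      Exec p σ s σ' → Exec q σ' t τ → Exec (Prog.seq p q) σ (s + t) τ
  | ifTrue {a b : ℕ} {p q : Prog} {σ τ : State} {t : ℕ} :
      σ.reg a < σ.reg b → Exec p σ t τ → Exec (Prog.ifLt a b p q) σ (1 + t) τ
  | ifFalse {a b : ℕ} {p q : Prog} {σ τ : State} {t : ℕ} :
      ¬ σ.reg a < σ.reg b → Exec q σ t τ → Exec (Prog.ifLt a b p q) σ (1 + t) τ
  | whileTrue {a b : ℕ} {p : Prog} {σ σ' τ : State} {s t : ℕ} :
      σ.reg a < σ.reg b → Exec p σ s σ' → Exec (Prog.whileLt a b p) σ' t τ →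
        Exec (Prog.whileLt a b p) σ (1 + s + t) τ
  | whileFalse {a b : ℕ} {p : Prog} {σ : State} :
      ¬ σ.reg a < σ.reg b → Exec (Prog.whileLt a b p) σ 1 σ

/-- The initial configuration: the input word `x` is in the memory cells `0, 1, 2, …`, one entry
per cell; all other cells and all registers are `0`. -/
def initial (x : List ℕ) : State := ⟨fun _ => 0, fun i => x.getD i 0⟩

end RAM

/-! ## Inputs -/

/-- `l` lists the elements of `s`, each once, in any order. -/
def ListsSet {α : Type*} (l : List α) (s : Set α) : Prop :=
  l.Nodup ∧ ∀ x, x ∈ l ↔ x ∈ s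

/-- An adjacency-list representation of a signed graph on `{0, …, n-1}` together with a tree
decomposition of its underlying graph with nodes `{0, …, N-1}`. The tree is not rooted and the
lists may be in any order. -/
structure InputLists {n N : ℕ} (G : SignedGraph (Fin n))
    (D : TreeDecomposition G.underlying (Fin N)) where
  posList : Fin n → List (Fin n)
  negList : Fin n → List (Fin n)
  bagList : Fin N → List (Fin n)
  treeList : Fin N → List (Fin N)
  pos_spec : ∀ v, ListsSet (posList v) {u | G.pos.Adj v u}
  neg_spec : ∀ v, ListsSet (negList v) {u | G.neg.Adj v u}
  bag_spec : ∀ t, ListsSet (bagList t) {v | v ∈ D.bag t}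
  tree_spec : ∀ t, ListsSet (treeList t) {s | D.tree.Adj t s}

/-- A list of numbers, preceded by its length. -/
def lengthPrefixed {m : ℕ} (l : List (Fin m)) : List ℕ := l.length :: l.map Fin.val

/-- The input word: `n`, `k`, `N`; then for each vertex the list of its positive and the list of
its negative neighbours; then the bags; then for each node of the tree the list of its
neighbours. -/
def InputLists.encode {n N : ℕ} {G : SignedGraph (Fin n)}
    {D : TreeDecomposition G.underlying (Fin N)} (I : InputLists G D) (k : ℕ) : List ℕ :=
  [n, k, N]
    ++ (List.finRange n).flatMap (fun v => lengthPrefixed (I.posList v) ++ lengthPrefixed (I.negList v))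
    ++ (List.finRange N).flatMap (fun t => lengthPrefixed (I.bagList t))
    ++ (List.finRange N).flatMap (fun t => lengthPrefixed (I.treeList t))

/-!
# Offensive alliances on graphs with a domino tree decomposition

**The dynamic program.** Root the tree. In a domino tree decomposition a vertex `v` lies in at most
two bags, a node `low v` and possibly its parent, so these two bags contain all neighbours of `v`.
Hence the conditions for `S` to be an offensive alliance split into conditions at the nodes `u`,
where the condition at `u` concerns the vertices with `low v = u` and depends only on how `S` meets
the bag of `u` and that of its parent. The same holds for the size of `S`; violated conditions are
charged `n + 1`, so that the cheapest sets are the smallest alliances. Processing the nodes from the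
leaves to the root, a node sends its parent, for every subset of the parent's bag, the least cost of
a compatible subset of its own bag. There are at most `2 ^ (2 d + 2)` pairs of subsets, and a pair
is evaluated in time `O(d ^ 2)`.

Correctness is proved for the tables of all unprocessed bags jointly, which avoids subtrees: by
`DominoDP.Layout.Valid.inv_step`, the sum of their entries for a set `s`, as long as it is at most
the number of vertices, is the least cost, over the processed part, of a set that agrees with `s`
on the unprocessed bags. Non-emptiness needs no extra state: at the first bag that a set meets, the
parent's bag is not met, and by `DominoDP.Layout.Valid.ans_spec` it suffices to minimize over such
situations.

**The traversal.** Breadth-first search from node `0` numbers the nodes. As the tree has `N - 1`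
edges, each of them joins a node and its parent (`AllianceProgram.IsInstance.parent_eq`), so that
bags that meet belong to a parent and a child. The adjacency lists of the tree have total length
`2 (N - 1)`, which bounds the time.

**The machine.** The algorithm is written in a language of bounded loops with variables and arrays,
whose semantics and cost are recursive functions. `BoundedLoop.Cmd.compile_runs` translates it into
machine programs with a constant factor in time; the arrays are interleaved in the memory above an
address that exceeds the length of the input. If no bag is empty, then `N ≤ 2 n`, as every vertex
lies in at most two bags; this gives the second time bound.
-/

/-! ### A language of bounded loops and its translation into machine programs -/

namespace RAM

/-- Started in `σ`, the program `p` halts within `T` steps in a configuration satisfying `Q`. -/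
def Runs (p : Prog) (σ : State) (T : ℕ) (Q : State → Prop) : Prop :=
  ∃ t τ, Exec p σ t τ ∧ t ≤ T ∧ Q τ

namespace Runs

variable {p q : Prog} {σ : State} {T T' : ℕ} {Q Q' : State → Prop}

theorem mono (h : Runs p σ T Q) (hT : T ≤ T') (hQ : ∀ τ, Q τ → Q' τ) : Runs p σ T' Q' := by
  obtain ⟨t, τ, h1, h2, h3⟩ := h
  exact ⟨t, τ, h1, h2.trans hT, hQ _ h3⟩

theorem seq (h : Runs p σ T fun τ => Runs q τ T' Q) : Runs (p.seq q) σ (T + T') Q := by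
  obtain ⟨t, τ, h1, h2, t', τ', h1', h2', h3⟩ := h
  exact ⟨_, _, h1.seq h1', Nat.add_le_add h2 h2', h3⟩

theorem const {r c : ℕ} (h : Q ⟨Function.update σ.reg r c, σ.mem⟩) :
    Runs (Prog.const r c) σ 1 Q := ⟨_, _, Exec.const r c σ, le_rfl, h⟩

theorem sum {r a b : ℕ} (h : Q ⟨Function.update σ.reg r (σ.reg a + σ.reg b), σ.mem⟩) :
    Runs (Prog.sum r a b) σ 1 Q := ⟨_, _, Exec.sum r a b σ, le_rfl, h⟩

theorem diff {r a b : ℕ} (h : Q ⟨Function.update σ.reg r (σ.reg a - σ.reg b), σ.mem⟩) :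
    Runs (Prog.diff r a b) σ 1 Q := ⟨_, _, Exec.diff r a b σ, le_rfl, h⟩

theorem load {r a : ℕ} (h : Q ⟨Function.update σ.reg r (σ.mem (σ.reg a)), σ.mem⟩) :
    Runs (Prog.load r a) σ 1 Q := ⟨_, _, Exec.load r a σ, le_rfl, h⟩

theorem store {a b : ℕ} (h : Q ⟨σ.reg, Function.update σ.mem (σ.reg a) (σ.reg b)⟩) :
    Runs (Prog.store a b) σ 1 Q := ⟨_, _, Exec.store a b σ, le_rfl, h⟩

theorem ifLt {a b : ℕ} (h₁ : σ.reg a < σ.reg b → Runs p σ T Q)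
    (h₂ : ¬ σ.reg a < σ.reg b → Runs q σ T Q) : Runs (Prog.ifLt a b p q) σ (1 + T) Q := by
  by_cases h : σ.reg a < σ.reg b
  · obtain ⟨t, τ, h1, h2, h3⟩ := h₁ h
    exact ⟨_, _, Exec.ifTrue h h1, by omega, h3⟩
  · obtain ⟨t, τ, h1, h2, h3⟩ := h₂ h
    exact ⟨_, _, Exec.ifFalse h h1, by omega, h3⟩

/-- A loop that makes exactly `m` rounds, where `Inv i` holds before round `i`. -/
theorem whileLt {a b m : ℕ} (Inv : ℕ → State → Prop) (T : ℕ → ℕ)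
    (hstep : ∀ i < m, ∀ σ, Inv i σ → σ.reg a < σ.reg b ∧ Runs p σ (T i) (Inv (i + 1)))
    (hend : ∀ σ, Inv m σ → ¬ σ.reg a < σ.reg b) (h0 : Inv 0 σ) :
    Runs (Prog.whileLt a b p) σ (1 + ∑ i ∈ Finset.range m, (1 + T i)) (Inv m) := by
  suffices H : ∀ j i, i + j = m → ∀ σ, Inv i σ →
      Runs (Prog.whileLt a b p) σ (1 + ∑ l ∈ Finset.Ico i m, (1 + T l)) (Inv m) by
    rw [Finset.range_eq_Ico]
    exact H m 0 (Nat.zero_add m) σ h0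
  intro j
  induction j with
  | zero =>
    intro i hi σ hσ
    obtain rfl : i = m := by simpa using hi
    exact ⟨1, σ, Exec.whileFalse (hend σ hσ), by omega, hσ⟩
  | succ j ih =>
    intro i hi σ hσ
    obtain ⟨hlt, t, τ, h1, h2, h3⟩ := hstep i (by omega) σ hσ
    obtain ⟨t', τ', h1', h2', h3'⟩ := ih (i + 1) (by omega) τ h3
    refine ⟨_, _, Exec.whileTrue hlt h1 h1', ?_, h3'⟩
    rw [Finset.sum_eq_sum_Ico_succ_bot (by omega : i < m)]
    omega

end Runs

end RAM

namespace BoundedLoop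

/-- Expressions over scalar variables `X` and arrays `A`; `inp e` is entry `e` of the read-only
input word, and `sub` is truncated. -/
inductive Expr (X A : Type) where
  | var (x : X)
  | lit (c : ℕ)
  | add (e f : Expr X A)
  | sub (e f : Expr X A)
  | inp (e : Expr X A)
  | arr (a : A) (e : Expr X A)

/-- Commands. `ite e f p q` tests whether `e < f`; `loop x e p` runs `p` for `x = 0, 1, …`, as often
as the value of `e` before the loop says. Hence every command terminates. -/
inductive Cmd (X A : Type) where
  | skip
  | set (x : X) (e : Expr X A)
  | put (a : A) (e f : Expr X A)
  | seq (p q : Cmd X A)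
  | ite (e f : Expr X A) (p q : Cmd X A)
  | loop (x : X) (e : Expr X A) (p : Cmd X A)

/-- Values of the variables and contents of the (infinite) arrays. -/
structure Store (X A : Type) where
  var : X → ℕ
  arr : A → ℕ → ℕ

variable {X A : Type}

/-- Assignment to a variable. -/
def Store.set [DecidableEq X] (s : Store X A) (x : X) (c : ℕ) : Store X A :=
  ⟨Function.update s.var x c, s.arr⟩

/-- Assignment to an array entry. -/
def Store.put [DecidableEq A] (s : Store X A) (a : A) (i c : ℕ) : Store X A :=
  ⟨s.var, Function.update s.arr a (Function.update (s.arr a) i c)⟩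

/-- `iterate f m s` applies `f 0`, `f 1`, …, `f (m - 1)` to `s`, in this order. -/
def iterate {α : Type*} (f : ℕ → α → α) : ℕ → α → α
  | 0, s => s
  | m + 1, s => f m (iterate f m s)

/-- The value of an expression; `w` is the input word. -/
def Expr.eval (w : ℕ → ℕ) (s : Store X A) : Expr X A → ℕ
  | var x => s.var x
  | lit c => c
  | add e f => e.eval w s + f.eval w s
  | sub e f => e.eval w s - f.eval w s
  | inp e => w (e.eval w s)
  | arr a e => s.arr a (e.eval w s)

/-- The store after the execution of a command. -/
def Cmd.run [DecidableEq X] [DecidableEq A] (w : ℕ → ℕ) : Cmd X A → Store X A → Store X A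
  | skip, s => s
  | set x e, s => s.set x (e.eval w s)
  | put a e f, s => s.put a (e.eval w s) (f.eval w s)
  | seq p q, s => q.run w (p.run w s)
  | ite e f p q, s => if e.eval w s < f.eval w s then p.run w s else q.run w s
  | loop x e p, s => iterate (fun i s => p.run w (s.set x i)) (e.eval w s) s

/-- The number of commands executed, where each round of a loop counts one extra. -/
def Cmd.cost [DecidableEq X] [DecidableEq A] (w : ℕ → ℕ) : Cmd X A → Store X A → ℕ
  | skip, _ => 1
  | set _ _, _ => 1
  | put _ _ _, _ => 1
  | seq p q, s => p.cost w s + q.cost w (p.run w s)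
  | ite e f p q, s => 1 + if e.eval w s < f.eval w s then p.cost w s else q.cost w s
  | loop x e p, s => 1 + ∑ i ∈ Finset.range (e.eval w s),
      (1 + p.cost w ((iterate (fun i s => p.run w (s.set x i)) i s).set x i))

/-- The machine register for intermediate value number `h`. Variables live in even registers, so
these registers are free. -/
def tmp (h : ℕ) : ℕ := 2 * h + 5

/-- Code that replaces the value `i` in `tmp h` by the address of entry `i` of array number `j`. The
arrays are interleaved above the address `B` kept in register `3`: the entry is at `B + 16 i + j`. -/
def address (h j : ℕ) : RAM.Prog :=
  (RAM.Prog.sum (tmp h) (tmp h) (tmp h)).seq <| (RAM.Prog.sum (tmp h) (tmp h) (tmp h)).seq <|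
  (RAM.Prog.sum (tmp h) (tmp h) (tmp h)).seq <| (RAM.Prog.sum (tmp h) (tmp h) (tmp h)).seq <|
  (RAM.Prog.sum (tmp h) (tmp h) 3).seq <| (RAM.Prog.const (tmp (h + 1)) j).seq <|
  RAM.Prog.sum (tmp h) (tmp h) (tmp (h + 1))

/-- Code that computes an expression into `tmp h`, leaving `tmp i` alone for `i < h`. Reading the
input word at or above `B` yields `0` without looking at the memory, which holds arrays there. -/
def Expr.compile (ix : X → ℕ) (ia : A → ℕ) : Expr X A → ℕ → RAM.Prog
  | var x, h => (RAM.Prog.const (tmp h) 0).seq (RAM.Prog.sum (tmp h) (tmp h) (2 * ix x))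
  | lit c, h => RAM.Prog.const (tmp h) c
  | add e f, h => (e.compile ix ia h).seq <| (f.compile ix ia (h + 1)).seq <|
      RAM.Prog.sum (tmp h) (tmp h) (tmp (h + 1))
  | sub e f, h => (e.compile ix ia h).seq <| (f.compile ix ia (h + 1)).seq <|
      RAM.Prog.diff (tmp h) (tmp h) (tmp (h + 1))
  | inp e, h => (e.compile ix ia h).seq <|
      RAM.Prog.ifLt (tmp h) 3 (RAM.Prog.load (tmp h) (tmp h)) (RAM.Prog.const (tmp h) 0)
  | arr a e, h => (e.compile ix ia h).seq <| (address h (ia a)).seq <|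
      RAM.Prog.load (tmp h) (tmp h)

/-- Machine code for a command; it leaves `tmp i` alone for `i < h`. -/
def Cmd.compile (ix : X → ℕ) (ia : A → ℕ) : Cmd X A → ℕ → RAM.Prog
  | skip, _ => RAM.Prog.skip
  | set x e, h => (e.compile ix ia h).seq <| (RAM.Prog.const (tmp (h + 1)) 0).seq <|
      RAM.Prog.sum (2 * ix x) (tmp h) (tmp (h + 1))
  | put a e f, h => (e.compile ix ia h).seq <| (address h (ia a)).seq <|
      (f.compile ix ia (h + 1)).seq <| RAM.Prog.store (tmp h) (tmp (h + 1))
  | seq p q, h => (p.compile ix ia h).seq (q.compile ix ia h)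
  | ite e f p q, h => (e.compile ix ia h).seq <| (f.compile ix ia (h + 1)).seq <|
      RAM.Prog.ifLt (tmp h) (tmp (h + 1)) (p.compile ix ia h) (q.compile ix ia h)
  | loop x e p, h => (e.compile ix ia h).seq <| (RAM.Prog.const (tmp (h + 1)) 0).seq <|
      RAM.Prog.whileLt (tmp (h + 1)) (tmp h) <|
        (RAM.Prog.const (tmp (h + 2)) 0).seq <|
        (RAM.Prog.sum (2 * ix x) (tmp (h + 1)) (tmp (h + 2))).seq <|
        (p.compile ix ia (h + 2)).seq <|
        (RAM.Prog.const (tmp (h + 2)) 1).seq <|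
        RAM.Prog.sum (tmp (h + 1)) (tmp (h + 1)) (tmp (h + 2))

/-- The number of machine steps that compute an expression. -/
def Expr.steps : Expr X A → ℕ
  | var _ => 2
  | lit _ => 1
  | add e f => e.steps + f.steps + 1
  | sub e f => e.steps + f.steps + 1
  | inp e => e.steps + 2
  | arr _ e => e.steps + 8

/-- A bound for the number of machine steps per unit of `Cmd.cost`. -/
def Cmd.weight : Cmd X A → ℕ
  | skip => 1
  | set _ e => e.steps + 2
  | put _ e f => e.steps + f.steps + 8
  | seq p q => p.weight + q.weight
  | ite e f p q => e.steps + f.steps + 1 + p.weight + q.weight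
  | loop _ e p => e.steps + 5 + p.weight

/-- The machine configuration `σ` represents the store `s`. -/
structure Represents (ix : X → ℕ) (ia : A → ℕ) (w : ℕ → ℕ) (B : ℕ) (s : Store X A)
    (σ : RAM.State) : Prop where
  var : ∀ x, σ.reg (2 * ix x) = s.var x
  base : σ.reg 3 = B
  inp : ∀ i < B, σ.mem i = w i
  arr : ∀ a i, σ.mem (B + 16 * i + ia a) = s.arr a i

/-- Two configurations differ at most in `tmp i` with `i ≥ h`. -/
def Agree (h : ℕ) (σ τ : RAM.State) : Prop :=
  τ.mem = σ.mem ∧ ∀ r, r % 2 = 0 ∨ r < tmp h → τ.reg r = σ.reg r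

variable {ix : X → ℕ} {ia : A → ℕ} {w : ℕ → ℕ} {B : ℕ}

theorem Represents.of_agree {s : Store X A} {σ τ : RAM.State} {h : ℕ}
    (hs : Represents ix ia w B s σ) (ha : Agree h σ τ) : Represents ix ia w B s τ where
  var x := by rw [ha.2 _ (Or.inl (by omega)), hs.var]
  base := by rw [ha.2 _ (Or.inr (by unfold tmp; omega)), hs.base]
  inp i hi := by rw [ha.1, hs.inp i hi]
  arr a i := by rw [ha.1, hs.arr]

theorem Agree.trans {h h' : ℕ} {σ τ υ : RAM.State} (h1 : Agree h σ τ) (h2 : Agree h' τ υ)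
    (hh : h ≤ h') : Agree h σ υ :=
  ⟨h2.1.trans h1.1, fun r hr => by
    rw [h2.2 r (hr.imp id fun h => h.trans_le (by unfold tmp; omega)), h1.2 r hr]⟩

theorem address_runs {σ : RAM.State} {h j : ℕ} :
    RAM.Runs (address h j) σ 7 fun τ =>
      τ.reg (tmp h) = σ.reg 3 + 16 * σ.reg (tmp h) + j ∧ Agree h σ τ := by
  unfold address
  refine (RAM.Runs.seq <| RAM.Runs.sum <| RAM.Runs.seq <| RAM.Runs.sum <| RAM.Runs.seq <|
    RAM.Runs.sum <| RAM.Runs.seq <| RAM.Runs.sum <| RAM.Runs.seq <| RAM.Runs.sum <|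
    RAM.Runs.seq <| RAM.Runs.const <| RAM.Runs.sum ?_ : RAM.Runs _ _ (1+(1+(1+(1+(1+(1+1)))))) _)
  refine ⟨?_, rfl, fun r hr => ?_⟩
  · have h1 : tmp h ≠ tmp (h + 1) := by unfold tmp; omega
    have h2 : 3 ≠ tmp h := by unfold tmp; omega
    simp [h1, h2]
    ring
  · have h1 : r ≠ tmp h := by unfold tmp at *; omega
    have h2 : r ≠ tmp (h + 1) := by unfold tmp at *; omega
    simp [Function.update_apply, h1, h2]

theorem Expr.compile_runs (hw : ∀ i, B ≤ i → w i = 0) (e : Expr X A) (h : ℕ) {s : Store X A}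
    {σ : RAM.State} (hs : Represents ix ia w B s σ) :
    RAM.Runs (e.compile ix ia h) σ e.steps fun τ =>
      τ.reg (tmp h) = e.eval w s ∧ Agree h σ τ := by
  have hne : tmp h ≠ tmp (h + 1) := by unfold tmp; omega
  have hne2 : ∀ r, (r % 2 = 0 ∨ r < tmp h) → r ≠ tmp h ∧ r ≠ tmp (h + 1) := by
    intro r hr; unfold tmp at *; omega
  induction e generalizing h σ with
  | var x =>
    refine RAM.Runs.seq <| RAM.Runs.const <| RAM.Runs.sum ⟨?_, rfl, fun r hr => ?_⟩
    · have h1 : 2 * ix x ≠ tmp h := by unfold tmp; omega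
      simp [h1, hs.var, Expr.eval]
    · simp [hne2 r hr]
  | lit c =>
    refine RAM.Runs.const ⟨by simp [Expr.eval], rfl, fun r hr => ?_⟩
    simp [hne2 r hr]
  | add e f ihe ihf =>
    refine (RAM.Runs.seq ((ihe h hs hne hne2).mono le_rfl fun τ hτ => RAM.Runs.seq
      ((ihf (h + 1) (hs.of_agree hτ.2) (by unfold tmp; omega)
        (by intro r hr; unfold tmp at *; omega)).mono le_rfl
        fun υ hυ => RAM.Runs.sum ?_))).mono (by simp only [Expr.steps]; omega) fun _ h => h
    refine ⟨?_, hυ.2.1.trans hτ.2.1, fun r hr => ?_⟩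
    · simp only [Function.update_self, hυ.1, Expr.eval]
      rw [hυ.2.2 _ (Or.inr (by unfold tmp; omega)), hτ.1]
    · simp only [Function.update_of_ne (hne2 r hr).1]
      exact (hτ.2.trans hυ.2 (Nat.le_succ h)).2 r hr
  | sub e f ihe ihf =>
    refine (RAM.Runs.seq ((ihe h hs hne hne2).mono le_rfl fun τ hτ => RAM.Runs.seq
      ((ihf (h + 1) (hs.of_agree hτ.2) (by unfold tmp; omega)
        (by intro r hr; unfold tmp at *; omega)).mono le_rfl
        fun υ hυ => RAM.Runs.diff ?_))).mono (by simp only [Expr.steps]; omega) fun _ h => h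
    refine ⟨?_, hυ.2.1.trans hτ.2.1, fun r hr => ?_⟩
    · simp only [Function.update_self, hυ.1, Expr.eval]
      rw [hυ.2.2 _ (Or.inr (by unfold tmp; omega)), hτ.1]
    · simp only [Function.update_of_ne (hne2 r hr).1]
      exact (hτ.2.trans hυ.2 (Nat.le_succ h)).2 r hr
  | inp e ih =>
    refine RAM.Runs.seq ((ih h hs hne hne2).mono le_rfl fun τ hτ => ?_)
    have hb : τ.reg 3 = B := (hs.of_agree hτ.2).base
    refine RAM.Runs.ifLt (T := 1) (fun hlt => RAM.Runs.load ⟨?_, hτ.2.1, fun r hr => ?_⟩)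
      (fun hlt => RAM.Runs.const ⟨?_, hτ.2.1, fun r hr => ?_⟩)
    · rw [hb] at hlt
      simp only [Function.update_self, Expr.eval]
      rw [(hs.of_agree hτ.2).inp _ hlt, hτ.1]
    · simp only [Function.update_of_ne (hne2 r hr).1]; exact hτ.2.2 r hr
    · rw [hb, hτ.1] at hlt
      simp only [Function.update_self, Expr.eval]
      rw [hw _ (by omega)]
    · simp only [Function.update_of_ne (hne2 r hr).1]; exact hτ.2.2 r hr
  | arr a e ih =>
    refine (RAM.Runs.seq ((ih h hs hne hne2).mono le_rfl fun τ hτ => RAM.Runs.seq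
      (address_runs.mono le_rfl fun υ hυ => RAM.Runs.load ?_))).mono
        (by simp only [Expr.steps]; omega) fun _ h => h
    refine ⟨?_, hυ.2.1.trans hτ.2.1, fun r hr => ?_⟩
    · simp only [Function.update_self, Expr.eval]
      rw [hυ.2.1, hυ.1, hτ.1, (hs.of_agree hτ.2).base, (hs.of_agree hτ.2).arr]
    · simp only [Function.update_of_ne (hne2 r hr).1]
      exact (hτ.2.trans hυ.2 le_rfl).2 r hr

/-- The compiled code simulates a command; the number of machine steps is bounded by a multiple of
the cost, and the factor depends on the command only. -/
theorem Cmd.compile_runs [DecidableEq X] [DecidableEq A] (hw : ∀ i, B ≤ i → w i = 0)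
    (hix : Function.Injective ix)
    (hia : Function.Injective ia) (hia' : ∀ a, ia a < 16) (p : Cmd X A) (h : ℕ) {s : Store X A}
    {σ : RAM.State} (hs : Represents ix ia w B s σ) :
    RAM.Runs (p.compile ix ia h) σ (p.weight * p.cost w s) fun τ =>
      Represents ix ia w B (p.run w s) τ ∧ ∀ i < h, τ.reg (tmp i) = σ.reg (tmp i) := by
  have hset : ∀ {s : Store X A} {σ : RAM.State} (x : X) (c : ℕ), Represents ix ia w B s σ →
      Represents ix ia w B (s.set x c) ⟨Function.update σ.reg (2 * ix x) c, σ.mem⟩ := by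
    intro s σ x c hs
    refine ⟨fun y => ?_, ?_, hs.inp, hs.arr⟩
    · by_cases hxy : y = x
      · subst hxy; simp [Store.set]
      · have : 2 * ix y ≠ 2 * ix x := fun h => hxy (hix (by omega))
        simp [Store.set, hxy, this, hs.var]
    · simp only
      rw [Function.update_of_ne (by omega), hs.base]
  induction p generalizing h s σ with
  | skip => exact ⟨1, σ, RAM.Exec.skip σ, by simp [Cmd.weight, Cmd.cost], hs, fun _ _ => rfl⟩
  | set x e =>
    refine (RAM.Runs.seq ((e.compile_runs hw h hs).mono le_rfl fun τ hτ => RAM.Runs.seq <|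
      RAM.Runs.const <| RAM.Runs.sum ?_)).mono
        (by simp only [Cmd.weight, Cmd.cost]; omega) fun _ h => h
    have h1 : tmp h ≠ tmp (h + 1) := by unfold tmp; omega
    have hag : Agree h σ ⟨Function.update τ.reg (tmp (h + 1)) 0, τ.mem⟩ := by
      refine ⟨hτ.2.1, fun r hr => ?_⟩
      rw [← hτ.2.2 r hr]
      exact Function.update_of_ne (by unfold tmp at *; omega) _ _
    have := hset x (e.eval w s) (hs.of_agree hag)
    simp only [Function.update_self, Function.update_of_ne h1, hτ.1, add_zero]
    refine ⟨this, fun i hi => ?_⟩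
    rw [Function.update_of_ne (by unfold tmp; omega)]
    exact hag.2 _ (Or.inr (by unfold tmp; omega))
  | put a e f =>
    refine (RAM.Runs.seq ((e.compile_runs hw h hs).mono le_rfl fun τ hτ => RAM.Runs.seq
      (address_runs.mono le_rfl fun υ hυ => RAM.Runs.seq
      ((f.compile_runs hw (h + 1) (hs.of_agree (hτ.2.trans hυ.2 le_rfl))).mono le_rfl
        fun ρ hρ => RAM.Runs.store ?_)))).mono
        (by simp only [Cmd.weight, Cmd.cost]; omega) fun _ h => h
    have hag : Agree h σ ρ := (hτ.2.trans hυ.2 le_rfl).trans hρ.2 (Nat.le_succ h)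
    have hρs := hs.of_agree hag
    rw [hρ.1, hρ.2.2 _ (Or.inr (by unfold tmp; omega)), hυ.1, hτ.1, (hs.of_agree hτ.2).base]
    refine ⟨⟨hρs.var, hρs.base, fun i hi => ?_, fun b i => ?_⟩, fun i hi =>
      hag.2 _ (Or.inr (by unfold tmp; omega))⟩
    · simp only
      rw [Function.update_of_ne (by omega)]
      exact hρs.inp i hi
    · simp only [Cmd.run, Store.put]
      by_cases hb : b = a
      · subst hb
        by_cases hi : i = e.eval w s
        · subst hi; simp
        · rw [Function.update_of_ne (by omega), Function.update_self, Function.update_of_ne hi,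
            hρs.arr]
      · have : ia b ≠ ia a := fun h => hb (hia h)
        have h1 := hia' a
        have h2 := hia' b
        rw [Function.update_of_ne (by omega), Function.update_of_ne hb, hρs.arr]
  | seq p q ihp ihq =>
    refine (RAM.Runs.seq ((ihp h hs).mono le_rfl fun τ hτ =>
      ((ihq h hτ.1).mono le_rfl fun υ hυ => ⟨hυ.1, fun i hi => (hυ.2 i hi).trans (hτ.2 i hi)⟩))).mono
        ?_ fun _ h => h
    simp only [Cmd.weight, Cmd.cost]
    nlinarith [Nat.zero_le (p.weight * q.cost w (p.run w s)), Nat.zero_le (q.weight * p.cost w s)]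
  | ite e f p q ihp ihq =>
    refine (RAM.Runs.seq ((e.compile_runs hw h hs).mono le_rfl fun τ hτ => RAM.Runs.seq
      ((f.compile_runs hw (h + 1) (hs.of_agree hτ.2)).mono le_rfl fun υ hυ => RAM.Runs.ifLt
        (T := if e.eval w s < f.eval w s then p.weight * p.cost w s else q.weight * q.cost w s)
        (fun hlt => ?_) (fun hlt => ?_)))).mono ?_ fun _ h => h
    rotate_left 2
    · simp only [Cmd.weight, Cmd.cost]
      split_ifs
      · nlinarith [Nat.zero_le (p.cost w s), Nat.zero_le ((e.steps + f.steps + 1) * p.cost w s),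
          Nat.zero_le (q.weight * p.cost w s)]
      · nlinarith [Nat.zero_le (q.cost w s), Nat.zero_le ((e.steps + f.steps + 1) * q.cost w s),
          Nat.zero_le (p.weight * q.cost w s)]
    all_goals
      have hag : Agree h σ υ := hτ.2.trans hυ.2 (Nat.le_succ h)
      rw [hυ.1, hυ.2.2 _ (Or.inr (by unfold tmp; omega)), hτ.1] at hlt
      simp only [hlt, if_true, if_false, Cmd.run]
    · exact (ihp h (hs.of_agree hag)).mono le_rfl fun ρ hρ =>
        ⟨hρ.1, fun i hi => (hρ.2 i hi).trans (hag.2 _ (Or.inr (by unfold tmp; omega)))⟩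
    · exact (ihq h (hs.of_agree hag)).mono le_rfl fun ρ hρ =>
        ⟨hρ.1, fun i hi => (hρ.2 i hi).trans (hag.2 _ (Or.inr (by unfold tmp; omega)))⟩
  | loop x e p ih =>
    set m := e.eval w s with hm
    set st : ℕ → Store X A := fun i => iterate (fun i s => p.run w (s.set x i)) i s with hst
    refine (RAM.Runs.seq ((e.compile_runs hw h hs).mono le_rfl fun τ hτ => RAM.Runs.seq <|
      RAM.Runs.const <| (RAM.Runs.whileLt (m := m)
        (fun i ρ => Represents ix ia w B (st i) ρ ∧ ρ.reg (tmp h) = m ∧ ρ.reg (tmp (h + 1)) = i ∧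
          ∀ i < h, ρ.reg (tmp i) = σ.reg (tmp i))
        (fun i => 1 + (1 + (p.weight * p.cost w ((st i).set x i) + (1 + 1))))
        (fun i hi ρ hρ => ?_) (fun ρ hρ => ?_) ?_).mono le_rfl
        fun ρ hρ => ?_)).mono ?_ fun _ h => h
    · obtain ⟨h1, h2, h3, h4⟩ := hρ
      refine ⟨by omega, RAM.Runs.seq <| RAM.Runs.const <| RAM.Runs.seq <| RAM.Runs.sum ?_⟩
      have ht : tmp (h + 1) ≠ tmp (h + 2) := by unfold tmp; omega
      have hag : Agree (h + 2) ρ ⟨Function.update ρ.reg (tmp (h + 2)) 0, ρ.mem⟩ :=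
        ⟨rfl, fun r hr => Function.update_of_ne (by unfold tmp at *; omega) _ _⟩
      have hrep := hset x i (h1.of_agree hag)
      simp only [Function.update_self, Function.update_of_ne ht, h3, add_zero]
      refine RAM.Runs.seq ((ih (h + 2) hrep).mono le_rfl fun υ hυ => RAM.Runs.seq <|
        RAM.Runs.const <| RAM.Runs.sum ?_)
      have hag2 : Agree (h + 2) υ ⟨Function.update υ.reg (tmp (h + 2)) 1, υ.mem⟩ :=
        ⟨rfl, fun r hr => Function.update_of_ne (by unfold tmp at *; omega) _ _⟩
      have hodd : ∀ j < h + 2, υ.reg (tmp j) = ρ.reg (tmp j) := by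
        intro j hj
        rw [hυ.2 j hj]
        simp only
        rw [Function.update_of_ne (by unfold tmp; omega),
          Function.update_of_ne (by unfold tmp; omega)]
      have hag3 : Agree (h + 1) υ ⟨Function.update (Function.update υ.reg (tmp (h + 2)) 1)
          (tmp (h + 1)) (Function.update υ.reg (tmp (h + 2)) 1 (tmp (h + 1)) +
          Function.update υ.reg (tmp (h + 2)) 1 (tmp (h + 2))), υ.mem⟩ := by
        refine ⟨rfl, fun r hr => ?_⟩
        simp only
        rw [Function.update_of_ne (by unfold tmp at *; omega),
          Function.update_of_ne (by unfold tmp at *; omega)]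
      refine ⟨hυ.1.of_agree hag3, ?_, ?_, fun j hj => ?_⟩
      · rw [hag3.2 _ (Or.inr (by unfold tmp; omega)), hodd _ (by omega), h2]
      · simp only [Function.update_self, Function.update_of_ne ht]
        rw [hodd _ (by omega), h3]
      · rw [hag3.2 _ (Or.inr (by unfold tmp; omega)), hodd _ (by omega), h4 j hj]
    · omega
    · have hag : Agree h σ ⟨Function.update τ.reg (tmp (h + 1)) 0, τ.mem⟩ := by
        refine ⟨hτ.2.1, fun r hr => ?_⟩
        rw [← hτ.2.2 r hr]
        exact Function.update_of_ne (by unfold tmp at *; omega) _ _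
      refine ⟨hs.of_agree hag, ?_, Function.update_self .., fun i hi => ?_⟩
      · simp only
        rw [Function.update_of_ne (by unfold tmp; omega), hτ.1]
      · exact hag.2 _ (Or.inr (by unfold tmp; omega))
    · exact ⟨hρ.1, hρ.2.2.2⟩
    · simp only [Cmd.weight, Cmd.cost, ← hm]
      have : ∑ i ∈ Finset.range m, (1 + (1 + (1 + (p.weight * p.cost w ((st i).set x i) + (1 + 1)))))
          ≤ (e.steps + 5 + p.weight) *
            ∑ i ∈ Finset.range m, (1 + p.cost w ((st i).set x i)) := by
        rw [Finset.mul_sum]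
        refine Finset.sum_le_sum fun i _ => ?_
        nlinarith [Nat.zero_le (e.steps * (1 + p.cost w ((st i).set x i))), Nat.zero_le p.weight,
          Nat.zero_le (5 * p.cost w ((st i).set x i))]
      change _ ≤ _ * (1 + ∑ i ∈ Finset.range m, (1 + p.cost w ((st i).set x i)))
      rw [Nat.mul_add]
      omega

end BoundedLoop

/-! ### Reasoning about bounded loop programs -/

namespace BoundedLoop

variable {X A : Type} {w : ℕ → ℕ}

/-- The variables a command may change. -/
def Cmd.vars : Cmd X A → List X
  | skip => []
  | set x _ => [x]
  | put _ _ _ => []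
  | seq p q => p.vars ++ q.vars
  | ite _ _ p q => p.vars ++ q.vars
  | loop x _ p => x :: p.vars

/-- The arrays a command may change. -/
def Cmd.arrs : Cmd X A → List A
  | skip => []
  | set _ _ => []
  | put a _ _ => [a]
  | seq p q => p.arrs ++ q.arrs
  | ite _ _ p q => p.arrs ++ q.arrs
  | loop _ _ p => p.arrs

/-- `s'` differs from `s` at most in the listed variables and arrays. -/
def Frame (xs : List X) (as : List A) (s s' : Store X A) : Prop :=
  (∀ x, x ∉ xs → s'.var x = s.var x) ∧ ∀ a, a ∉ as → s'.arr a = s.arr a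

theorem Frame.refl (xs : List X) (as : List A) (s : Store X A) : Frame xs as s s :=
  ⟨fun _ _ => rfl, fun _ _ => rfl⟩

theorem Frame.mono {xs ys : List X} {as bs : List A} {s s' : Store X A} (h : Frame xs as s s')
    (hx : ∀ x ∈ xs, x ∈ ys) (ha : ∀ a ∈ as, a ∈ bs) : Frame ys bs s s' :=
  ⟨fun x hx' => h.1 x fun h' => hx' (hx x h'), fun a ha' => h.2 a fun h' => ha' (ha a h')⟩

theorem Frame.trans {xs : List X} {as : List A} {s s' s'' : Store X A} (h : Frame xs as s s')
    (h' : Frame xs as s' s'') : Frame xs as s s'' :=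
  ⟨fun x hx => (h'.1 x hx).trans (h.1 x hx), fun a ha => (h'.2 a ha).trans (h.2 a ha)⟩

theorem Frame.set [DecidableEq X] {xs : List X} {as : List A} {s s' : Store X A}
    (h : Frame xs as s s')
    (x : X) (c : ℕ) (hx : x ∈ xs := by simp) : Frame xs as s (s'.set x c) :=
  ⟨fun y hy => by
    have : y ≠ x := by rintro rfl; exact hy hx
    exact (Function.update_of_ne this _ _).trans (h.1 y hy), h.2⟩

theorem Frame.put [DecidableEq A] {xs : List X} {as : List A} {s s' : Store X A}
    (h : Frame xs as s s')
    (a : A) (i c : ℕ) (ha : a ∈ as := by simp) : Frame xs as s (s'.put a i c) :=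
  ⟨h.1, fun b hb => by
    have : b ≠ a := by rintro rfl; exact hb ha
    exact (Function.update_of_ne this _ _).trans (h.2 b hb)⟩

variable [DecidableEq X] [DecidableEq A]

theorem Cmd.frame (p : Cmd X A) (s : Store X A) : Frame p.vars p.arrs s (p.run w s) := by
  induction p generalizing s with
  | skip => exact ⟨fun _ _ => rfl, fun _ _ => rfl⟩
  | set x e =>
    exact ⟨fun y hy => Function.update_of_ne (by simpa [Cmd.vars] using hy) _ _, fun _ _ => rfl⟩
  | put a e f =>
    exact ⟨fun _ _ => rfl, fun b hb => Function.update_of_ne (by simpa [Cmd.arrs] using hb) _ _⟩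
  | seq p q ihp ihq =>
    refine ⟨fun x hx => ?_, fun a ha => ?_⟩
    · simp only [Cmd.vars, List.mem_append, not_or] at hx
      exact ((ihq _).1 x hx.2).trans ((ihp _).1 x hx.1)
    · simp only [Cmd.arrs, List.mem_append, not_or] at ha
      exact ((ihq _).2 a ha.2).trans ((ihp _).2 a ha.1)
  | ite e f p q ihp ihq =>
    refine ⟨fun x hx => ?_, fun a ha => ?_⟩
    · simp only [Cmd.vars, List.mem_append, not_or] at hx
      simp only [Cmd.run]
      split_ifs
      · exact (ihp _).1 x hx.1
      · exact (ihq _).1 x hx.2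
    · simp only [Cmd.arrs, List.mem_append, not_or] at ha
      simp only [Cmd.run]
      split_ifs
      · exact (ihp _).2 a ha.1
      · exact (ihq _).2 a ha.2
  | loop x e p ih =>
    have key : ∀ m, Frame (x :: p.vars) p.arrs s
        (iterate (fun i s => p.run w (s.set x i)) m s) := by
      intro m
      induction m with
      | zero => exact ⟨fun _ _ => rfl, fun _ _ => rfl⟩
      | succ m ihm =>
        refine ⟨fun y hy => ?_, fun a ha => ?_⟩
        · have hy' := hy
          simp only [List.mem_cons, not_or] at hy
          exact ((ih _).1 y hy.2).trans ((Function.update_of_ne hy.1 _ _).trans (ihm.1 y hy'))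
        · exact ((ih _).2 a ha).trans (ihm.2 a ha)
    exact key _

/-- Started in `s`, the command `p` ends in a store satisfying `Q`, at a cost of at most `T`. That
only the variables and arrays occurring in assignments change is not part of `Q`: `Spec.mono`
supplies it when it weakens the postcondition. -/
def Spec (w : ℕ → ℕ) (p : Cmd X A) (s : Store X A) (T : ℕ) (Q : Store X A → Prop) : Prop :=
  Q (p.run w s) ∧ p.cost w s ≤ T

namespace Spec

variable {p q : Cmd X A} {s : Store X A} {T T' : ℕ} {Q Q' : Store X A → Prop}

theorem mono (h : Spec w p s T Q) (hT : T ≤ T')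
    (hQ : ∀ s', Frame p.vars p.arrs s s' → Q s' → Q' s') : Spec w p s T' Q' :=
  ⟨hQ _ (p.frame s) h.1, h.2.trans hT⟩

theorem mono' (h : Spec w p s T Q) (hT : T ≤ T') : Spec w p s T' Q := ⟨h.1, h.2.trans hT⟩

theorem skip (h : Q s) : Spec w Cmd.skip s 1 Q := ⟨h, le_rfl⟩

theorem set {x : X} {e : Expr X A} (h : Q (s.set x (e.eval w s))) :
    Spec w (Cmd.set x e) s 1 Q := ⟨h, le_rfl⟩

theorem put {a : A} {e f : Expr X A} (h : Q (s.put a (e.eval w s) (f.eval w s))) :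
    Spec w (Cmd.put a e f) s 1 Q := ⟨h, le_rfl⟩

theorem seq (h : Spec w p s T fun s' => Spec w q s' T' Q) : Spec w (p.seq q) s (T + T') Q :=
  ⟨h.1.1, Nat.add_le_add h.2 h.1.2⟩

theorem ite {e f : Expr X A} (h₁ : e.eval w s < f.eval w s → Spec w p s T Q)
    (h₂ : ¬ e.eval w s < f.eval w s → Spec w q s T Q) : Spec w (Cmd.ite e f p q) s (1 + T) Q := by
  by_cases h : e.eval w s < f.eval w s
  · exact ⟨by simpa [Cmd.run, h] using (h₁ h).1, by simpa [Cmd.cost, h] using (h₁ h).2⟩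
  · exact ⟨by simpa [Cmd.run, h] using (h₂ h).1, by simpa [Cmd.cost, h] using (h₂ h).2⟩

/-- The rule for loops: `Inv i` holds before round `i`, which costs at most `T i`. -/
theorem loop {x : X} {e : Expr X A} {m : ℕ} (Inv : ℕ → Store X A → Prop) (T : ℕ → ℕ)
    (hm : e.eval w s = m) (h0 : Inv 0 s)
    (hstep : ∀ i < m, ∀ s', Frame (x :: p.vars) p.arrs s s' → Inv i s' →
      Spec w p (s'.set x i) (T i) (Inv (i + 1))) :
    Spec w (Cmd.loop x e p) s (1 + ∑ i ∈ Finset.range m, (1 + T i)) (Inv m) := by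
  set st : ℕ → Store X A := fun i => iterate (fun i s => p.run w (s.set x i)) i s with hst
  have hfr : ∀ i, Frame (x :: p.vars) p.arrs s (st i) := fun i =>
    (Cmd.loop x (Expr.lit i) p).frame s
  have key : ∀ i ≤ m, Inv i (st i) := by
    intro i
    induction i with
    | zero => exact fun _ => h0
    | succ i ih => exact fun hi => (hstep i (by omega) _ (hfr i) (ih (by omega))).1
  refine ⟨by simpa only [Cmd.run, hm] using key m le_rfl, ?_⟩
  simp only [Cmd.cost, hm]
  refine Nat.add_le_add_left (Finset.sum_le_sum fun i hi => Nat.add_le_add_left ?_ 1) 1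
  have hi := Finset.mem_range.mp hi
  exact (hstep i hi _ (hfr i) (key i hi.le)).2

/-- `Spec.loop` with the same cost bound for all rounds. -/
theorem loop_const {x : X} {e : Expr X A} {m : ℕ} (Inv : ℕ → Store X A → Prop) (T : ℕ)
    (hm : e.eval w s = m) (h0 : Inv 0 s)
    (hstep : ∀ i < m, ∀ s', Frame (x :: p.vars) p.arrs s s' → Inv i s' →
      Spec w p (s'.set x i) T (Inv (i + 1))) :
    Spec w (Cmd.loop x e p) s (1 + m * (1 + T)) (Inv m) := by
  simpa using loop Inv (fun _ => T) hm h0 hstep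

/-- A rule for loops whose rounds have costs that are bounded in total only: `Inv i c` holds before
round `i` if the preceding rounds have cost `c`. -/
theorem loop_amortized {x : X} {e : Expr X A} {m C : ℕ} (Inv : ℕ → ℕ → Store X A → Prop)
    (hm : e.eval w s = m) (h0 : Inv 0 0 s)
    (hstep : ∀ i < m, ∀ c s', Frame (x :: p.vars) p.arrs s s' → Inv i c s' →
      ∃ T, Spec w p (s'.set x i) T fun s'' => ∀ T' ≤ T, Inv (i + 1) (c + (1 + T')) s'')
    (hC : ∀ c s', Inv m c s' → c ≤ C) :
    Spec w (Cmd.loop x e p) s (1 + C) fun s' => ∃ c, Inv m c s' := by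
  set st : ℕ → Store X A := fun i => iterate (fun i s => p.run w (s.set x i)) i s with hst
  have hfr : ∀ i, Frame (x :: p.vars) p.arrs s (st i) := fun i =>
    (Cmd.loop x (Expr.lit i) p).frame s
  have key : ∀ i ≤ m, Inv i (∑ j ∈ Finset.range i, (1 + p.cost w ((st j).set x j))) (st i) := by
    intro i
    induction i with
    | zero => exact fun _ => h0
    | succ i ih =>
      intro hi
      obtain ⟨T, h1, h2⟩ := hstep i (by omega) _ _ (hfr i) (ih (by omega))
      rw [Finset.sum_range_succ]
      exact h1 _ h2
  refine ⟨⟨_, by simpa only [Cmd.run, hm] using key m le_rfl⟩, ?_⟩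
  simp only [Cmd.cost, hm]
  exact Nat.add_le_add_left (hC _ _ (key m le_rfl)) 1

end Spec

/-- The word `w` contains at position `q` the list `l`, preceded by its length. -/
def ListAt (w : ℕ → ℕ) (q : ℕ) (l : List ℕ) : Prop :=
  w q = l.length ∧ ∀ j (h : j < l.length), w (q + 1 + j) = l[j]

/-- Run `p` for `x` ranging over the list that the input word contains at position `e`; the
variable `j` is the position in the list. -/
def forEach (j x : X) (e : Expr X A) (p : Cmd X A) : Cmd X A :=
  Cmd.loop j (Expr.inp e)
    ((Cmd.set x (Expr.inp (Expr.add (Expr.add e (Expr.lit 1)) (Expr.var j)))).seq p)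

/-- The rule for `forEach`: `Inv l'` holds after the prefix `l'` of the list has been processed. -/
theorem Spec.forEach {p : Cmd X A} {s : Store X A} {j x : X} {e : Expr X A} {q : ℕ} {l : List ℕ}
    (Inv : List ℕ → Store X A → Prop) (T : ℕ) (hl : ListAt w q l)
    (he : ∀ s', Frame (j :: x :: p.vars) p.arrs s s' → e.eval w s' = q) (h0 : Inv [] s)
    (hstep : ∀ l₁ v l₂, l = l₁ ++ v :: l₂ → ∀ s', Frame (j :: x :: p.vars) p.arrs s s' →
      Inv l₁ s' → Spec w p ((s'.set j l₁.length).set x v) T (Inv (l₁ ++ [v]))) :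
    Spec w (forEach j x e p) s (1 + l.length * (2 + T)) (Inv l) := by
  have h := Spec.loop_const (w := w) (x := j) (e := Expr.inp e) (s := s) (m := l.length)
    (p := (Cmd.set x (Expr.inp (Expr.add (Expr.add e (Expr.lit 1)) (Expr.var j)))).seq p)
    (fun i => Inv (l.take i)) (1 + T)
    (by rw [← hl.1]; simp only [Expr.eval]
        rw [he s ⟨fun _ _ => rfl, fun _ _ => rfl⟩]) h0 ?_
  · rw [List.take_length] at h
    exact h.mono' (by rw [← add_assoc])
  · intro i hi s' hf hs
    refine Spec.seq (Spec.set ?_)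
    have hl' : l = l.take i ++ l[i] :: l.drop (i + 1) := by simp
    have := hstep _ _ _ hl' s' hf hs
    have hval : (Expr.inp (Expr.add (Expr.add e (Expr.lit 1)) (Expr.var j))).eval w (s'.set j i)
        = l[i] := by
      simp only [Expr.eval]
      rw [he (s'.set j i) ⟨fun y hy => ?_, fun a ha => hf.2 a ha⟩]
      · simp only [Store.set, Function.update_self]
        exact hl.2 i hi
      · have : y ≠ j := fun h => hy (by simp [h])
        simp only [Store.set, Function.update_of_ne this]
        exact hf.1 y hy
    rw [hval]
    rw [List.length_take_of_le hi.le] at this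
    rwa [List.take_concat_get' l i hi] at this

end BoundedLoop

/-! ### The dynamic program -/

namespace DominoDP

/-- The binary number with digits `s v`, for `v` in `l`, least significant digit first. -/
def code (s : ℕ → ℕ) : List ℕ → ℕ
  | [] => 0
  | v :: l => s v + 2 * code s l

/-- `s` is the indicator function of a set. -/
def IsIndicator (s : ℕ → ℕ) : Prop := ∀ v, s v ≤ 1

theorem code_congr {s s' : ℕ → ℕ} {l : List ℕ} (h : ∀ v ∈ l, s v = s' v) :
    code s l = code s' l := by
  induction l with
  | nil => rfl
  | cons v l ih =>
    simp only [code, h v (by simp), ih fun x hx => h x (by simp [hx])]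

theorem code_zero (l : List ℕ) : code (fun _ => 0) l = 0 := by
  induction l with
  | nil => rfl
  | cons v l ih => simp [code, ih]

theorem code_lt {s : ℕ → ℕ} (hs : IsIndicator s) (l : List ℕ) : code s l < 2 ^ l.length := by
  induction l with
  | nil => simp [code]
  | cons v l ih =>
    have := hs v
    simp only [code, List.length_cons, pow_succ]
    omega

theorem code_div_mod {s : ℕ → ℕ} (hs : IsIndicator s) (l : List ℕ) (j : ℕ) (hj : j < l.length) :
    code s l / 2 ^ j % 2 = s l[j] := by
  induction l generalizing j with
  | nil => simp at hj
  | cons v l ih =>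
    have := hs v
    cases j with
    | zero => simp only [code, pow_zero, Nat.div_one, List.getElem_cons_zero]; omega
    | succ j =>
      rw [List.getElem_cons_succ, ← ih j (by simpa using hj), pow_succ', ← Nat.div_div_eq_div_mul]
      congr 2
      simp only [code]
      omega

theorem code_append_singleton (s : ℕ → ℕ) (l : List ℕ) (v : ℕ) :
    code s (l ++ [v]) = code s l + s v * 2 ^ l.length := by
  induction l with
  | nil => simp [code]
  | cons x l ih =>
    simp only [List.cons_append, code, ih, List.length_cons, pow_succ]
    ring

theorem code_inj {s s' : ℕ → ℕ} (hs : IsIndicator s) (hs' : IsIndicator s') {l : List ℕ}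
    (h : code s l = code s' l) : ∀ v ∈ l, s v = s' v := by
  intro v hv
  obtain ⟨j, hj, rfl⟩ := List.getElem_of_mem hv
  rw [← code_div_mod hs l j hj, h, code_div_mod hs' l j hj]

theorem exists_ne_zero_of_code_pos {s : ℕ → ℕ} {l : List ℕ} (h : 0 < code s l) :
    ∃ v ∈ l, s v ≠ 0 := by
  by_contra! H
  rw [code_congr H, code_zero] at h
  exact lt_irrefl 0 h

theorem code_pos {s : ℕ → ℕ} (hs : IsIndicator s) {l : List ℕ} {v : ℕ} (hv : v ∈ l)
    (h : s v ≠ 0) : 0 < code s l := by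
  by_contra! H
  exact h (code_inj hs (fun _ => Nat.zero_le 1) ((Nat.le_zero.mp H).trans (code_zero l).symm) v hv)

/-- Data on vertices `0, …, n - 1` and bags `0, …, N`, where bag `0` is an auxiliary one.
`pos v` and `neg v` list the neighbours of `v`, `par u` is the parent of bag `u`, and `low v` is
the last bag that contains `v`. -/
structure Layout where
  n : ℕ
  N : ℕ
  bag : ℕ → List ℕ
  pos : ℕ → List ℕ
  neg : ℕ → List ℕ
  par : ℕ → ℕ
  low : ℕ → ℕ

namespace Layout

variable (L : Layout)

/-- The properties of a rooted domino tree decomposition: the tree is rooted at bag `1`, whose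
parent is the empty bag `0`, and parents have smaller numbers. By `domino`, a vertex lies in at
most two bags, `low v` and its parent, and by `nbr` these contain all its neighbours. -/
structure Valid : Prop where
  bag_zero : L.bag 0 = []
  par_lt : ∀ u, 1 ≤ u → u ≤ L.N → L.par u < u
  domino : ∀ i j v, i < j → j ≤ L.N → v ∈ L.bag i → v ∈ L.bag j → i = L.par j
  bag_lt : ∀ u ≤ L.N, ∀ v ∈ L.bag u, v < L.n
  nodup : ∀ u ≤ L.N, (L.bag u).Nodup
  low_mem : ∀ v < L.n, L.low v ≤ L.N ∧ v ∈ L.bag (L.low v)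
  le_low : ∀ u ≤ L.N, ∀ v ∈ L.bag u, u ≤ L.low v
  nbr : ∀ v < L.n, ∀ y, y ∈ L.pos v ∨ y ∈ L.neg v →
    y ∈ L.bag (L.low v) ∨ y ∈ L.bag (L.par (L.low v))

/-- The penalty for a vertex that is in the boundary of the set `s` and not successfully attacked;
otherwise `0`. The penalty `n + 1` exceeds the size of every set. -/
def defect (s : ℕ → ℕ) (v : ℕ) : ℕ :=
  if s v = 0 ∧ 0 < ((L.pos v).map s).sum + ((L.neg v).map s).sum ∧
      (((L.neg v).map s).sum < ((L.pos v).map s).sum ∨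
        ((L.neg v).map s).sum < (L.pos v).length - ((L.pos v).map s).sum + 1)
  then L.n + 1 else 0

/-- The cost of the vertices whose last bag is `u`: their number in `s` plus their penalties. -/
def cost (u : ℕ) (s : ℕ → ℕ) : ℕ :=
  ((L.bag u).map fun v => if L.low v = u then s v + L.defect s v else 0).sum

/-- The number of elements of `s` plus all penalties. -/
def total (s : ℕ → ℕ) : ℕ := ∑ v ∈ Finset.range L.n, (s v + L.defect s v)

variable {L}

theorem defect_congr {s s' : ℕ → ℕ} {v : ℕ} (hv : s v = s' v)
    (h : ∀ y, y ∈ L.pos v ∨ y ∈ L.neg v → s y = s' y) : L.defect s v = L.defect s' v := by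
  unfold defect
  rw [List.map_congr_left fun y hy => h y (Or.inl hy),
    List.map_congr_left fun y hy => h y (Or.inr hy), hv]

theorem defect_zero (v : ℕ) : L.defect (fun _ => 0) v = 0 := by
  simp [defect]

theorem cost_zero (u : ℕ) : L.cost u (fun _ => 0) = 0 := by
  simp [cost, defect_zero]

/-- The cost at `u` depends only on the bag `u` and its parent. -/
theorem Valid.cost_congr (hL : L.Valid) {s s' : ℕ → ℕ} {u : ℕ} (hu : u ≤ L.N)
    (h₁ : ∀ v ∈ L.bag u, s v = s' v) (h₂ : ∀ v ∈ L.bag (L.par u), s v = s' v) :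
    L.cost u s = L.cost u s' := by
  unfold cost
  congr 1
  refine List.map_congr_left fun v hv => ?_
  split_ifs with hlow
  · rw [h₁ v hv, defect_congr (h₁ v hv) fun y hy => ?_]
    have := hL.nbr v (hL.bag_lt u hu v hv) y hy
    rw [hlow] at this
    exact this.elim (h₁ y) (h₂ y)
  · rfl

theorem Valid.cost_eq_sum (hL : L.Valid) {u : ℕ} (hu : u ≤ L.N) (s : ℕ → ℕ) :
    L.cost u s = ∑ v ∈ Finset.range L.n, if L.low v = u then s v + L.defect s v else 0 := by
  unfold cost
  rw [← List.sum_toFinset _ (hL.nodup u hu)]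
  refine Finset.sum_subset (fun v hv => ?_) fun v hv hv' => ?_
  · simpa using hL.bag_lt u hu v (by simpa using hv)
  · rw [if_neg]
    rintro rfl
    exact hv' (by simpa using (hL.low_mem v (by simpa using hv)).2)

theorem Valid.low_pos (hL : L.Valid) {v : ℕ} (hv : v < L.n) : 0 < L.low v := by
  rw [Nat.pos_iff_ne_zero]
  intro h
  have := (hL.low_mem v hv).2
  rw [h, hL.bag_zero] at this
  simp at this

theorem Valid.sum_cost (hL : L.Valid) (s : ℕ → ℕ) :
    ∑ u ∈ Finset.Ioc 0 L.N, L.cost u s = L.total s := by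
  rw [Finset.sum_congr rfl fun u hu => hL.cost_eq_sum (Finset.mem_Ioc.mp hu).2 s,
    Finset.sum_comm]
  refine Finset.sum_congr rfl fun v hv => ?_
  have hv := Finset.mem_range.mp hv
  rw [Finset.sum_ite_eq, if_pos (Finset.mem_Ioc.mpr ⟨hL.low_pos hv, (hL.low_mem v hv).1⟩)]

/-- A vertex lies in at most two bags, so there are at most `2 n` non-empty ones. -/
theorem Valid.le_two_mul (hL : L.Valid) (hne : ∀ u, 1 ≤ u → u ≤ L.N → L.bag u ≠ []) :
    L.N ≤ 2 * L.n := by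
  have hsub : Finset.Ioc 0 L.N ⊆ (Finset.range L.n).image L.low ∪
      (Finset.range L.n).image fun v => L.par (L.low v) := by
    intro u hu
    rw [Finset.mem_Ioc] at hu
    obtain ⟨v, hv⟩ := List.exists_mem_of_ne_nil _ (hne u hu.1 hu.2)
    have hvn := hL.bag_lt u hu.2 v hv
    rcases (hL.le_low u hu.2 v hv).lt_or_eq with h | h
    · have := hL.domino u _ v h (hL.low_mem v hvn).1 hv (hL.low_mem v hvn).2
      exact Finset.mem_union_right _ (Finset.mem_image.mpr ⟨v, Finset.mem_range.mpr hvn, this.symm⟩)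
    · exact Finset.mem_union_left _ (Finset.mem_image.mpr ⟨v, Finset.mem_range.mpr hvn, h.symm⟩)
  have h1 := (Finset.card_le_card hsub).trans (Finset.card_union_le _ _)
  have h2 := Finset.card_image_le (s := Finset.range L.n) (f := L.low)
  have h3 := Finset.card_image_le (s := Finset.range L.n) (f := fun v => L.par (L.low v))
  simp only [Nat.card_Ioc, Finset.card_range] at h1 h2 h3
  omega

variable (L)

/-- `m` is the minimum of `F u (S ∩ bag u) + cost u S` over the sets `S` that meet the parent bag in
the set with code `a`; but `m = n + 1` stands for all larger values. -/
def IsMessage (F : ℕ → ℕ → ℕ) (u a m : ℕ) : Prop :=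
  (∀ s, IsIndicator s → code s (L.bag (L.par u)) = a →
    m ≤ F u (code s (L.bag u)) + L.cost u s) ∧
  (m = L.n + 1 ∨ ∃ s, IsIndicator s ∧ code s (L.bag (L.par u)) = a ∧
    m = F u (code s (L.bag u)) + L.cost u s)

/-- `ans'` is the minimum of `ans` and of `F u (S ∩ bag u) + cost u S` over the sets `S` that meet
the bag `u` but not its parent. -/
def IsUpdate (F : ℕ → ℕ → ℕ) (u ans ans' : ℕ) : Prop :=
  ans' ≤ ans ∧
  (∀ s, IsIndicator s → code s (L.bag (L.par u)) = 0 → 0 < code s (L.bag u) →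
    ans' ≤ F u (code s (L.bag u)) + L.cost u s) ∧
  (ans' = ans ∨ ∃ s, IsIndicator s ∧ code s (L.bag (L.par u)) = 0 ∧ 0 < code s (L.bag u) ∧
    ans' = F u (code s (L.bag u)) + L.cost u s)

/-- Processing the bag `u` turns the tables `F` and the value `ans` into `F'` and `ans'`; only
entries with codes below `W` matter. -/
def IsStep (W : ℕ) (F : ℕ → ℕ → ℕ) (u ans : ℕ) (F' : ℕ → ℕ → ℕ) (ans' : ℕ) : Prop :=
  (∀ t a, a < W → t ≠ L.par u → F' t a = F t a) ∧
  (∀ a < W, ∃ m, L.IsMessage F u a m ∧ F' (L.par u) a = F (L.par u) a + m) ∧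
  L.IsUpdate F u ans ans'

/-- The invariant after the bags `N, N - 1, …, i + 1` have been processed. The tables of the other
bags describe, jointly, how a set given on these bags can be extended at least total cost: `lower`
and `upper` are the two inequalities. The same holds for `ans` and the cost of non-empty sets. -/
structure Inv (F : ℕ → ℕ → ℕ) (i ans : ℕ) : Prop where
  zero : ∀ t ≤ i, F t 0 = 0
  lower : ∀ s, IsIndicator s → ∑ t ∈ Finset.range (i + 1), F t (code s (L.bag t)) ≤
    ∑ u ∈ Finset.Ioc i L.N, L.cost u s
  upper : ∀ s, IsIndicator s → ∑ t ∈ Finset.range (i + 1), F t (code s (L.bag t)) ≤ L.n →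
    ∃ s', IsIndicator s' ∧ (∀ t ≤ i, ∀ v ∈ L.bag t, s' v = s v) ∧
      ∑ u ∈ Finset.Ioc i L.N, L.cost u s' ≤ ∑ t ∈ Finset.range (i + 1), F t (code s (L.bag t))
  ans_le : ans ≤ L.n + 1
  ans_lower : ∀ s, IsIndicator s → ∀ u ∈ Finset.Ioc i L.N, code s (L.bag (L.par u)) = 0 →
    0 < code s (L.bag u) → ans ≤ L.total s
  ans_upper : ans = L.n + 1 ∨ ∃ s, IsIndicator s ∧ (∃ v < L.n, s v ≠ 0) ∧ L.total s ≤ ans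

variable {L}

theorem inv_init : L.Inv (fun _ _ => 0) L.N (L.n + 1) where
  zero _ _ := rfl
  lower s _ := by simp
  upper s hs _ := ⟨s, hs, fun _ _ _ _ => rfl, by simp⟩
  ans_le := le_rfl
  ans_lower s _ u hu := by simp at hu
  ans_upper := Or.inl rfl

theorem sum_Ioc_eq_add {f : ℕ → ℕ} {i N : ℕ} (h : i < N) :
    ∑ u ∈ Finset.Ioc i N, f u = f (i + 1) + ∑ u ∈ Finset.Ioc (i + 1) N, f u := by
  have : Finset.Ioc i N = insert (i + 1) (Finset.Ioc (i + 1) N) := by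
    ext x; simp only [Finset.mem_Ioc, Finset.mem_insert]; omega
  rw [this, Finset.sum_insert (by simp)]

theorem Valid.inv_step (hL : L.Valid) {W i ans ans' : ℕ} {F F' : ℕ → ℕ → ℕ} (hi : i < L.N)
    (hW : ∀ t ≤ L.N, 2 ^ (L.bag t).length ≤ W) (hF : L.Inv F (i + 1) ans)
    (hstep : L.IsStep W F (i + 1) ans F' ans') : L.Inv F' i ans' := by
  obtain ⟨hother, hpar, hle, hans₁, hans₂⟩ := hstep
  have hp : L.par (i + 1) < i + 1 := hL.par_lt _ (by omega) (by omega)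
  have hcW : ∀ s, IsIndicator s → ∀ t ≤ L.N, code s (L.bag t) < W := fun s hs t ht =>
    (code_lt hs _).trans_le (hW t ht)
  have hW0 : 0 < W := lt_of_lt_of_le (by positivity) (hW 0 (by omega))
  -- adding the message to the table of the parent adds it to the sum of the table entries
  have hsum : ∀ s, IsIndicator s → ∃ m, L.IsMessage F (i + 1) (code s (L.bag (L.par (i + 1)))) m ∧
      ∑ t ∈ Finset.range (i + 1), F' t (code s (L.bag t)) =
        ∑ t ∈ Finset.range (i + 1), F t (code s (L.bag t)) + m := by
    intro s hs
    obtain ⟨m, hm, hFm⟩ := hpar _ (hcW s hs (L.par (i + 1)) (by omega))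
    refine ⟨m, hm, ?_⟩
    have hmem : L.par (i + 1) ∈ Finset.range (i + 1) := Finset.mem_range.mpr hp
    rw [← Finset.add_sum_erase _ _ hmem, ← Finset.add_sum_erase _ _ hmem, hFm,
      Finset.sum_congr rfl fun t ht => hother t _
        (hcW s hs t (by have := Finset.mem_range.mp (Finset.mem_of_mem_erase ht); omega))
        (Finset.ne_of_mem_erase ht)]
    ring
  have hdisj : ∀ t ≤ i, t ≠ L.par (i + 1) → ∀ v ∈ L.bag t, v ∉ L.bag (i + 1) :=
    fun t ht htp v hv hv' => htp (hL.domino t (i + 1) v (by omega) (by omega) hv hv')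
  -- a set given on the bag `i + 1` and one on the smaller bags can be combined
  have hglue : ∀ s σ, IsIndicator s → IsIndicator σ →
      (∀ v ∈ L.bag (L.par (i + 1)), σ v = s v) → ∃ s₁, IsIndicator s₁ ∧
      (∀ v ∈ L.bag (i + 1), s₁ v = σ v) ∧ ∀ t ≤ i, ∀ v ∈ L.bag t, s₁ v = s v := by
    intro s σ hs hσ h
    refine ⟨fun v => if v ∈ L.bag (i + 1) then σ v else s v, fun v => ?_, fun v hv => ?_,
      fun t ht v hv => ?_⟩
    · dsimp only; split_ifs; exacts [hσ v, hs v]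
    · simp [hv]
    · by_cases htp : t = L.par (i + 1)
      · subst htp
        dsimp only; split_ifs
        exacts [h v hv, rfl]
      · simp [hdisj t ht htp v hv]
  have hglue_sum : ∀ s s₁ : ℕ → ℕ, (∀ t ≤ i, ∀ v ∈ L.bag t, s₁ v = s v) →
      ∑ t ∈ Finset.range (i + 1), F t (code s₁ (L.bag t)) =
        ∑ t ∈ Finset.range (i + 1), F t (code s (L.bag t)) := by
    intro s s₁ h
    refine Finset.sum_congr rfl fun t ht => ?_
    rw [code_congr (h t (by have := Finset.mem_range.mp ht; omega))]
  have hzero : ∀ t, IsIndicator (fun _ => 0) ∧ code (fun _ => 0) (L.bag t) = 0 :=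
    fun t => ⟨fun _ => Nat.zero_le 1, code_zero _⟩
  have hle_total : ∀ s, L.cost (i + 1) s + ∑ u ∈ Finset.Ioc (i + 1) L.N, L.cost u s
      ≤ L.total s := by
    intro s
    rw [← sum_Ioc_eq_add (f := fun u => L.cost u s) hi, ← hL.sum_cost]
    exact Finset.sum_le_sum_of_subset (Finset.Ioc_subset_Ioc_left (Nat.zero_le i))
  constructor
  · intro t ht
    by_cases htp : t = L.par (i + 1)
    · subst htp
      obtain ⟨m, hm, hFm⟩ := hpar 0 hW0
      have := hm.1 _ (hzero 0).1 (hzero _).2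
      rw [(hzero _).2, cost_zero, hF.zero _ le_rfl] at this
      rw [hFm, hF.zero _ (by omega)]
      omega
    · rw [hother t 0 hW0 htp, hF.zero t (by omega)]
  · intro s hs
    obtain ⟨m, hm, h⟩ := hsum s hs
    have h1 := hm.1 s hs rfl
    have h2 := hF.lower s hs
    rw [Finset.sum_range_succ] at h2
    rw [h, sum_Ioc_eq_add hi]
    omega
  · intro s hs hle
    obtain ⟨m, hm, h⟩ := hsum s hs
    obtain ⟨σ, hσ, hσs, rfl⟩ := hm.2.resolve_left (by omega)
    have hag := code_inj hσ hs hσs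
    obtain ⟨s₁, hs₁, h1, h2⟩ := hglue s σ hs hσ hag
    have h3 := hF.upper s₁ hs₁
    rw [Finset.sum_range_succ, hglue_sum s s₁ h2, code_congr h1] at h3
    obtain ⟨s', hs', h4, h5⟩ := h3 (by omega)
    refine ⟨s', hs', fun t ht v hv => (h4 t (by omega) v hv).trans (h2 t ht v hv), ?_⟩
    have hc : L.cost (i + 1) s' = L.cost (i + 1) σ :=
      hL.cost_congr hi (fun v hv => (h4 _ le_rfl v hv).trans (h1 v hv)) fun v hv =>
        (h4 _ hp.le v hv).trans ((h2 _ (by omega) v hv).trans (hag v hv).symm)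
    rw [sum_Ioc_eq_add hi, hc, h]
    omega
  · exact hle.trans hF.ans_le
  · intro s hs u hu h1 h2
    rw [Finset.mem_Ioc] at hu
    rcases Nat.lt_or_ge (i + 1) u with hlt | hge
    · exact hle.trans (hF.ans_lower s hs u (Finset.mem_Ioc.mpr ⟨hlt, hu.2⟩) h1 h2)
    · obtain rfl : u = i + 1 := by omega
      have h3 := hF.lower s hs
      rw [Finset.sum_range_succ] at h3
      have h4 := hans₁ s hs h1 h2
      have h5 := hle_total s
      omega
  · rcases hans₂ with rfl | ⟨σ, hσ, h1, h2, h3⟩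
    · exact hF.ans_upper
    rcases Nat.lt_or_ge L.n ans' with hlt | hge
    · exact Or.inl (by have := hF.ans_le; omega)
    right
    have hag : ∀ v ∈ L.bag (L.par (i + 1)), σ v = 0 := by
      have := code_inj hσ (hzero 0).1 (l := L.bag (L.par (i + 1))) (by rw [h1, code_zero])
      exact this
    obtain ⟨s₁, hs₁, h4, h5⟩ := hglue _ σ (hzero 0).1 hσ hag
    have h6 := hF.upper s₁ hs₁
    have h7 : ∑ t ∈ Finset.range (i + 1), F t (code s₁ (L.bag t)) = 0 := by
      rw [hglue_sum _ s₁ h5]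
      refine Finset.sum_eq_zero fun t ht => ?_
      rw [code_zero, hF.zero t (by have := Finset.mem_range.mp ht; omega)]
    rw [Finset.sum_range_succ, h7, code_congr h4] at h6
    obtain ⟨s', hs', h8, h9⟩ := h6 (by omega)
    have h10 : ∀ t ≤ i, ∀ v ∈ L.bag t, s' v = 0 := fun t ht v hv =>
      (h8 t (by omega) v hv).trans (h5 t ht v hv)
    have hc : L.cost (i + 1) s' = L.cost (i + 1) σ :=
      hL.cost_congr hi (fun v hv => (h8 _ le_rfl v hv).trans (h4 v hv)) fun v hv =>
        (h10 _ (by omega) v hv).trans (hag v hv).symm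
    refine ⟨s', hs', ?_, ?_⟩
    · rw [← code_congr fun v hv => (h8 _ le_rfl v hv).trans (h4 v hv)] at h2
      obtain ⟨v, hv, hne⟩ := exists_ne_zero_of_code_pos h2
      exact ⟨v, hL.bag_lt _ hi v hv, hne⟩
    · have h11 : ∑ u ∈ Finset.Ioc 0 i, L.cost u s' = 0 := by
        refine Finset.sum_eq_zero fun u hu => ?_
        rw [Finset.mem_Ioc] at hu
        have := hL.par_lt u hu.1 (by omega)
        rw [← cost_zero (L := L) u]
        exact hL.cost_congr (by omega) (h10 u hu.2) (h10 _ (by omega))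
      have h12 := Finset.sum_Ioc_consecutive (fun u => L.cost u s') (Nat.zero_le i) hi.le
      rw [h11, sum_Ioc_eq_add hi, hc] at h12
      rw [← hL.sum_cost, ← h12]
      omega

/-- At the end, `ans` is the smallest total cost of a non-empty set if this is at most `n`. -/
theorem Valid.ans_spec (hL : L.Valid) {F : ℕ → ℕ → ℕ} {ans : ℕ} (h : L.Inv F 0 ans) :
    (∀ s, IsIndicator s → (∃ v < L.n, s v ≠ 0) → ans ≤ L.total s) ∧
    (ans = L.n + 1 ∨ ∃ s, IsIndicator s ∧ (∃ v < L.n, s v ≠ 0) ∧ L.total s ≤ ans) := by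
  refine ⟨fun s hs ⟨v, hv, hne⟩ => ?_, h.ans_upper⟩
  -- the first bag that meets `s`
  have hex : ∃ u, 0 < code s (L.bag u) := ⟨L.low v, code_pos hs (hL.low_mem v hv).2 hne⟩
  classical
  have hle : Nat.find hex ≤ L.N :=
    (Nat.find_min' hex (code_pos hs (hL.low_mem v hv).2 hne)).trans (hL.low_mem v hv).1
  have hpos : 0 < Nat.find hex := by
    rw [Nat.pos_iff_ne_zero]
    intro h0
    have := Nat.find_spec hex
    rw [h0, hL.bag_zero] at this
    simp [code] at this
  refine h.ans_lower s hs _ (Finset.mem_Ioc.mpr ⟨hpos, hle⟩) ?_ (Nat.find_spec hex)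
  simpa using Nat.find_min hex (hL.par_lt _ hpos hle)

end Layout

end DominoDP

/-! ### The program -/

namespace AllianceProgram

set_option linter.constructorNameAsVariable false

open BoundedLoop DominoDP

local infixr:60 " ;; " => Cmd.seq

/-- The scalar variables. -/
inductive Var
  | res | ans | n | k | N | p | inf | wd | W | r | pw | cnt | i | j | x | y | u | q | bu | bq
  | a | c | m | val | v | e₁ | e₂ | sp | sn
  deriving DecidableEq

/-- The arrays: `ptr` holds the positions of the lists in the input word; `half` and `odd` hold
quotients and remainders modulo two; `order`, `pp`, `vis` belong to the traversal of the tree,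
`bp` and `low` to the bags in the order of this traversal; `sel` is the current vertex set; and
`tab` holds the tables, the table of bag `t` from position `row t` on. -/
inductive Arr
  | ptr | half | odd | row | order | pp | vis | bp | low | sel | tab
  deriving DecidableEq

/-- The value of a variable. -/
abbrev V (x : Var) : Expr Var Arr := Expr.var x

/-- A literal. -/
abbrev K (c : ℕ) : Expr Var Arr := Expr.lit c

/-- An entry of an array. -/
abbrev get (a : Arr) (e : Expr Var Arr) : Expr Var Arr := Expr.arr a e

/-- An entry of the input word. -/
abbrev word (e : Expr Var Arr) : Expr Var Arr := Expr.inp e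

instance : Add (Expr Var Arr) := ⟨Expr.add⟩

instance : Sub (Expr Var Arr) := ⟨Expr.sub⟩

@[simp] theorem eval_add (w : ℕ → ℕ) (s : Store Var Arr) (e f : Expr Var Arr) :
    (e + f).eval w s = e.eval w s + f.eval w s := rfl

@[simp] theorem eval_sub (w : ℕ → ℕ) (s : Store Var Arr) (e f : Expr Var Arr) :
    (e - f).eval w s = e.eval w s - f.eval w s := rfl

@[simp] theorem var_set (s : Store Var Arr) (x y : Var) (c : ℕ) :
    (s.set x c).var y = if y = x then c else s.var y := Function.update_apply ..

@[simp] theorem arr_set (s : Store Var Arr) (x : Var) (c : ℕ) : (s.set x c).arr = s.arr := rfl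

@[simp] theorem var_put (s : Store Var Arr) (a : Arr) (i c : ℕ) : (s.put a i c).var = s.var := rfl

@[simp] theorem arr_put (s : Store Var Arr) (a b : Arr) (i c : ℕ) :
    (s.put a i c).arr b = if b = a then Function.update (s.arr a) i c else s.arr b :=
  Function.update_apply ..

attribute [simp] Expr.eval

/-- Equality test. -/
def ifEq (e f : Expr Var Arr) (p : Cmd Var Arr) : Cmd Var Arr :=
  .ite ((e - f) + (f - e)) (K 1) p .skip

/-- `dst` becomes the number of selected vertices in the list at position `e`. -/
def count (dst : Var) (e : Expr Var Arr) : Cmd Var Arr :=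
  .set dst (K 0) ;; forEach .x .y e (.set dst (V dst + get .sel (V .y)))

/-- Select vertices of the list at position `b` according to the binary digits of `c`. -/
def decode (b c : Var) : Cmd Var Arr :=
  .set .r (V c) ;; forEach .x .y (V b)
    (.put .sel (V .y) (get .odd (V .r)) ;; .set .r (get .half (V .r)))

/-- `dst` becomes the code of the selection in the list at position `b`. -/
def encode (dst b : Var) : Cmd Var Arr :=
  .set dst (K 0) ;; .set .pw (K 1) ;; forEach .x .y (V b)
    (.ite (K 0) (get .sel (V .y)) (.set dst (V dst + V .pw)) .skip ;; .set .pw (V .pw + V .pw))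

/-- Add to `val` the contribution of the vertex `v`. -/
def addVertex : Cmd Var Arr :=
  .set .val (V .val + get .sel (V .v)) ;;
  count .sp (get .ptr (V .v + V .v)) ;;
  count .sn (get .ptr (V .v + V .v + K 1)) ;;
  .ite (get .sel (V .v)) (K 1)
    (.ite (K 0) (V .sp + V .sn)
      (.ite (K 0) ((V .sp - V .sn) + ((word (get .ptr (V .v + V .v)) - V .sp + K 1) - V .sn))
        (.set .val (V .val + V .inf)) .skip) .skip) .skip

/-- `val` becomes the table entry for code `c` of bag `u`, plus the cost at `u`. -/
def evaluate : Cmd Var Arr :=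
  .set .val (get .tab (get .row (V .u) + V .c)) ;;
  forEach .j .v (V .bu) (ifEq (get .low (V .v)) (V .u) addVertex)

/-- Update `m` and `ans` by the value `val`. -/
def minimize : Cmd Var Arr :=
  .ite (V .val) (V .m) (.set .m (V .val)) .skip ;;
  .ite (V .a) (K 1)
    (.ite (K 0) (V .c) (.ite (V .val) (V .ans) (.set .ans (V .val)) .skip) .skip) .skip

/-- Treat the code `c` for the bag `u` and the code `a` for its parent. They may be inconsistent on
the common vertices, or out of range; then encoding does not return the same codes. -/
def tryCodes : Cmd Var Arr :=
  decode .bu .c ;; decode .bq .a ;; encode .e₁ .bu ;; encode .e₂ .bq ;;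
  ifEq (V .e₁) (V .c) (ifEq (V .e₂) (V .a) (evaluate ;; minimize))

/-- Compute the message of bag `u` for the code `a` and add it to the table of the parent. -/
def sendMessage : Cmd Var Arr :=
  .set .m (V .inf) ;; .loop .c (V .W) tryCodes ;;
  .put .tab (get .row (V .q) + V .a) (get .tab (get .row (V .q) + V .a) + V .m)

/-- Process the bag `u = N - i`. -/
def processBag : Cmd Var Arr :=
  .set .u (V .N - V .i) ;; .set .q (get .pp (V .u)) ;;
  .set .bu (get .bp (V .u)) ;; .set .bq (get .bp (V .q)) ;;
  .loop .a (V .W) sendMessage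

/-- The dynamic program: bags are processed in reverse order. -/
def solve : Cmd Var Arr := .set .ans (V .inf) ;; .loop .i (V .N) processBag

/-- Read the numbers at the beginning of the input and find the positions of all lists. -/
def scan : Cmd Var Arr :=
  .set .n (word (K 0)) ;; .set .k (word (K 1)) ;; .set .N (word (K 2)) ;; .set .p (K 3) ;;
  .set .inf (V .n + K 1) ;;
  .loop .i (V .n + V .n + V .N + V .N)
    (.put .ptr (V .i) (V .p) ;; .set .p (V .p + K 1 + word (V .p))) ;;
  .put .bp (K 0) (V .p)

/-- The largest size of a bag, and two to this power. -/
def width : Cmd Var Arr :=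
  .set .wd (K 0) ;;
  .loop .i (V .N) (.set .x (word (get .ptr (V .n + V .n + V .i))) ;;
    .ite (V .wd) (V .x) (.set .wd (V .x)) .skip) ;;
  .set .W (K 1) ;; .loop .i (V .wd) (.set .W (V .W + V .W))

/-- Fill the arrays `half`, `odd` and `row`. -/
def tables : Cmd Var Arr :=
  .loop .i (V .W) (.put .half (V .i + V .i) (V .i) ;; .put .odd (V .i + V .i) (K 0) ;;
    .put .half (V .i + V .i + K 1) (V .i) ;; .put .odd (V .i + V .i + K 1) (K 1)) ;;
  .set .r (K 0) ;; .loop .i (V .N + K 1) (.put .row (V .i) (V .r) ;; .set .r (V .r + V .W))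

/-- Append the node `y` to the order of the traversal, as a child of number `u`. -/
def discover : Cmd Var Arr :=
  .put .vis (V .y) (K 1) ;; .put .order (V .cnt) (V .y) ;; .put .pp (V .cnt) (V .u) ;;
  .set .cnt (V .cnt + K 1)

/-- Treat node number `u = i + 1` of the order. -/
def visit : Cmd Var Arr :=
  .set .u (V .i + K 1) ;; .set .v (get .order (V .u)) ;;
  .set .q (get .ptr (V .n + V .n + V .v)) ;; .put .bp (V .u) (V .q) ;;
  forEach .x .y (V .q) (.put .low (V .y) (V .u)) ;;
  .set .q (get .ptr (V .n + V .n + V .N + V .v)) ;;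
  forEach .x .y (V .q) (.ite (get .vis (V .y)) (K 1) discover .skip)

/-- Breadth-first traversal of the tree from node `0`, which gets number `1`. -/
def traverse : Cmd Var Arr :=
  .put .order (K 1) (K 0) ;; .put .pp (K 1) (K 0) ;; .put .vis (K 0) (K 1) ;; .set .cnt (K 2) ;;
  .loop .i (V .N) visit

/-- Compare the result with `k`. -/
def answer : Cmd Var Arr :=
  .set .res (K 0) ;;
  .ite (V .ans) (V .inf) (.ite (V .ans) (V .k + K 1) (.set .res (K 1)) .skip) .skip

/-- The whole algorithm. -/
def main : Cmd Var Arr := scan ;; width ;; tables ;; traverse ;; solve ;; answer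

/-! ### Counting, decoding and encoding -/

section

variable {w : ℕ → ℕ} {s : Store Var Arr}

theorem ifEq_spec {e f : Expr Var Arr} {p : Cmd Var Arr} {T : ℕ} {Q : Store Var Arr → Prop}
    (h₁ : e.eval w s = f.eval w s → Spec w p s T Q) (h₂ : e.eval w s ≠ f.eval w s → Q s)
    (hT : 1 ≤ T) : Spec w (ifEq e f p) s (1 + T) Q := by
  refine Spec.ite (fun h => h₁ ?_) fun h => (Spec.skip (h₂ ?_)).mono' hT
  · simp only [eval_sub, Expr.eval] at h; omega
  · simp only [eval_sub, Expr.eval] at h; omega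

theorem count_spec {dst : Var} {e : Expr Var Arr} {q : ℕ} {l : List ℕ} (hl : ListAt w q l)
    (hd : dst ≠ .x ∧ dst ≠ .y)
    (he : ∀ s', Frame [.x, .y, dst] [] s s' → e.eval w s' = q) :
    Spec w (count dst e) s (2 + l.length * 3) fun s' => s'.var dst = (l.map (s.arr .sel)).sum := by
  refine (Spec.seq (Spec.set (Spec.forEach
    (fun l₁ s' => s'.var dst = (l₁.map (s.arr .sel)).sum) 1 hl ?_ ?_ ?_))).mono' (by omega)
  · intro s' hf
    refine he s' ⟨fun x hx => (hf.1 x hx).trans ?_, hf.2⟩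
    simp only [List.mem_cons, not_or] at hx
    simp [hx.2.2.1]
  · simp
  · intro l₁ v l₂ _ s' hf hs
    have := hf.2 .sel (by simp [Cmd.arrs])
    refine Spec.set ?_
    simp [hd, hs, this]

theorem decode_spec {b c : Var} {W : ℕ} {l : List ℕ} (hl : ListAt w (s.var b) l) (hnd : l.Nodup)
    (hb : b ∉ [Var.r, .x, .y]) (hhalf : ∀ i < W, s.arr .half i = i / 2)
    (hodd : ∀ i < W, s.arr .odd i = i % 2) (hc : s.var c < W) (hsel : IsIndicator (s.arr .sel)) :
    Spec w (decode b c) s (2 + l.length * 4) fun s' =>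
      IsIndicator (s'.arr .sel) ∧ (∀ v, v ∉ l → s'.arr .sel v = s.arr .sel v) ∧
      ∀ f, IsIndicator f → code f l = s.var c → ∀ v ∈ l, s'.arr .sel v = f v := by
  refine (Spec.seq (Spec.set (Spec.mono (Spec.forEach
    (fun l₁ s' => s'.var .r = s.var c / 2 ^ l₁.length ∧ IsIndicator (s'.arr .sel) ∧
      (∀ v, v ∉ l → s'.arr .sel v = s.arr .sel v) ∧
      ∀ i (h : i < l₁.length), s'.arr .sel l₁[i] = s.var c / 2 ^ i % 2) 2 hl ?_ ?_ ?_) le_rfl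
      fun s' hf hs => ?_))).mono' (by omega)
  · intro s' hf
    rw [Expr.eval, hf.1 b (by simp_all [Cmd.vars])]
    simp_all
  · simp [hsel]
  · rintro l₁ v l₂ rfl s' hf ⟨h1, h2, h3, h4⟩
    refine Spec.seq (T := 1) (T' := 1) (Spec.put (Spec.set ?_))
    have h5 : s.var c / 2 ^ l₁.length < W := (Nat.div_le_self _ _).trans_lt hc
    have h6 := hf.2 .half (by simp [Cmd.arrs])
    have h7 := hf.2 .odd (by simp [Cmd.arrs])
    simp only [arr_set] at h6 h7
    have hv : v ∉ l₁ := by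
      intro h
      rw [List.nodup_append] at hnd
      exact hnd.2.2 v h v (by simp) rfl
    refine ⟨?_, ?_, ?_, ?_⟩
    · simp [h1, h6, hhalf _ h5, pow_succ, Nat.div_div_eq_div_mul]
    · intro x
      simp only [Expr.eval, arr_set, arr_put, if_true, var_set, reduceCtorEq, if_false,
        Function.update_apply, h7]
      split_ifs
      · rw [h1, hodd _ h5]; omega
      · exact h2 x
    · intro x hx
      have : x ≠ v := fun h => hx (by simp [h])
      simp [this, h3 x hx]
    · intro i hi
      simp only [List.length_append, List.length_cons, List.length_nil] at hi
      rcases Nat.lt_or_ge i l₁.length with h | h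
      · have : l₁[i] ≠ v := fun h' => hv (h' ▸ List.getElem_mem h)
        simp [List.getElem_append_left h, this, h4 i h]
      · obtain rfl : i = l₁.length := by omega
        simp [h1, h7, hodd _ h5]
  · obtain ⟨-, h2, h3, h4⟩ := hs
    refine ⟨h2, h3, fun f hf hcode v hv => ?_⟩
    obtain ⟨i, hi, rfl⟩ := List.getElem_of_mem hv
    rw [h4 i hi, ← hcode, code_div_mod hf]

theorem encode_spec {dst b : Var} {l : List ℕ} (hl : ListAt w (s.var b) l)
    (hb : b ∉ [dst, Var.pw, .x, .y]) (hd : dst ∉ [Var.pw, .x, .y])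
    (hsel : IsIndicator (s.arr .sel)) :
    Spec w (encode dst b) s (3 + l.length * 5) fun s' => s'.var dst = code (s.arr .sel) l := by
  simp only [List.mem_cons, not_or] at hb hd
  refine (Spec.seq (Spec.set (Spec.seq (Spec.set (Spec.mono (Spec.forEach
    (fun l₁ s' => s'.var dst = code (s.arr .sel) l₁ ∧ s'.var .pw = 2 ^ l₁.length) 3 hl ?_ ?_ ?_)
      le_rfl fun s' hf hs => hs.1))))).mono' (by omega)
  · intro s' hf
    rw [Expr.eval, hf.1 b (by simp_all [Cmd.vars])]
    simp_all
  · simp [hd, code]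
  · rintro l₁ v l₂ rfl s' hf ⟨h1, h2⟩
    have h3 := hf.2 .sel (by simp [Cmd.arrs])
    simp only [arr_set] at h3
    have h4 := hsel v
    refine Spec.seq (T := 1 + 1) (T' := 1) (Spec.ite (fun h => Spec.set (Spec.set ?_))
      (fun h => Spec.skip (Spec.set ?_)))
    · simp only [Expr.eval, arr_set, var_set, if_true, h3] at h
      have h5 : s.arr .sel v = 1 := by omega
      have h6 : ¬ Var.pw = dst := fun h => hd.1 h.symm
      simp [hd, h1, h2, h6, code_append_singleton, h5, pow_succ, mul_two]
    · simp only [Expr.eval, arr_set, var_set, if_true, h3] at h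
      have h5 : s.arr .sel v = 0 := by omega
      simp [hd, h1, h2, code_append_singleton, h5, pow_succ, mul_two]

/-! ### The cost of one vertex and of one bag -/

/-- The store contains the data of the layout `L`, and the auxiliary tables for codes below `W`. -/
structure Ready (w : ℕ → ℕ) (L : Layout) (W : ℕ) (s : Store Var Arr) : Prop where
  inf_eq : s.var .inf = L.n + 1
  N_eq : s.var .N = L.N
  W_eq : s.var .W = W
  half : ∀ i < W, s.arr .half i = i / 2
  odd : ∀ i < W, s.arr .odd i = i % 2
  row : ∀ t ≤ L.N, s.arr .row t = W * t
  pp : s.arr .pp = L.par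
  low : s.arr .low = L.low
  bag : ∀ u ≤ L.N, ListAt w (s.arr .bp u) (L.bag u)
  pos : ∀ v < L.n, ListAt w (s.arr .ptr (v + v)) (L.pos v)
  neg : ∀ v < L.n, ListAt w (s.arr .ptr (v + v + 1)) (L.neg v)

variable {L : Layout} {W d : ℕ}

theorem Ready.frame {s' : Store Var Arr} {xs : List Var} {as : List Arr} (h : Ready w L W s)
    (hf : Frame xs as s s') (hx : ∀ x ∈ [Var.inf, .N, .W], x ∉ xs := by decide)
    (ha : ∀ a ∈ [Arr.half, .odd, .row, .pp, .low, .bp, .ptr], a ∉ as := by decide) :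
    Ready w L W s' where
  inf_eq := by rw [hf.1 _ (hx _ (by simp)), h.inf_eq]
  N_eq := by rw [hf.1 _ (hx _ (by simp)), h.N_eq]
  W_eq := by rw [hf.1 _ (hx _ (by simp)), h.W_eq]
  half := by rw [hf.2 _ (ha _ (by simp))]; exact h.half
  odd := by rw [hf.2 _ (ha _ (by simp))]; exact h.odd
  row := by rw [hf.2 _ (ha _ (by simp))]; exact h.row
  pp := by rw [hf.2 _ (ha _ (by simp))]; exact h.pp
  low := by rw [hf.2 _ (ha _ (by simp))]; exact h.low
  bag := by rw [hf.2 _ (ha _ (by simp))]; exact h.bag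
  pos := by rw [hf.2 _ (ha _ (by simp))]; exact h.pos
  neg := by rw [hf.2 _ (ha _ (by simp))]; exact h.neg

/-- A valid layout with bags of size at most `d` and degrees at most `2 d`, where `W = 2 ^ d`. -/
structure Sized (L : Layout) (W d : ℕ) : Prop where
  valid : L.Valid
  bag_le : ∀ u ≤ L.N, (L.bag u).length ≤ d
  pos_le : ∀ v < L.n, (L.pos v).length ≤ 2 * d
  neg_le : ∀ v < L.n, (L.neg v).length ≤ 2 * d
  pow : 2 ^ d = W

theorem addVertex_spec (hL : Sized L W d) (hs : Ready w L W s) (hv : s.var .v < L.n) :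
    Spec w addVertex s (9 + 12 * d) fun s' =>
      s'.var .val = s.var .val + (s.arr .sel (s.var .v) + L.defect (s.arr .sel) (s.var .v)) := by
  have hp := hL.pos_le _ hv
  have hn := hL.neg_le _ hv
  have hptr : ∀ s' : Store Var Arr, Frame [.val, .sp, .sn, .x, .y] [] s s' →
      s'.var .v = s.var .v ∧ s'.arr .ptr = s.arr .ptr ∧ s'.arr .sel = s.arr .sel ∧
        s'.var .inf = L.n + 1 := fun s' hf =>
    ⟨hf.1 _ (by decide), hf.2 _ (by decide), hf.2 _ (by decide),
      (hf.1 _ (by decide)).trans hs.inf_eq⟩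
  refine (Spec.seq (T := 1) (Spec.set (Spec.seq ((count_spec (dst := .sp) (hs.pos _ hv) (by decide)
    fun s₁ hf₁ => ?_).mono le_rfl fun s₁ hf₁ h₁ => Spec.seq ((count_spec (dst := .sn) (hs.neg _ hv)
    (by decide) fun s₂ hf₂ => ?_).mono le_rfl fun s₂ hf₂ h₂ => ?_))))).mono'
      (by omega : _ + ((2 + (L.pos (s.var .v)).length * 3) +
        ((2 + (L.neg (s.var .v)).length * 3) + 4)) ≤ _)
  · simp only [Expr.eval]
    obtain ⟨h1, h2, -⟩ := hptr s₁ ⟨fun x hx => (hf₁.1 x (by simp_all)).trans (by simp_all), hf₁.2⟩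
    rw [h1, h2]
  · have hf : Frame [.val, .sp, .sn, .x, .y] [] s s₁ :=
      ⟨fun x hx => (hf₁.1 x (by simp_all [count, forEach, Cmd.vars])).trans (by simp_all),
        hf₁.2⟩
    obtain ⟨h1, h2, -⟩ := hptr s₂ ⟨fun x hx => (hf₂.1 x (by simp_all)).trans (hf.1 x hx),
      fun a ha => (hf₂.2 a ha).trans (hf.2 a ha)⟩
    simp only [Expr.eval]
    rw [h1, h2]
  · have hf : Frame [.val, .sp, .sn, .x, .y] [] s s₁ :=
      ⟨fun x hx => (hf₁.1 x (by simp_all [count, forEach, Cmd.vars])).trans (by simp_all),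
        hf₁.2⟩
    obtain ⟨h3, h4, h5, h6⟩ := hptr s₂ ⟨fun x hx => (hf₂.1 x
      (by simp_all [count, forEach, Cmd.vars])).trans (hf.1 x hx),
      fun a ha => (hf₂.2 a ha).trans (hf.2 a ha)⟩
    have h7 : s₂.var .val = s.var .val + s.arr .sel (s.var .v) := by
      rw [hf₂.1 _ (by decide), hf₁.1 _ (by decide)]; simp
    have h8 : s₂.var .sp = ((L.pos (s.var .v)).map (s.arr .sel)).sum := by
      rw [hf₂.1 _ (by decide), h₁]; simp
    rw [hf.2 .sel (by decide)] at h₂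
    have h9 := (hs.pos _ hv).1
    unfold Layout.defect
    rw [← h8, ← h₂, ← h9]
    refine Spec.ite (T := 3) (fun ha => Spec.ite (T := 2) (fun hb => Spec.ite (T := 1)
      (fun hc => Spec.set ?_) (fun hc => Spec.skip ?_)) (fun hb => (Spec.skip ?_).mono' (by omega)))
      (fun ha => (Spec.skip ?_).mono' (by omega))
    all_goals simp only [Expr.eval, eval_sub, h3, h4, h5, h6, h7, var_set, if_true] at *
    · rw [if_pos ⟨by omega, by omega, by omega⟩]; omega
    · rw [if_neg (by omega)]; omega
    · rw [if_neg (by omega)]; omega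
    · rw [if_neg (by omega)]; omega

theorem evaluate_spec (hL : Sized L W d) (hs : Ready w L W s) {u : ℕ} (hu : s.var .u = u)
    (huN : u ≤ L.N) (hbu : ListAt w (s.var .bu) (L.bag u)) :
    Spec w evaluate s (2 + d * (12 + 12 * d)) fun s' =>
      s'.var .val = s.arr .tab (W * u + s.var .c) + L.cost u (s.arr .sel) := by
  have hlen := hL.bag_le u huN
  refine (Spec.seq (T := 1) (Spec.set (Spec.forEach (T := 1 + (9 + 12 * d)) (fun l₁ s' => s'.var Var.val =
    s.arr .tab (W * u + s.var .c) + (l₁.map fun v => if L.low v = u then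
      s.arr .sel v + L.defect (s.arr .sel) v else 0).sum) hbu ?_ ?_ ?_))).mono' ?_
  · intro s' hf
    rw [Expr.eval, hf.1 _ (by decide)]; simp
  · simp [hu, hs.row u huN]
  · intro l₁ v l₂ hl s' hf hs'
    have hvn : v < L.n := hL.valid.bag_lt u huN v (by simp [hl])
    have hR := ((hs.frame ((Frame.refl [.val] [] s).set Var.val _)).frame hf)
    have h1 : s'.arr .low = L.low := hR.low
    have h2 : s'.var .u = u := by rw [hf.1 _ (by decide)]; simp [hu]
    have h3 : s'.arr .sel = s.arr .sel := by rw [hf.2 _ (by decide)]; simp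
    refine ifEq_spec (fun h => ?_) (fun h => ?_) (by omega)
    · simp only [Expr.eval, var_set, arr_set, if_true, reduceCtorEq, if_false, h1, h2] at h
      refine (addVertex_spec hL (s := (s'.set .j _).set .v v)
        (hR.frame (((Frame.refl [.j, .v] [] s').set Var.j _).set Var.v _)) (by simpa using hvn)).mono le_rfl
        fun s'' _ h' => ?_
      rw [h']
      simp [h, hs', h3, add_assoc]
    · simp only [Expr.eval, var_set, arr_set, if_true, reduceCtorEq, if_false, h1, h2] at h
      simp [h, hs']
  · have := Nat.mul_le_mul_right (12 + 12 * d) hlen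
    have h2 : 2 + (1 + (9 + 12 * d)) = 12 + 12 * d := by omega
    rw [h2]
    omega

theorem minimize_spec : Spec w minimize s 6 fun s' =>
    s'.var .m = min (s.var .val) (s.var .m) ∧
    s'.var .ans = if s.var .a = 0 ∧ 0 < s.var .c then min (s.var .val) (s.var .ans)
      else s.var .ans := by
  have h2 : ∀ s₁ : Store Var Arr, s₁.var .m = min (s.var .val) (s.var .m) →
      Frame [.m] [] s s₁ → Spec w (.ite (V .a) (K 1)
    (.ite (K 0) (V .c) (.ite (V .val) (V .ans) (.set .ans (V .val)) .skip) .skip) .skip) s₁ 4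
    fun s' => s'.var .m = min (s.var .val) (s.var .m) ∧
    s'.var .ans = if s.var .a = 0 ∧ 0 < s.var .c then min (s.var .val) (s.var .ans)
      else s.var .ans := by
    intro s₁ hm hf
    have h3 := hf.1 .val (by decide)
    have h4 := hf.1 .ans (by decide)
    have h5 := hf.1 .a (by decide)
    have h6 := hf.1 .c (by decide)
    rw [← h3] at hm ⊢
    rw [← h4, ← h5, ← h6]
    refine Spec.ite (T := 3) (fun ha => Spec.ite (T := 2) (fun hb => Spec.ite (T := 1)
      (fun hc => Spec.set ?_) (fun hc => Spec.skip ?_)) (fun hb => (Spec.skip ?_).mono' (by omega)))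
      (fun ha => (Spec.skip ?_).mono' (by omega))
    all_goals simp only [Expr.eval] at *
    · rw [if_pos ⟨by omega, hb⟩]
      simp [hm, hc.le]
    · rw [if_pos ⟨by omega, hb⟩]
      exact ⟨hm, by omega⟩
    · rw [if_neg (by omega)]
      exact ⟨hm, rfl⟩
    · rw [if_neg (by omega)]
      exact ⟨hm, rfl⟩
  refine Spec.seq (T := 2) (T' := 4) (Spec.ite (T := 1) (fun h => Spec.set (h2 _ ?_ ?_))
    fun h => Spec.skip (h2 _ ?_ ?_))
  · simp only [Expr.eval] at h
    simp [h.le]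
  · exact (Frame.refl [.m] [] s).set Var.m _
  · simp only [Expr.eval] at h
    omega
  · exact Frame.refl [.m] [] s

/-! ### Messages, and the sweep over the bags -/

theorem tryCodes_spec (hL : Sized L W d) (hs : Ready w L W s) {u : ℕ} (hu : s.var .u = u)
    (huN : u ≤ L.N) (hpN : L.par u ≤ L.N) (hbu : ListAt w (s.var .bu) (L.bag u))
    (hbq : ListAt w (s.var .bq) (L.bag (L.par u)))
    (ha : s.var .a < W) (hc : s.var .c < W) (hsel : IsIndicator (s.arr .sel)) :
    Spec w tryCodes s (20 + 18 * d + d * (12 + 12 * d)) fun s' => IsIndicator (s'.arr .sel) ∧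
      s'.var .m ≤ s.var .m ∧ s'.var .ans ≤ s.var .ans ∧
      (∀ f, IsIndicator f → code f (L.bag (L.par u)) = s.var .a → code f (L.bag u) = s.var .c →
        s'.var .m ≤ s.arr .tab (W * u + s.var .c) + L.cost u f ∧
        (s.var .a = 0 → 0 < s.var .c →
          s'.var .ans ≤ s.arr .tab (W * u + s.var .c) + L.cost u f)) ∧
      (s'.var .m = s.var .m ∨ ∃ f, IsIndicator f ∧ code f (L.bag (L.par u)) = s.var .a ∧
        code f (L.bag u) = s.var .c ∧ s'.var .m = s.arr .tab (W * u + s.var .c) + L.cost u f) ∧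
      (s'.var .ans = s.var .ans ∨ ∃ f, IsIndicator f ∧ code f (L.bag (L.par u)) = s.var .a ∧
        code f (L.bag u) = s.var .c ∧ s.var .a = 0 ∧ 0 < s.var .c ∧
        s'.var .ans = s.arr .tab (W * u + s.var .c) + L.cost u f) := by
  have hlu := hL.bag_le u huN
  have hlp := hL.bag_le _ hpN
  refine (Spec.seq ((decode_spec hbu (hL.valid.nodup u huN) (by decide) hs.half hs.odd hc
    hsel).mono le_rfl fun s₁ hf₁ ⟨h11, h12, h13⟩ => ?_)).mono'
    (by omega : _ + ((2 + (L.bag (L.par u)).length * 4) + ((3 + (L.bag u).length * 5) +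
      ((3 + (L.bag (L.par u)).length * 5) + (1 + (1 + (2 + d * (12 + 12 * d) + 6)))))) ≤ _)
  have hs₁ : Ready w L W s₁ := hs.frame hf₁
  have v1 : ∀ x ∈ [Var.u, .bu, .bq, .a, .c, .m, .ans], s₁.var x = s.var x := fun x hx =>
    hf₁.1 x (by revert x; decide)
  have t1 : s₁.arr .tab = s.arr .tab := hf₁.2 _ (by decide)
  simp only [List.forall_mem_cons] at v1
  obtain ⟨u1, bu1, bq1, a1, c1, m1, ans1, -⟩ := v1
  refine Spec.seq ((decode_spec (by rw [bq1]; exact hbq) (hL.valid.nodup _ hpN) (by decide) hs₁.half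
    hs₁.odd (by rw [a1]; exact ha) h11).mono le_rfl fun s₂ hf₂ ⟨h21, h22, h23⟩ => ?_)
  have hs₂ : Ready w L W s₂ := hs₁.frame hf₂
  have v2 : ∀ x ∈ [Var.u, .bu, .bq, .a, .c, .m, .ans], s₂.var x = s₁.var x := fun x hx =>
    hf₂.1 x (by revert x; decide)
  have t2 : s₂.arr .tab = s₁.arr .tab := hf₂.2 _ (by decide)
  simp only [List.forall_mem_cons, u1, bu1, bq1, a1, c1, m1, ans1] at v2
  obtain ⟨u2, bu2, bq2, a2, c2, m2, ans2, -⟩ := v2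
  refine Spec.seq ((encode_spec (dst := .e₁) (l := L.bag u) (by rw [bu2]; exact hbu) (by decide)
    (by decide) h21).mono le_rfl fun s₃ hf₃ h3 => ?_)
  have hs₃ : Ready w L W s₃ := hs₂.frame hf₃
  have v3 : ∀ x ∈ [Var.u, .bu, .bq, .a, .c, .m, .ans], s₃.var x = s₂.var x := fun x hx =>
    hf₃.1 x (by revert x; decide)
  have t3 : s₃.arr .tab = s₂.arr .tab := hf₃.2 _ (by decide)
  have sel3 : s₃.arr .sel = s₂.arr .sel := hf₃.2 _ (by decide)
  simp only [List.forall_mem_cons, u2, bu2, bq2, a2, c2, m2, ans2] at v3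
  obtain ⟨u3, bu3, bq3, a3, c3, m3, ans3, -⟩ := v3
  refine Spec.seq ((encode_spec (dst := .e₂) (l := L.bag (L.par u)) (by rw [bq3]; exact hbq)
    (by decide) (by decide) (by rw [sel3]; exact h21)).mono le_rfl fun s₄ hf₄ h4 => ?_)
  have hs₄ : Ready w L W s₄ := hs₃.frame hf₄
  have v4 : ∀ x ∈ [Var.e₁, .u, .bu, .bq, .a, .c, .m, .ans], s₄.var x = s₃.var x := fun x hx =>
    hf₄.1 x (by revert x; decide)
  have t4 : s₄.arr .tab = s₃.arr .tab := hf₄.2 _ (by decide)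
  have sel4 : s₄.arr .sel = s₂.arr .sel := (hf₄.2 _ (by decide)).trans sel3
  simp only [List.forall_mem_cons, u3, bu3, bq3, a3, c3, m3, ans3] at v4
  obtain ⟨e4, u4, bu4, bq4, a4, c4, m4, ans4, -⟩ := v4
  rw [t3, t2, t1] at t4
  rw [h3] at e4
  rw [sel3] at h4
  -- a set with these codes is what has been decoded
  have hdec : ∀ f, IsIndicator f → code f (L.bag (L.par u)) = s.var .a →
      code f (L.bag u) = s.var .c →
      (∀ v ∈ L.bag u, s₂.arr .sel v = f v) ∧ ∀ v ∈ L.bag (L.par u), s₂.arr .sel v = f v := by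
    intro f hf hfa hfc
    have h5 := h23 f hf (hfa.trans a1.symm)
    refine ⟨fun v hv => ?_, h5⟩
    by_cases hvp : v ∈ L.bag (L.par u)
    · exact h5 v hvp
    · rw [h22 v hvp, h13 f hf hfc v hv]
  have hno : (code (s₂.arr .sel) (L.bag u) = s.var .c →
      code (s₂.arr .sel) (L.bag (L.par u)) ≠ s.var .a) →
      ∀ f, IsIndicator f → code f (L.bag (L.par u)) = s.var .a →
      code f (L.bag u) = s.var .c → False := by
    intro hne f hf hfa hfc
    obtain ⟨h5, h6⟩ := hdec f hf hfa hfc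
    exact hne ((code_congr h5).trans hfc) ((code_congr h6).trans hfa)
  have hsel4 : IsIndicator (s₄.arr .sel) := by rw [sel4]; exact h21
  refine ifEq_spec (fun hec => ifEq_spec (fun hea => ?_) (fun hea => ?_) (by omega))
    (fun hec => ?_) (by omega)
  · simp only [Expr.eval] at hec hea
    refine Spec.seq ((evaluate_spec hL hs₄ (u4.trans hu) huN (by rw [bu4]; exact hbu)).mono le_rfl
      fun s₅ hf₅ h5 => ?_)
    have v5 : ∀ x ∈ [Var.a, .c, .m, .ans], s₅.var x = s₄.var x := fun x hx =>
      hf₅.1 x (by revert x; decide)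
    have sel5 : s₅.arr .sel = s₂.arr .sel := (hf₅.2 _ (by decide)).trans sel4
    simp only [List.forall_mem_cons, a4, c4, m4, ans4] at v5
    obtain ⟨a5, c5, m5, ans5, -⟩ := v5
    refine minimize_spec.mono le_rfl fun s₆ hf₆ ⟨hm, hans⟩ => ?_
    have sel6 : s₆.arr .sel = s₂.arr .sel := (hf₆.2 _ (by decide)).trans sel5
    rw [t4, c4, sel4] at h5
    rw [h5, m5] at hm
    rw [h5, a5, c5, ans5] at hans
    have hcode1 : code (s₂.arr .sel) (L.bag u) = s.var .c := by rw [← e4, hec, c4]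
    have hcode2 : code (s₂.arr .sel) (L.bag (L.par u)) = s.var .a := by rw [← h4, hea, a4]
    refine ⟨by rw [sel6]; exact h21, by omega, by rw [hans]; split_ifs <;> omega,
      fun f hf hfa hfc => ?_, ?_, ?_⟩
    · obtain ⟨h6, h7⟩ := hdec f hf hfa hfc
      rw [← hL.valid.cost_congr huN h6 h7]
      refine ⟨by omega, fun h8 h9 => ?_⟩
      rw [hans, if_pos ⟨h8, h9⟩]
      omega
    · rw [hm]
      rcases le_total (s.arr .tab (W * u + s.var .c) + L.cost u (s₂.arr .sel)) (s.var .m)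
        with h | h
      · exact Or.inr ⟨_, h21, hcode2, hcode1, min_eq_left h⟩
      · exact Or.inl (min_eq_right h)
    · rw [hans]
      split_ifs with hif
      · rcases le_total (s.arr .tab (W * u + s.var .c) + L.cost u (s₂.arr .sel)) (s.var .ans)
          with h | h
        · exact Or.inr ⟨_, h21, hcode2, hcode1, hif.1, hif.2, min_eq_left h⟩
        · exact Or.inl (min_eq_right h)
      · exact Or.inl rfl
  · simp only [Expr.eval, h4, a4] at hea
    exact ⟨hsel4, m4.le, ans4.le, fun f hf h5 h6 => (hno (fun _ => hea) f hf h5 h6).elim,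
      Or.inl m4, Or.inl ans4⟩
  · simp only [Expr.eval, e4, c4] at hec
    exact ⟨hsel4, m4.le, ans4.le, fun f hf h5 h6 => (hno (fun h => (hec h).elim) f hf h5 h6).elim,
      Or.inl m4, Or.inl ans4⟩

/-- The entry of the table of bag `t` for the code `a`. -/
def table (W : ℕ) (s : Store Var Arr) (t a : ℕ) : ℕ := s.arr .tab (W * t + a)

theorem mul_add_inj {W t a t' a' : ℕ} (ha : a < W) (ha' : a' < W) (h : W * t + a = W * t' + a') :
    t = t' ∧ a = a' := by
  have h1 : (W * t + a) / W = t := by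
    rw [Nat.mul_add_div (by omega), Nat.div_eq_of_lt ha, add_zero]
  have h2 : (W * t' + a') / W = t' := by
    rw [Nat.mul_add_div (by omega), Nat.div_eq_of_lt ha', add_zero]
  have : t = t' := by rw [← h1, h, h2]
  subst this
  omega

/-- A bound for the cost of `sendMessage`. -/
def messageCost (W d : ℕ) : ℕ := 3 + W * (21 + 18 * d + d * (12 + 12 * d))

theorem sendMessage_spec (hL : Sized L W d) (hs : Ready w L W s) {u : ℕ} (hu : s.var .u = u)
    (huN : u ≤ L.N) (hpN : L.par u ≤ L.N) (hq : s.var .q = L.par u)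
    (hbu : ListAt w (s.var .bu) (L.bag u)) (hbq : ListAt w (s.var .bq) (L.bag (L.par u)))
    (ha : s.var .a < W) (hsel : IsIndicator (s.arr .sel)) :
    Spec w sendMessage s (messageCost W d) fun s' => IsIndicator (s'.arr .sel) ∧
      (∃ m, L.IsMessage (table W s) u (s.var .a) m ∧
        table W s' (L.par u) (s.var .a) = table W s (L.par u) (s.var .a) + m) ∧
      (∀ t b, b < W → t ≠ L.par u ∨ b ≠ s.var .a → table W s' t b = table W s t b) ∧
      s'.var .ans ≤ s.var .ans ∧
      (s.var .a = 0 → ∀ f, IsIndicator f → code f (L.bag (L.par u)) = 0 → 0 < code f (L.bag u) →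
        s'.var .ans ≤ table W s u (code f (L.bag u)) + L.cost u f) ∧
      (s'.var .ans = s.var .ans ∨ ∃ f, IsIndicator f ∧ code f (L.bag (L.par u)) = 0 ∧
        0 < code f (L.bag u) ∧
        s'.var .ans = table W s u (code f (L.bag u)) + L.cost u f) := by
  refine (Spec.seq (T := 1) (Spec.set (Spec.seq (Spec.mono (Spec.loop_const (m := W)
    (fun i s' => IsIndicator (s'.arr .sel) ∧ s'.var .ans ≤ s.var .ans ∧
      (∀ f, IsIndicator f → code f (L.bag (L.par u)) = s.var .a → code f (L.bag u) < i →
        s'.var .m ≤ table W s u (code f (L.bag u)) + L.cost u f ∧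
        (s.var .a = 0 → 0 < code f (L.bag u) →
          s'.var .ans ≤ table W s u (code f (L.bag u)) + L.cost u f)) ∧
      (s'.var .m = L.n + 1 ∨ ∃ f, IsIndicator f ∧ code f (L.bag (L.par u)) = s.var .a ∧
        s'.var .m = table W s u (code f (L.bag u)) + L.cost u f) ∧
      (s'.var .ans = s.var .ans ∨ ∃ f, IsIndicator f ∧ code f (L.bag (L.par u)) = 0 ∧
        0 < code f (L.bag u) ∧
        s'.var .ans = table W s u (code f (L.bag u)) + L.cost u f))
    (20 + 18 * d + d * (12 + 12 * d)) ?_ ?_ ?_) le_rfl fun s' hf' hs' => Spec.put ?_)))).mono' ?_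
  · simp [hs.W_eq]
  · refine ⟨hsel, le_rfl, fun f _ _ h => absurd h (Nat.not_lt_zero _), Or.inl ?_, Or.inl rfl⟩
    simp [hs.inf_eq]
  · intro i hi s' hf ⟨h1, h2, h3, h4, h5⟩
    have hf' : Frame [.r, .x, .y, .pw, .e₁, .e₂, .val, .j, .v, .sp, .sn, .m, .ans, .c] [.sel] s
        (s'.set .c i) := by
      exact (((Frame.refl _ _ s).set Var.m _).trans (hf.mono (by decide) (by decide))).set Var.c _
    have htab : s'.arr .tab = s.arr .tab := hf'.2 .tab (by decide)
    have ha' : (s'.set .c i).var .a = s.var .a := hf'.1 _ (by decide)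
    refine (tryCodes_spec hL (hs.frame hf') ((hf'.1 _ (by decide)).trans hu) huN hpN
      (by rw [hf'.1 _ (by decide)]; exact hbu) (by rw [hf'.1 _ (by decide)]; exact hbq)
      (by rw [ha']; exact ha) (by simpa using hi) h1).mono le_rfl ?_
    intro s'' _ ⟨g1, g2, g3, g4, g5, g6⟩
    rw [ha'] at g4 g5 g6
    simp only [var_set, if_true, reduceCtorEq, if_false, arr_set, htab] at g2 g3 g4 g5 g6
    refine ⟨g1, g3.trans h2, fun f hf hfa hfi => ?_, ?_, ?_⟩
    · rcases Nat.lt_succ_iff_lt_or_eq.mp hfi with hlt | heq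
      · obtain ⟨k1, k2⟩ := h3 f hf hfa hlt
        exact ⟨g2.trans k1, fun k3 k4 => g3.trans (k2 k3 k4)⟩
      · obtain ⟨k1, k2⟩ := g4 f hf hfa heq
        rw [heq]
        exact ⟨k1, k2⟩
    · rcases g5 with g5 | ⟨f, k1, k2, k3, k4⟩
      · rw [g5]; exact h4
      · exact Or.inr ⟨f, k1, k2, by rw [k3]; exact k4⟩
    · rcases g6 with g6 | ⟨f, k1, k2, k3, k4, k5, k6⟩
      · rw [g6]; exact h5
      · exact Or.inr ⟨f, k1, k2.trans k4, by rw [k3]; exact k5, by rw [k3]; exact k6⟩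
  · obtain ⟨h1, h2, h3, h4, h5⟩ := hs'
    have hf : Frame [.r, .x, .y, .pw, .e₁, .e₂, .val, .j, .v, .sp, .sn, .m, .ans, .c] [.sel] s
        s' := by
      exact ((Frame.refl _ _ s).set Var.m _).trans (hf'.mono (by decide) (by decide))
    have htab : s'.arr .tab = s.arr .tab := hf.2 .tab (by decide)
    have ha' : s'.var .a = s.var .a := hf.1 _ (by decide)
    have hq' : s'.var .q = L.par u := (hf.1 _ (by decide)).trans hq
    have hrow := (hs.frame hf).row _ hpN
    have hlt : ∀ f, IsIndicator f → code f (L.bag u) < W := fun f hf' =>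
      (code_lt hf' _).trans_le (by
        rw [← hL.pow]; exact Nat.pow_le_pow_right (by omega) (hL.bag_le u huN))
    simp only [Expr.eval, hq', hrow, ha', htab, arr_put, if_true, reduceCtorEq, if_false,
      var_put, table]
    refine ⟨h1, ⟨s'.var .m, ⟨fun f hf hfa => (h3 f hf hfa (hlt f hf)).1, h4⟩, by simp⟩,
      fun t b hb hne => ?_, h2, fun ha0 f hf hfa hfc => ?_, h5⟩
    · rw [Function.update_of_ne]
      intro heq
      obtain ⟨k1, k2⟩ := mul_add_inj hb ha heq
      exact hne.elim (· k1) (· k2)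
    · exact (h3 f hf (hfa.trans ha0.symm) (hlt f hf)).2 ha0 hfc
  · have : 1 + (20 + 18 * d + d * (12 + 12 * d)) = 21 + 18 * d + d * (12 + 12 * d) := by omega
    rw [messageCost, this]
    omega

theorem processBag_spec (hL : Sized L W d) (hs : Ready w L W s) {i : ℕ} (hi : i < L.N)
    (hsi : s.var .i + (i + 1) = L.N) (hsel : IsIndicator (s.arr .sel)) :
    Spec w processBag s (5 + W * (1 + messageCost W d)) fun s' => IsIndicator (s'.arr .sel) ∧
      L.IsStep W (table W s) (i + 1) (s.var .ans) (table W s') (s'.var .ans) := by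
  have hp : L.par (i + 1) < i + 1 := hL.valid.par_lt _ (by omega) (by omega)
  have hu : L.N - s.var .i = i + 1 := by omega
  have hW0 : 0 < W := by rw [← hL.pow]; positivity
  refine (Spec.seq (T := 1) (Spec.set (Spec.seq (T := 1) (Spec.set (Spec.seq (T := 1) (Spec.set
    (Spec.seq (T := 1) (Spec.set (Spec.mono (Spec.loop_const (m := W)
    (fun a s' => IsIndicator (s'.arr .sel) ∧
      (∀ b < a, ∃ m, L.IsMessage (table W s) (i + 1) b m ∧
        table W s' (L.par (i + 1)) b = table W s (L.par (i + 1)) b + m) ∧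
      (∀ t b, b < W → t ≠ L.par (i + 1) ∨ a ≤ b → table W s' t b = table W s t b) ∧
      s'.var .ans ≤ s.var .ans ∧
      (0 < a → ∀ f, IsIndicator f → code f (L.bag (L.par (i + 1))) = 0 →
        0 < code f (L.bag (i + 1)) →
        s'.var .ans ≤ table W s (i + 1) (code f (L.bag (i + 1))) + L.cost (i + 1) f) ∧
      (s'.var .ans = s.var .ans ∨ ∃ f, IsIndicator f ∧ code f (L.bag (L.par (i + 1))) = 0 ∧
        0 < code f (L.bag (i + 1)) ∧
        s'.var .ans = table W s (i + 1) (code f (L.bag (i + 1))) + L.cost (i + 1) f))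
    (messageCost W d) ?_ ?_ ?_) le_rfl fun s' hf' hs' => ?_))))))))).mono' (by omega)
  · simp [hs.W_eq]
  · refine ⟨hsel, fun b hb => absurd hb (Nat.not_lt_zero _), fun t b _ _ => rfl, le_rfl,
      fun h => absurd h (Nat.not_lt_zero _), Or.inl rfl⟩
  · intro a ha s' hf ⟨h1, h2, h3, h4, h5, h6⟩
    set s₀ := (((s.set .u (Expr.eval w s (V .N - V .i))).set .q _).set .bu _).set .bq _ with hs₀
    have hR : Ready w L W s₀ := hs.frame (((((Frame.refl [.u, .q, .bu, .bq] [] s).set Var.u _).set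
      Var.q _).set Var.bu _).set Var.bq _)
    have hfs : Frame [.r, .x, .y, .pw, .e₁, .e₂, .val, .j, .v, .sp, .sn, .m, .ans, .c, .a]
        [.sel, .tab] s₀ (s'.set .a a) := by
      exact (hf.mono (by decide) (by decide)).set Var.a _
    have hu0 : s₀.var .u = i + 1 := by simp [hs₀, hs.N_eq, hu]
    have hq0 : s₀.var .q = L.par (i + 1) := by simp [hs₀, hs.N_eq, hu, hs.pp]
    have hbu0 : s₀.var .bu = s₀.arr .bp (i + 1) := by simp [hs₀, hs.N_eq, hu]
    have hbq0 : s₀.var .bq = s₀.arr .bp (L.par (i + 1)) := by simp [hs₀, hs.N_eq, hu, hs.pp]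
    refine (sendMessage_spec hL (hR.frame hfs) (u := i + 1)
      ((hfs.1 _ (by decide)).trans hu0) hi (by omega)
      ((hfs.1 _ (by decide)).trans hq0)
      (by rw [hfs.1 _ (by decide), hbu0]; exact hR.bag _ hi)
      (by rw [hfs.1 _ (by decide), hbq0]; exact hR.bag _ (by omega))
      (by simpa using ha) h1).mono le_rfl ?_
    rintro s'' - ⟨g1, ⟨m, g2, g2'⟩, g3, g4, g5, g6⟩
    have htu : ∀ b < W, table W (s'.set .a a) (i + 1) b = table W s (i + 1) b := fun b hb =>
      h3 _ b hb (Or.inl (by omega))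
    have hlt : ∀ f, IsIndicator f → code f (L.bag (i + 1)) < W := fun f hf' =>
      (code_lt hf' _).trans_le (by
        rw [← hL.pow]; exact Nat.pow_le_pow_right (by omega) (hL.bag_le _ hi))
    have hva : (s'.set .a a).var .a = a := by simp
    have hvans : (s'.set .a a).var .ans = s'.var .ans := by simp
    have htab : ∀ t b, table W (s'.set .a a) t b = table W s' t b := fun t b => rfl
    rw [hva] at g2 g2' g3 g5
    rw [hvans] at g4 g6
    refine ⟨g1, fun b hb => ?_, fun t b hb hne => ?_, g4.trans h4, fun _ f hf hf0 hfc => ?_, ?_⟩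
    · rcases Nat.lt_succ_iff_lt_or_eq.mp hb with hlt' | rfl
      · obtain ⟨m', k1, k2⟩ := h2 b hlt'
        exact ⟨m', k1, by rw [g3 _ b (by omega) (Or.inr (by omega)), htab, k2]⟩
      · refine ⟨m, ⟨fun f hf hfa => ?_, ?_⟩, ?_⟩
        · have := g2.1 f hf hfa
          rwa [htu _ (hlt f hf)] at this
        · rcases g2.2 with k | ⟨f, k1, k2, k3⟩
          · exact Or.inl k
          · rw [htu _ (hlt f k1)] at k3
            exact Or.inr ⟨f, k1, k2, k3⟩
        · rw [g2', htab, h3 _ b ha (Or.inr le_rfl)]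
    · rw [g3 t b hb (hne.imp id (by omega)), htab, h3 t b hb (hne.imp id (by omega))]
    · rcases Nat.eq_zero_or_pos a with ha0 | ha0
      · have := g5 ha0 f hf hf0 hfc
        rwa [htu _ (hlt f hf)] at this
      · exact g4.trans (h5 ha0 f hf hf0 hfc)
    · rcases g6 with g6 | ⟨f, k1, k2, k3, k4⟩
      · rw [g6]; exact h6
      · rw [htu _ (hlt f k1)] at k4
        exact Or.inr ⟨f, k1, k2, k3, k4⟩
  · obtain ⟨h1, h2, h3, h4, h5, h6⟩ := hs'
    exact ⟨h1, fun t a ha hne => h3 t a ha (Or.inl hne), h2, h4, h5 hW0, h6⟩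

theorem solve_spec (hL : Sized L W d) (hs : Ready w L W s) (hsel : IsIndicator (s.arr .sel))
    (htab : ∀ i, s.arr .tab i = 0) :
    Spec w solve s (2 + L.N * (6 + W * (1 + messageCost W d))) fun s' =>
      ∃ F, L.Inv F 0 (s'.var .ans) := by
  refine (Spec.seq (T := 1) (Spec.set (Spec.mono (Spec.loop_const (m := L.N)
    (fun i s' => IsIndicator (s'.arr .sel) ∧ L.Inv (table W s') (L.N - i) (s'.var .ans))
    (5 + W * (1 + messageCost W d)) ?_ ?_ ?_) le_rfl fun s' hf' hs' => ?_))).mono' ?_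
  · simp [hs.N_eq]
  · refine ⟨hsel, ?_⟩
    have : table W (s.set .ans (Expr.eval w s (V .inf))) = fun _ _ => 0 := by
      funext t a
      exact htab _
    rw [this]
    simpa [hs.inf_eq] using Layout.inv_init (L := L)
  · intro i hi s' hf ⟨h1, h2⟩
    have hR : Ready w L W (s'.set .i i) :=
      ((hs.frame ((Frame.refl [.ans] [] s).set Var.ans _)).frame hf).frame
        ((Frame.refl [.i] [] s').set Var.i _)
    refine (processBag_spec hL hR (i := L.N - (i + 1)) (by omega) (by simp; omega)
      h1).mono le_rfl ?_
    rintro s'' - ⟨h3, h4⟩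
    refine ⟨h3, hL.valid.inv_step (W := W) (by omega) (fun t ht => ?_) ?_ h4⟩
    · rw [← hL.pow]; exact Nat.pow_le_pow_right (by omega) (hL.bag_le t ht)
    · have : L.N - (i + 1) + 1 = L.N - i := by omega
      rw [this, var_set, if_neg (by decide)]
      exact h2
  · simp only [Nat.sub_self] at hs'
    exact ⟨_, hs'.2⟩
  · have : 1 + (5 + W * (1 + messageCost W d)) = 6 + W * (1 + messageCost W d) := by omega
    rw [this]
    omega

end

/-! ### Reading the input -/

section

variable {w : ℕ → ℕ} {s : Store Var Arr}

/-- The position in the input word of list number `i`: there are three numbers before the first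
list, and every list is preceded by its length. -/
def start (ls : ℕ → List ℕ) : ℕ → ℕ
  | 0 => 3
  | i + 1 => start ls i + 1 + (ls i).length

/-- The word `w` consists of the numbers `n`, `k`, `N` and the lists `ls i` for `i < 2 n + 2 N`,
followed by zeros: two lists for each of `n` vertices, then bags and neighbours of `N` nodes. -/
structure Encodes (w : ℕ → ℕ) (n k N : ℕ) (ls : ℕ → List ℕ) : Prop where
  n_eq : w 0 = n
  k_eq : w 1 = k
  N_eq : w 2 = N
  list : ∀ i < n + n + N + N, ListAt w (start ls i) (ls i)
  zero : w (start ls (n + n + N + N)) = 0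

/-- The size of the largest bag. -/
def bagSize (n N : ℕ) (ls : ℕ → List ℕ) : ℕ :=
  (Finset.range N).sup fun t => (ls (n + n + t)).length

/-- The input has been read, and the positions of the lists have been stored. -/
structure Scanned (n k N : ℕ) (ls : ℕ → List ℕ) (s : Store Var Arr) : Prop where
  n_eq : s.var .n = n
  k_eq : s.var .k = k
  N_eq : s.var .N = N
  inf_eq : s.var .inf = n + 1
  ptr : ∀ i < n + n + N + N, s.arr .ptr i = start ls i
  bp : s.arr .bp 0 = start ls (n + n + N + N)

variable {n k N : ℕ} {ls : ℕ → List ℕ}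

theorem Scanned.frame {s' : Store Var Arr} {xs : List Var} {as : List Arr}
    (h : Scanned n k N ls s) (hf : Frame xs as s s')
    (hx : ∀ x ∈ [Var.n, .k, .N, .inf], x ∉ xs := by decide)
    (ha : ∀ a ∈ [Arr.ptr, .bp], a ∉ as := by decide) : Scanned n k N ls s' where
  n_eq := by rw [hf.1 _ (hx _ (by simp)), h.n_eq]
  k_eq := by rw [hf.1 _ (hx _ (by simp)), h.k_eq]
  N_eq := by rw [hf.1 _ (hx _ (by simp)), h.N_eq]
  inf_eq := by rw [hf.1 _ (hx _ (by simp)), h.inf_eq]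
  ptr := by rw [hf.2 _ (ha _ (by simp))]; exact h.ptr
  bp := by rw [hf.2 _ (ha _ (by simp))]; exact h.bp

theorem scan_spec (hw : Encodes w n k N ls) :
    Spec w scan s (7 + (n + n + N + N) * 3) fun s' => Scanned n k N ls s' := by
  set M := n + n + N + N with hM
  refine (Spec.seq (T := 1) (Spec.set (Spec.seq (T := 1) (Spec.set (Spec.seq (T := 1) (Spec.set
    (Spec.seq (T := 1) (Spec.set (Spec.seq (T := 1) (Spec.set (Spec.seq (Spec.mono
    (Spec.loop_const (m := M) (fun i s' => s'.var .p = start ls i ∧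
      ∀ j < i, s'.arr .ptr j = start ls j) 2 ?_ ?_ ?_) le_rfl
      fun s' hf hs' => Spec.put ?_)))))))))))).mono' (by omega)
  · simp [hw.n_eq, hw.N_eq, hM]
  · simp [start]
  · intro i hi s' hf ⟨h1, h2⟩
    refine Spec.seq (T := 1) (T' := 1) (Spec.put (Spec.set ⟨?_, fun j hj => ?_⟩))
    · simp [h1, start, (hw.list i hi).1]
    · rcases Nat.lt_succ_iff_lt_or_eq.mp hj with hlt | rfl
      · simp [Function.update_of_ne hlt.ne, h2 j hlt]
      · simp [h1]
  · obtain ⟨h1, h2⟩ := hs'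
    have h3 := hf.1 .n (by decide)
    have h4 := hf.1 .k (by decide)
    have h5 := hf.1 .N (by decide)
    have h6 := hf.1 .inf (by decide)
    simp only [var_set, reduceCtorEq, if_true, if_false, Expr.eval, hw.n_eq, hw.k_eq,
      hw.N_eq] at h3 h4 h5 h6
    exact ⟨h3, h4, h5, h6, by simpa using h2, by simp [h1, hM]⟩

theorem width_spec (hw : Encodes w n k N ls) (hs : Scanned n k N ls s) :
    Spec w width s (4 + N * 4 + bagSize n N ls * 2) fun s' =>
      s'.var .wd = bagSize n N ls ∧ s'.var .W = 2 ^ bagSize n N ls := by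
  refine (Spec.seq (T := 1) (Spec.set (Spec.seq (Spec.mono (Spec.loop_const (m := N)
    (fun i s' => s'.var .wd = bagSize n i ls) 3 ?_ ?_ ?_) le_rfl fun s₁ hf₁ hs₁ => Spec.seq (T := 1)
    (Spec.set (Spec.mono (Spec.loop_const (m := bagSize n N ls)
      (fun i s' => s'.var .W = 2 ^ i) 1 ?_ ?_ ?_) le_rfl fun s₂ hf₂ hs₂ => ⟨?_, hs₂⟩)))))).mono'
      (by omega)
  · simp [hs.N_eq]
  · simp [bagSize]
  · intro i hi s' hf h1
    have hs' : Scanned n k N ls s' := (hs.frame ((Frame.refl [.wd] [] s).set Var.wd _)).frame hf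
    have h2 : w (s'.arr .ptr (n + n + i)) = (ls (n + n + i)).length := by
      rw [hs'.ptr _ (by omega), (hw.list _ (by omega)).1]
    have h3 : bagSize n (i + 1) ls = max (bagSize n i ls) (ls (n + n + i)).length := by
      rw [bagSize, Finset.range_add_one, Finset.sup_insert, max_comm]; rfl
    refine Spec.seq (T := 1) (T' := 2) (Spec.set (Spec.ite (T := 1) (fun h => Spec.set ?_)
      fun h => Spec.skip ?_))
    all_goals simp only [Expr.eval, var_set, arr_set, reduceCtorEq, if_true, if_false,
      hs'.n_eq, h1, h2, h3] at h ⊢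
    · omega
    · omega
  · simp [hs₁]
  · simp
  · intro i hi s' hf h1
    refine Spec.set ?_
    simp [h1, pow_succ, mul_two]
  · rw [hf₂.1 _ (by decide)]
    simp [hs₁]

theorem tables_spec {W : ℕ} (hN : s.var .N = N) (hW : s.var .W = W) :
    Spec w tables s (6 + W * 5 + N * 3) fun s' =>
      (∀ i < W, s'.arr .half i = i / 2 ∧ s'.arr .odd i = i % 2) ∧
      ∀ t ≤ N, s'.arr .row t = W * t := by
  refine (Spec.seq (Spec.mono (Spec.loop_const (m := W) (fun i s' => ∀ r < 2 * i,
    s'.arr .half r = r / 2 ∧ s'.arr .odd r = r % 2) 4 ?_ ?_ ?_) le_rfl fun s₁ hf₁ hs₁ => Spec.seq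
    (T := 1) (Spec.set (Spec.mono (Spec.loop_const (m := N + 1) (fun i s' => s'.var .r = W * i ∧
      ∀ t < i, s'.arr .row t = W * t) 2 ?_ ?_ ?_) le_rfl fun s₂ hf₂ hs₂ => ⟨?_, ?_⟩)))).mono'
      (by omega)
  · simp [hW]
  · simp
  · intro i hi s' hf h1
    refine Spec.seq (T := 1) (T' := 1 + (1 + 1)) (Spec.put (Spec.seq (Spec.put (Spec.seq
      (Spec.put (Spec.put fun r hr => ?_))))))
    simp only [arr_put, Expr.eval, var_put, var_set, arr_set, if_true, reduceCtorEq,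
      if_false, Function.update_apply]
    by_cases h2 : r = i + i + 1
    · simp only [h2, if_true]; omega
    · by_cases h3 : r = i + i
      · simp only [h3, if_true]
        rw [if_neg (by omega), if_neg (by omega)]; omega
      · simp only [h2, h3, if_false]
        exact h1 r (by omega)
  · simp [hf₁.1 .N (by decide), hN]
  · simp
  · intro i hi s' hf ⟨h1, h2⟩
    have h3 : s'.var .W = W := by
      rw [hf.1 _ (by decide), var_set, if_neg (by decide), hf₁.1 _ (by decide), hW]
    refine Spec.seq (T := 1) (T' := 1) (Spec.put (Spec.set ⟨?_, fun t ht => ?_⟩))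
    · simp [h1, h3]; ring
    · rcases Nat.lt_succ_iff_lt_or_eq.mp ht with hlt | rfl
      · simp [Function.update_of_ne hlt.ne, h2 t hlt]
      · simp [h1]
  · intro i hi
    rw [hf₂.2 .half (by decide), hf₂.2 .odd (by decide)]
    exact hs₁ i (by omega)
  · exact fun t ht => hs₂.2 t (by omega)

/-! ### Traversing the tree -/

/-- The state of the traversal of a tree with adjacency lists `nbr`: the discovered nodes are
`ord 1, …, ord (cnt - 1)`, they are marked by `vis`, and each but the first is a neighbour of
`ord (pp j)`, where `pp j ≤ b`. -/
structure Discovered (nbr : ℕ → List ℕ) (N : ℕ) (ord pp vis : ℕ → ℕ) (cnt b : ℕ) : Prop where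
  ord_one : ord 1 = 0
  pp_one : pp 1 = 0
  lt : ∀ j, 1 ≤ j → j < cnt → ord j < N ∧ vis (ord j) ≠ 0
  inj : ∀ j j', 1 ≤ j → j < cnt → 1 ≤ j' → j' < cnt → ord j = ord j' → j = j'
  vis : ∀ x, vis x ≠ 0 → ∃ j, 1 ≤ j ∧ j < cnt ∧ ord j = x
  par : ∀ j, 2 ≤ j → j < cnt → 1 ≤ pp j ∧ pp j < j ∧ pp j ≤ b ∧ ord j ∈ nbr (ord (pp j))

variable {nbr : ℕ → List ℕ} {ord pp vis : ℕ → ℕ} {cnt b : ℕ}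

theorem Discovered.extend (h : Discovered nbr N ord pp vis cnt b) (hb : 1 ≤ b) (hbc : b < cnt)
    {x : ℕ} (hx : x ∈ nbr (ord b)) (hxN : x < N) (hvx : vis x = 0) :
    Discovered nbr N (Function.update ord cnt x) (Function.update pp cnt b)
      (Function.update vis x 1) (cnt + 1) b where
  ord_one := by
    by_cases hc : 1 = cnt
    · omega
    · rw [Function.update_of_ne hc, h.ord_one]
  pp_one := by
    by_cases hc : 1 = cnt
    · omega
    · rw [Function.update_of_ne hc, h.pp_one]
  lt j h1 h2 := by
    rcases Nat.lt_succ_iff_lt_or_eq.mp h2 with h3 | rfl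
    · rw [Function.update_of_ne h3.ne]
      have := h.lt j h1 h3
      rw [Function.update_of_ne (by rintro h4; exact this.2 (h4 ▸ hvx))]
      exact this
    · simp [hxN]
  inj j j' h1 h2 h3 h4 h5 := by
    have hne : ∀ i, 1 ≤ i → i < cnt → ord i ≠ x := fun i hi hi' h =>
      (by have := (‹Discovered nbr N ord pp vis cnt b›.lt i hi hi').2; rw [h] at this; exact this hvx)
    rcases Nat.lt_succ_iff_lt_or_eq.mp h2 with h6 | rfl <;>
      rcases Nat.lt_succ_iff_lt_or_eq.mp h4 with h7 | rfl
    · rw [Function.update_of_ne h6.ne, Function.update_of_ne h7.ne] at h5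
      exact h.inj j j' h1 h6 h3 h7 h5
    · rw [Function.update_of_ne h6.ne, Function.update_self] at h5
      exact (hne j h1 h6 h5).elim
    · rw [Function.update_of_ne h7.ne, Function.update_self] at h5
      exact (hne j' h3 h7 h5.symm).elim
    · rfl
  vis y hy := by
    by_cases hyx : y = x
    · exact ⟨cnt, by omega, by omega, by simp [hyx]⟩
    · rw [Function.update_of_ne hyx] at hy
      obtain ⟨j, h1, h2, h3⟩ := h.vis y hy
      exact ⟨j, h1, by omega, by rw [Function.update_of_ne h2.ne, h3]⟩
  par j h1 h2 := by
    rcases Nat.lt_succ_iff_lt_or_eq.mp h2 with h3 | rfl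
    · obtain ⟨k1, k2, k3, k4⟩ := h.par j h1 h3
      rw [Function.update_of_ne h3.ne, Function.update_of_ne h3.ne,
        Function.update_of_ne (by omega)]
      exact ⟨k1, k2, k3, k4⟩
    · rw [Function.update_self, Function.update_self, Function.update_of_ne hbc.ne]
      exact ⟨hb, hbc, le_rfl, hx⟩

theorem Discovered.mono {b' : ℕ} (h : Discovered nbr N ord pp vis cnt b) (hb : b ≤ b') :
    Discovered nbr N ord pp vis cnt b' :=
  ⟨h.ord_one, h.pp_one, h.lt, h.inj, h.vis, fun j h1 h2 => by
    obtain ⟨k1, k2, k3, k4⟩ := h.par j h1 h2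
    exact ⟨k1, k2, k3.trans hb, k4⟩⟩

theorem Discovered.sum_le (h : Discovered nbr N ord pp vis cnt b) (f : ℕ → ℕ) {i : ℕ}
    (hi : i < cnt) : ∑ j ∈ Finset.Ioc 0 i, f (ord j) ≤ ∑ t ∈ Finset.range N, f t := by
  rw [← Finset.sum_image (f := f) (g := ord)]
  · refine Finset.sum_le_sum_of_subset fun t ht => ?_
    obtain ⟨j, hj, rfl⟩ := Finset.mem_image.mp ht
    rw [Finset.mem_Ioc] at hj
    exact Finset.mem_range.mpr (h.lt j hj.1 (by omega)).1
  · intro j hj j' hj' heq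
    simp only [Finset.coe_Ioc, Set.mem_Ioc] at hj hj'
    exact h.inj j j' hj.1 (by omega) hj'.1 (by omega) heq

/-- There are never more than `N` discovered nodes. -/
theorem Discovered.le (h : Discovered nbr N ord pp vis cnt b) : cnt ≤ N + 1 := by
  rcases Nat.eq_zero_or_pos cnt with h0 | h0
  · omega
  · have := h.sum_le (fun _ => 1) (i := cnt - 1) (by omega)
    simp at this
    omega

/-- If all neighbours of discovered nodes are discovered, then the traversal is complete. -/
theorem Discovered.complete (h : Discovered nbr N ord pp vis cnt b) (h2 : 2 ≤ cnt)
    (hconn : ∀ S : ℕ → Prop, S 0 → (∀ t < N, S t → ∀ x ∈ nbr t, S x) → ∀ t < N, S t)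
    (hcl : ∀ j, 1 ≤ j → j < cnt → ∀ x ∈ nbr (ord j), vis x ≠ 0) : N < cnt := by
  have hall := hconn (fun x => vis x ≠ 0) (by have := (h.lt 1 le_rfl (by omega)).2; rwa [h.ord_one] at this)
    fun t ht hvt x hx => by
      obtain ⟨j, h3, h4, rfl⟩ := h.vis t hvt
      exact hcl j h3 h4 x hx
  have hsub : Finset.range N ⊆ (Finset.Ioc 0 (cnt - 1)).image ord := by
    intro t ht
    obtain ⟨j, h3, h4, rfl⟩ := h.vis t (hall t (Finset.mem_range.mp ht))
    exact Finset.mem_image_of_mem _ (Finset.mem_Ioc.mpr ⟨h3, by omega⟩)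
  have := (Finset.card_le_card hsub).trans Finset.card_image_le
  simp at this
  omega

/-- `low v` is the largest number `j ≤ i` such that `v` is in the bag of the node `ord j`. -/
def IsLow (bags : ℕ → List ℕ) (ord low : ℕ → ℕ) (i : ℕ) : Prop :=
  ∀ v j, 1 ≤ j → j ≤ i → v ∈ bags (ord j) →
    j ≤ low v ∧ low v ≤ i ∧ v ∈ bags (ord (low v))

/-- The store after `i` rounds of the traversal. -/
structure Traversed (n N : ℕ) (ls : ℕ → List ℕ) (i : ℕ) (s : Store Var Arr) : Prop where
  disc : Discovered (fun t => ls (n + n + N + t)) N (s.arr .order) (s.arr .pp) (s.arr .vis)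
    (s.var .cnt) i
  cnt_gt : 2 ≤ s.var .cnt ∧ i < s.var .cnt
  closed : ∀ j, 1 ≤ j → j ≤ i → ∀ x ∈ ls (n + n + N + s.arr .order j), s.arr .vis x ≠ 0
  bp : ∀ j, 1 ≤ j → j ≤ i → s.arr .bp j = start ls (n + n + s.arr .order j)
  low : IsLow (fun t => ls (n + n + t)) (s.arr .order) (s.arr .low) i

theorem discover_spec : Spec w discover s 4 fun s' =>
    s'.arr .vis = Function.update (s.arr .vis) (s.var .y) 1 ∧
    s'.arr .order = Function.update (s.arr .order) (s.var .cnt) (s.var .y) ∧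
    s'.arr .pp = Function.update (s.arr .pp) (s.var .cnt) (s.var .u) ∧
    s'.var .cnt = s.var .cnt + 1 :=
  Spec.seq (T := 1) (T' := 3) (Spec.put (Spec.seq (T := 1) (T' := 2) (Spec.put (Spec.seq (T := 1)
    (T' := 1) (Spec.put (Spec.set (by simp)))))))

theorem visit_spec (hw : Encodes w n k N ls) (hs : Scanned n k N ls s)
    (hnbr : ∀ t < N, ∀ x ∈ ls (n + n + N + t), x < N)
    (hconn : ∀ S : ℕ → Prop, S 0 → (∀ t < N, S t → ∀ x ∈ ls (n + n + N + t), S x) → ∀ t < N, S t)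
    {i : ℕ} (hi : i < N) (hsi : s.var .i = i) (hT : Traversed n N ls i s) :
    Spec w visit s (7 + (ls (n + n + s.arr .order (i + 1))).length * 3 +
      (ls (n + n + N + s.arr .order (i + 1))).length * 7) fun s' =>
      Traversed n N ls (i + 1) s' ∧ s'.arr .bp 0 = s.arr .bp 0 ∧
      ∀ j < i + 2, s'.arr .order j = s.arr .order j := by
  obtain ⟨hD, hcnt, hcl, hbp, hlow⟩ := hT
  have hlt : i + 1 < s.var .cnt := by
    by_contra hge
    have := hD.complete hcnt.1 hconn fun j h1 h2 => hcl j h1 (by omega)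
    omega
  set t := s.arr .order (i + 1) with ht
  have htN : t < N := (hD.lt _ (by omega) hlt).1
  have hl1 : ListAt w (s.arr .ptr (n + n + t)) (ls (n + n + t)) := by
    rw [hs.ptr _ (by omega)]; exact hw.list _ (by omega)
  have hl2 : ListAt w (s.arr .ptr (n + n + N + t)) (ls (n + n + N + t)) := by
    rw [hs.ptr _ (by omega)]; exact hw.list _ (by omega)
  refine (Spec.seq (T := 1) (Spec.set (Spec.seq (T := 1) (Spec.set (Spec.seq (T := 1) (Spec.set
    (Spec.seq (T := 1) (Spec.put (Spec.seq (Spec.mono (Spec.forEach (T := 1) (q := s.arr .ptr (n + n + t))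
      (fun l₁ s' => ∀ v, s'.arr .low v = if v ∈ l₁ then i + 1 else s.arr .low v) hl1 ?_ ?_ ?_)
      le_rfl fun s₁ hf₁ hs₁ => Spec.seq (T := 1) (Spec.set (Spec.mono (Spec.forEach (T := 5)
      (q := s.arr .ptr (n + n + N + t))
      (fun l₁ s' => Discovered (fun t => ls (n + n + N + t)) N (s'.arr .order) (s'.arr .pp)
          (s'.arr .vis) (s'.var .cnt) (i + 1) ∧ i + 1 < s'.var .cnt ∧
        (∀ x, s.arr .vis x ≠ 0 → s'.arr .vis x ≠ 0) ∧
        (∀ x ∈ l₁, s'.arr .vis x ≠ 0) ∧ ∀ j < i + 2, s'.arr .order j = s.arr .order j)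
      hl2 ?_ ?_ ?_) le_rfl fun s₂ hf₂ hs₂ => ?_)))))))))))).mono' (by omega)
  · intro s' hf
    rw [Expr.eval, hf.1 _ (by decide)]
    simp [hs.n_eq, hsi, ← ht]
  · simp
  · intro l₁ v l₂ hl s' hf hs' 
    refine Spec.put fun x => ?_
    have h1 : s'.var .u = i + 1 := by rw [hf.1 _ (by decide)]; simp [hsi]
    simp only [arr_put, Expr.eval, var_set, arr_set, if_true, reduceCtorEq, if_false,
      Function.update_apply, h1, hs' x, List.mem_append, List.mem_singleton]
    by_cases hxv : x = v
    · simp [hxv]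
    · simp [hxv]
  all_goals
    have n1 : s₁.var .n = n := by rw [hf₁.1 _ (by decide)]; simp [hs.n_eq]
    have N1 : s₁.var .N = N := by rw [hf₁.1 _ (by decide)]; simp [hs.N_eq]
    have v1 : s₁.var .v = t := by rw [hf₁.1 _ (by decide)]; simp [hsi, ht]
    have u1 : s₁.var .u = i + 1 := by rw [hf₁.1 _ (by decide)]; simp [hsi]
    have c1 : s₁.var .cnt = s.var .cnt := by rw [hf₁.1 _ (by decide)]; simp
    have ptr1 : s₁.arr .ptr = s.arr .ptr := by rw [hf₁.2 _ (by decide)]; simp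
    have ord1 : s₁.arr .order = s.arr .order := by rw [hf₁.2 _ (by decide)]; simp
    have pp1 : s₁.arr .pp = s.arr .pp := by rw [hf₁.2 _ (by decide)]; simp
    have vis1 : s₁.arr .vis = s.arr .vis := by rw [hf₁.2 _ (by decide)]; simp
  · intro s' hf
    rw [Expr.eval, hf.1 _ (by decide)]
    simp [n1, N1, v1, ptr1]
  · simp only [arr_set, var_set, reduceCtorEq, if_false, ord1, pp1, vis1, c1]
    exact ⟨hD.mono (by omega), hlt, fun _ h => h, by simp, fun _ _ => trivial⟩
  · intro l₁ x l₂ hl s' hf ⟨h1, h2, h3, h4, h5⟩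
    have u2 : s'.var .u = i + 1 := by
      rw [hf.1 _ (by decide), var_set, if_neg (by decide), u1]
    refine (Spec.ite (T := 4) (fun hlt => discover_spec.mono le_rfl fun s'' _ hs'' => ?_)
      fun hge => (Spec.skip ?_).mono' (by omega))
    · simp only [arr_set, var_set, reduceCtorEq, if_true, if_false, u2, Expr.eval] at hs'' hlt
      obtain ⟨k1, k2, k3, k4⟩ := hs''
      rw [k1, k2, k3, k4]
      refine ⟨h1.extend (by omega) h2 ?_ (hnbr t htN x (by simp [hl])) (by omega), by omega,
        fun y hy => ?_, fun y hy => ?_, fun j hj => ?_⟩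
      · rw [h5 _ (by omega), ← ht]; simp [hl]
      · rw [Function.update_apply]; split_ifs
        · exact one_ne_zero
        · exact h3 y hy
      · rw [Function.update_apply]; split_ifs with hyx
        · exact one_ne_zero
        · exact h4 y (by simpa [hyx] using hy)
      · rw [Function.update_of_ne (by omega), h5 j hj]
    · simp only [arr_set, var_set, reduceCtorEq, if_true, if_false, Expr.eval] at hge ⊢
      refine ⟨h1, h2, h3, fun y hy => ?_, h5⟩
      rcases List.mem_append.mp hy with hy | hy
      · exact h4 y hy
      · obtain rfl : y = x := by simpa using hy
        omega
  · obtain ⟨h1, h2, h3, h4, h5⟩ := hs₂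
    have bp2 : s₂.arr .bp = Function.update (s.arr .bp) (i + 1) (start ls (n + n + t)) := by
      rw [hf₂.2 _ (by decide), arr_set, hf₁.2 _ (by decide)]
      simp [hsi, hs.n_eq, ← ht, hs.ptr _ (by omega : n + n + t < n + n + N + N)]
    have low2 : s₂.arr .low = s₁.arr .low := by rw [hf₂.2 _ (by decide), arr_set]
    refine ⟨⟨h1, ⟨by omega, h2⟩, fun j hj hji x hx => ?_, fun j hj hji => ?_, ?_⟩, ?_, h5⟩
    · rw [h5 j (by omega)] at hx
      rcases Nat.le_succ_iff.mp hji with h | rfl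
      · exact h3 x (hcl j hj h x hx)
      · exact h4 x hx
    · rw [bp2, h5 j (by omega)]
      rcases Nat.le_succ_iff.mp hji with h | rfl
      · rw [Function.update_of_ne (by omega), hbp j hj h]
      · rw [Function.update_self]
    · intro v j hj hji hv
      rw [h5 j (by omega)] at hv
      rw [low2, hs₁ v]
      split_ifs with hvt
      · rw [h5 _ (by omega)]
        exact ⟨hji, le_rfl, hvt⟩
      · have hji' : j ≤ i := by
          rcases Nat.le_succ_iff.mp hji with h | rfl
          · exact h
          · exact (hvt hv).elim
        obtain ⟨k1, k2, k3⟩ := hlow v j hj hji' hv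
        rw [h5 _ (by omega)]
        exact ⟨k1, by omega, k3⟩
    · rw [bp2, Function.update_of_ne (by omega)]

theorem traverse_spec (hw : Encodes w n k N ls) (hs : Scanned n k N ls s) (hN : 1 ≤ N)
    (hvis : ∀ x, s.arr .vis x = 0)
    (hnbr : ∀ t < N, ∀ x ∈ ls (n + n + N + t), x < N)
    (hconn : ∀ S : ℕ → Prop, S 0 → (∀ t < N, S t → ∀ x ∈ ls (n + n + N + t), S x) → ∀ t < N, S t) :
    Spec w traverse s (5 + (N * (8 + bagSize n N ls * 3) +
      (∑ t ∈ Finset.range N, (ls (n + n + N + t)).length) * 7)) fun s' =>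
      Traversed n N ls N s' ∧ s'.arr .bp 0 = s.arr .bp 0 := by
  have hbag : ∀ t < N, (ls (n + n + t)).length ≤ bagSize n N ls := fun t ht =>
    Finset.le_sup (f := fun t => (ls (n + n + t)).length) (Finset.mem_range.mpr ht)
  refine (Spec.seq (T := 1) (Spec.put (Spec.seq (T := 1) (Spec.put (Spec.seq (T := 1) (Spec.put
    (Spec.seq (T := 1) (Spec.set (Spec.mono (Spec.loop_amortized (m := N)
      (fun i c s' => Traversed n N ls i s' ∧ s'.arr .bp 0 = s.arr .bp 0 ∧
        c ≤ ∑ j ∈ Finset.Ioc 0 i, (8 + bagSize n N ls * 3 +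
          (ls (n + n + N + s'.arr .order j)).length * 7)) ?_ ?_ ?_ ?_) le_rfl
          fun s' hf' hs' => ?_))))))))).mono' (by omega : _ + (_ + (_ + (_ + (1 +
          (N * (8 + bagSize n N ls * 3) +
      (∑ t ∈ Finset.range N, (ls (n + n + N + t)).length) * 7))))) ≤ _)
  · simp [hs.N_eq]
  · refine ⟨⟨⟨?_, ?_, ?_, ?_, ?_, ?_⟩, ?_, ?_, ?_, ?_⟩, ?_, ?_⟩
    · simp
    · simp
    · intro j h1 h2
      obtain rfl : j = 1 := by simp at h2; omega
      simp; omega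
    · intro j j' h1 h2 h3 h4 _
      simp at h2 h4; omega
    · intro x hx
      refine ⟨1, le_rfl, by simp, ?_⟩
      by_contra hne
      simp at hne
      simp [Function.update_of_ne (Ne.symm hne), hvis] at hx
    · intro j h1 h2
      simp at h2; omega
    · simp
    · intro j h1 h2; omega
    · intro j h1 h2; omega
    · intro v j h1 h2; omega
    · simp
    · simp
  · rintro i hi c s' hf ⟨h1, h2, h3⟩
    have hf' : Frame [.cnt, .i, .u, .v, .q, .x, .y] [.order, .pp, .vis, .low, .bp] s s' :=
      ((((((Frame.refl _ _ s).put Arr.order _ _).put Arr.pp _ _).put Arr.vis _ _).set Var.cnt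
        _).trans (hf.mono (by decide) (by decide)))
    have hS : Scanned n k N ls (s'.set .i i) :=
      ⟨by simp [hf'.1 .n (by decide), hs.n_eq], by simp [hf'.1 .k (by decide), hs.k_eq],
        by simp [hf'.1 .N (by decide), hs.N_eq], by simp [hf'.1 .inf (by decide), hs.inf_eq],
        by simp only [arr_set]; rw [hf'.2 _ (by decide)]; exact hs.ptr,
        by simp [h2, hs.bp]⟩
    have hT : Traversed n N ls i (s'.set .i i) :=
      ⟨by simpa using h1.disc, by simpa using h1.cnt_gt, h1.closed, h1.bp, h1.low⟩
    refine ⟨_, (visit_spec hw hS hnbr hconn hi (by simp) hT).mono le_rfl ?_⟩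
    rintro s'' hf'' ⟨k1, k2, k3⟩ T' hT'
    refine ⟨k1, k2.trans h2, ?_⟩
    rw [Finset.sum_Ioc_succ_top (Nat.zero_le i), k3 _ (by omega)]
    have h4 : ∑ j ∈ Finset.Ioc 0 i, (8 + bagSize n N ls * 3 +
        (ls (n + n + N + s''.arr .order j)).length * 7) =
        ∑ j ∈ Finset.Ioc 0 i, (8 + bagSize n N ls * 3 +
          (ls (n + n + N + s'.arr .order j)).length * 7) := by
      refine Finset.sum_congr rfl fun j hj => ?_
      rw [k3 j (by have := (Finset.mem_Ioc.mp hj).2; omega)]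
      rfl
    rw [h4]
    have h5 := k1.disc.lt (i + 1) (by omega) k1.cnt_gt.2
    rw [k3 _ (by omega)] at h5
    have h6 := hbag _ h5.1
    omega
  · rintro c s' ⟨h1, -, h3⟩
    have h4 := h1.disc.sum_le (fun t => (ls (n + n + N + t)).length) h1.cnt_gt.2
    rw [Finset.sum_add_distrib, ← Finset.sum_mul] at h3
    simp only [Finset.sum_const, Nat.card_Ioc, smul_eq_mul, Nat.sub_zero] at h3
    have := Nat.mul_le_mul_right 7 h4
    omega
  · obtain ⟨c, h1, h2, -⟩ := hs'
    exact ⟨h1, h2⟩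

/-! ### From the traversal to a layout -/

/-- The lists describe a signed graph on `n` vertices and a domino tree decomposition with the
tree `T`. -/
structure IsInstance (n N : ℕ) (ls : ℕ → List ℕ) (T : SimpleGraph (Fin N)) : Prop where
  isTree : T.IsTree
  nbr_lt : ∀ t < N, ∀ x ∈ ls (n + n + N + t), x < N
  adj_iff : ∀ t x : Fin N, x.val ∈ ls (n + n + N + t) ↔ T.Adj t x
  nbr_nodup : ∀ t < N, (ls (n + n + N + t)).Nodup
  bag_lt : ∀ t < N, ∀ v ∈ ls (n + n + t), v < n
  bag_nodup : ∀ t < N, (ls (n + n + t)).Nodup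
  cover : ∀ v < n, ∃ t < N, v ∈ ls (n + n + t)
  domino : ∀ t t' v, t < N → t' < N → t ≠ t' → v ∈ ls (n + n + t) → v ∈ ls (n + n + t') →
    t' ∈ ls (n + n + N + t)
  edge : ∀ v < n, ∀ y, y ∈ ls (v + v) ∨ y ∈ ls (v + v + 1) →
    ∃ t < N, v ∈ ls (n + n + t) ∧ y ∈ ls (n + n + t)
  pos_nodup : ∀ v < n, (ls (v + v)).Nodup
  neg_nodup : ∀ v < n, (ls (v + v + 1)).Nodup

variable {T : SimpleGraph (Fin N)}

theorem IsInstance.one_le (h : IsInstance n N ls T) : 1 ≤ N := by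
  obtain ⟨t⟩ := h.isTree.connected.nonempty
  have := t.2
  omega

theorem IsInstance.connected (h : IsInstance n N ls T) (S : ℕ → Prop) (h0 : S 0)
    (hS : ∀ t < N, S t → ∀ x ∈ ls (n + n + N + t), S x) : ∀ t < N, S t := by
  have key : ∀ t x : Fin N, T.Walk t x → S t → S x := by
    intro t x p
    induction p with
    | nil => exact id
    | cons hadj _ ih => exact fun ht => ih (hS _ (Fin.is_lt _) ht _ ((h.adj_iff _ _).mpr hadj))
  intro t ht
  obtain ⟨p⟩ := h.isTree.connected.preconnected ⟨0, h.one_le⟩ ⟨t, ht⟩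
  exact key _ _ p h0

/-- The number of entries of the adjacency lists of the tree. -/
theorem IsInstance.sum_length (h : IsInstance n N ls T) :
    ∑ t ∈ Finset.range N, (ls (n + n + N + t)).length ≤ 2 * N := by
  classical
  have h1 : ∀ t : Fin N, (ls (n + n + N + t)).length = T.degree t := by
    intro t
    rw [← List.toFinset_card_of_nodup (h.nbr_nodup t t.2), ← SimpleGraph.card_neighborFinset_eq_degree,
      ← Finset.card_map Fin.valEmbedding]
    congr 1
    ext x
    simp only [List.mem_toFinset, Finset.mem_map, SimpleGraph.mem_neighborFinset,
      Fin.valEmbedding_apply]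
    constructor
    · intro hx
      exact ⟨⟨x, h.nbr_lt t t.2 x hx⟩, (h.adj_iff t ⟨x, _⟩).mp hx, rfl⟩
    · rintro ⟨y, hy, rfl⟩
      exact (h.adj_iff t y).mpr hy
  rw [← Fin.sum_univ_eq_sum_range (fun t => (ls (n + n + N + t)).length),
    Finset.sum_congr rfl fun t _ => h1 t, SimpleGraph.sum_degrees_eq_twice_card_edges]
  have := h.isTree.card_edgeFinset
  simp only [Fintype.card_fin] at this
  omega

/-- Every edge of the tree joins a node and its parent in the traversal, as there are only `N - 1`
edges. -/
theorem IsInstance.parent_eq (h : IsInstance n N ls T) {ord pp vis : ℕ → ℕ} {b : ℕ}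
    (hD : Discovered (fun t => ls (n + n + N + t)) N ord pp vis (N + 1) b) {i j : ℕ} (hi : 1 ≤ i)
    (hij : i < j) (hj : j ≤ N) (hadj : ord j ∈ ls (n + n + N + ord i)) : i = pp j := by
  classical
  have hlt : ∀ j, 1 ≤ j → j ≤ N → ord j < N := fun j h1 h2 => (hD.lt j h1 (by omega)).1
  -- the node number `j`, with a junk value outside the range
  let f : ℕ → Fin N := fun j => if hj : ord j < N then ⟨ord j, hj⟩ else ⟨0, h.one_le⟩
  have hf : ∀ j, 1 ≤ j → j ≤ N → (f j).val = ord j := by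
    intro j h1 h2
    simp [f, hlt j h1 h2]
  have hfinj : ∀ j j', 1 ≤ j → j ≤ N → 1 ≤ j' → j' ≤ N → f j = f j' → j = j' := by
    intro j j' h1 h2 h3 h4 h5
    refine hD.inj j j' h1 (by omega) h3 (by omega) ?_
    rw [← hf j h1 h2, ← hf j' h3 h4, h5]
  have hpar : ∀ j, 2 ≤ j → j ≤ N → 1 ≤ pp j ∧ pp j < j ∧ T.Adj (f (pp j)) (f j) := by
    intro j h1 h2
    obtain ⟨h3, h4, -, h5⟩ := hD.par j h1 (by omega)
    refine ⟨h3, h4, (h.adj_iff _ _).mp ?_⟩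
    rw [hf j (by omega) h2, hf _ h3 (by omega)]
    exact h5
  have himg : (Finset.Icc 2 N).image (fun j => s(f (pp j), f j)) = T.edgeFinset := by
    refine Finset.eq_of_subset_of_card_le (fun e he => ?_) ?_
    · obtain ⟨j, hj, rfl⟩ := Finset.mem_image.mp he
      rw [Finset.mem_Icc] at hj
      exact SimpleGraph.mem_edgeFinset.mpr (hpar j hj.1 hj.2).2.2
    · rw [Finset.card_image_of_injOn]
      · have := h.isTree.card_edgeFinset
        simp only [Fintype.card_fin] at this
        simp only [Nat.card_Icc]
        omega
      · intro j hj j' hj' heq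
        simp only [Finset.coe_Icc, Set.mem_Icc] at hj hj'
        obtain ⟨h1, h2, -⟩ := hpar j hj.1 hj.2
        obtain ⟨h3, h4, -⟩ := hpar j' hj'.1 hj'.2
        rcases Sym2.eq_iff.mp heq with ⟨-, h5⟩ | ⟨h5, h6⟩
        · exact hfinj j j' (by omega) hj.2 (by omega) hj'.2 h5
        · have h7 := hfinj _ _ h1 (by omega) (by omega) hj'.2 h5
          have h8 := hfinj _ _ (by omega) hj.2 h3 (by omega) h6
          omega
  have hmem : s(f i, f j) ∈ T.edgeFinset := by
    refine SimpleGraph.mem_edgeFinset.mpr ((h.adj_iff _ _).mp ?_)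
    rw [hf i hi (by omega), hf j (by omega) hj]
    exact hadj
  rw [← himg] at hmem
  obtain ⟨j', hj', heq⟩ := Finset.mem_image.mp hmem
  rw [Finset.mem_Icc] at hj'
  obtain ⟨h1, h2, -⟩ := hpar j' hj'.1 hj'.2
  rcases Sym2.eq_iff.mp heq with ⟨h5, h6⟩ | ⟨h5, h6⟩
  · have h7 := hfinj _ _ h1 (by omega) hi (by omega) h5
    have h8 := hfinj _ _ (by omega) hj'.2 (by omega) hj h6
    rw [← h7, h8]
  · have h7 := hfinj _ _ h1 (by omega) (by omega) hj h5
    have h8 := hfinj _ _ (by omega) hj'.2 hi (by omega) h6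
    omega

/-- The layout given by an instance and a traversal of its tree. -/
def layoutOf (n N : ℕ) (ls : ℕ → List ℕ) (s : Store Var Arr) : Layout where
  n := n
  N := N
  bag j := if 1 ≤ j ∧ j ≤ N then ls (n + n + s.arr .order j) else []
  pos v := ls (v + v)
  neg v := ls (v + v + 1)
  par := s.arr .pp
  low := s.arr .low

theorem IsInstance.valid (h : IsInstance n N ls T) (hT : Traversed n N ls N s) :
    (layoutOf n N ls s).Valid := by
  have hD := hT.disc
  have hcnt : s.var .cnt = N + 1 := le_antisymm hD.le hT.cnt_gt.2
  rw [hcnt] at hD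
  have hlt : ∀ j, 1 ≤ j → j ≤ N → s.arr .order j < N := fun j h1 h2 => (hD.lt j h1 (by omega)).1
  have hsurj : ∀ t < N, ∃ j, 1 ≤ j ∧ j ≤ N ∧ s.arr .order j = t := by
    have himg : (Finset.Ioc 0 N).image (s.arr .order) = Finset.range N := by
      refine Finset.eq_of_subset_of_card_le (fun t ht => ?_) ?_
      · obtain ⟨j, hj, rfl⟩ := Finset.mem_image.mp ht
        rw [Finset.mem_Ioc] at hj
        exact Finset.mem_range.mpr (hlt j hj.1 hj.2)
      · rw [Finset.card_image_of_injOn]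
        · simp
        · intro j hj j' hj' heq
          simp only [Finset.coe_Ioc, Set.mem_Ioc] at hj hj'
          exact hD.inj j j' hj.1 (by omega) hj'.1 (by omega) heq
    intro t ht
    rw [← Finset.mem_range, ← himg] at ht
    obtain ⟨j, hj, rfl⟩ := Finset.mem_image.mp ht
    rw [Finset.mem_Ioc] at hj
    exact ⟨j, hj.1, hj.2, rfl⟩
  have hbag : ∀ {j v}, v ∈ (layoutOf n N ls s).bag j →
      1 ≤ j ∧ j ≤ N ∧ v ∈ ls (n + n + s.arr .order j) := by
    intro j v hv
    simp only [layoutOf] at hv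
    split_ifs at hv with hj
    · exact ⟨hj.1, hj.2, hv⟩
    · simp at hv
  have hbag' : ∀ {j v}, 1 ≤ j → j ≤ N → v ∈ ls (n + n + s.arr .order j) →
      v ∈ (layoutOf n N ls s).bag j := by
    intro j v h1 h2 hv
    simpa only [layoutOf, h1, h2, and_self, if_true] using hv
  have hdom : ∀ i j v, i < j → v ∈ (layoutOf n N ls s).bag i →
      v ∈ (layoutOf n N ls s).bag j → i = s.arr .pp j := by
    intro i j v hij hi hj
    obtain ⟨h1, h2, h3⟩ := hbag hi
    obtain ⟨h4, h5, h6⟩ := hbag hj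
    refine h.parent_eq hD h1 hij h5 (h.domino _ _ v (hlt i h1 h2) (hlt j h4 h5) (fun heq => ?_) h3 h6)
    have := hD.inj i j h1 (by omega) h4 (by omega) heq
    omega
  have hlow : ∀ {j v}, v ∈ (layoutOf n N ls s).bag j → j ≤ s.arr .low v ∧ s.arr .low v ≤ N ∧
      v ∈ (layoutOf n N ls s).bag (s.arr .low v) := by
    intro j v hv
    obtain ⟨h1, h2, h3⟩ := hbag hv
    obtain ⟨h4, h5, h6⟩ := hT.low v j h1 h2 h3
    exact ⟨h4, h5, hbag' (by omega) h5 h6⟩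
  constructor
  · simp [layoutOf]
  · intro u h1 h2
    rcases Nat.lt_or_ge u 2 with h3 | h3
    · obtain rfl : u = 1 := by omega
      have := hD.pp_one
      simp only [layoutOf]
      omega
    · exact (hD.par u h3 (Nat.lt_succ_of_le h2)).2.1
  · exact fun i j v hij _ hi hj => hdom i j v hij hi hj
  · intro u _ v hv
    obtain ⟨h1, h2, h3⟩ := hbag hv
    exact h.bag_lt _ (hlt u h1 h2) v h3
  · intro u _
    simp only [layoutOf]
    split_ifs with hu
    · exact h.bag_nodup _ (hlt u hu.1 hu.2)
    · exact List.nodup_nil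
  · intro v hv
    obtain ⟨t, ht, hvt⟩ := h.cover v hv
    obtain ⟨j, h1, h2, rfl⟩ := hsurj t ht
    exact (hlow (hbag' h1 h2 hvt)).2
  · exact fun u _ v hv => (hlow hv).1
  · intro v hv y hy
    obtain ⟨t, ht, hvt, hyt⟩ := h.edge v hv y hy
    obtain ⟨j, h1, h2, rfl⟩ := hsurj t ht
    obtain ⟨h3, h4, h5⟩ := hlow (hbag' h1 h2 hvt)
    rcases h3.lt_or_eq with h6 | h6
    · have h7 := hdom _ _ v h6 (hbag' h1 h2 hvt) h5
      right
      simp only [layoutOf] at h7 ⊢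
      rw [← h7]
      exact hbag' h1 h2 hyt
    · left
      have : (layoutOf n N ls s).low v = j := h6.symm
      rw [this]
      exact hbag' h1 h2 hyt

theorem IsInstance.sized (h : IsInstance n N ls T) (hT : Traversed n N ls N s) :
    Sized (layoutOf n N ls s) (2 ^ bagSize n N ls) (bagSize n N ls) := by
  have hV := h.valid hT
  have hbag : ∀ u, ((layoutOf n N ls s).bag u).length ≤ bagSize n N ls := by
    intro u
    simp only [layoutOf]
    split_ifs with hu
    · exact Finset.le_sup (f := fun t => (ls (n + n + t)).length)
        (Finset.mem_range.mpr (hT.disc.lt u hu.1 (hu.2.trans_lt hT.cnt_gt.2)).1)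
    · simp
  have hdeg : ∀ v < n, ∀ l : List ℕ, l.Nodup → (∀ y ∈ l, y ∈ ls (v + v) ∨ y ∈ ls (v + v + 1)) →
      l.length ≤ 2 * bagSize n N ls := by
    intro v hv l hl hsub
    have h1 : l ⊆ (layoutOf n N ls s).bag ((layoutOf n N ls s).low v) ++
        (layoutOf n N ls s).bag ((layoutOf n N ls s).par ((layoutOf n N ls s).low v)) :=
      fun y hy => List.mem_append.mpr (hV.nbr v hv y (hsub y hy))
    have h2 := (List.subperm_of_subset hl h1).length_le
    rw [List.length_append] at h2
    have h3 := hbag ((layoutOf n N ls s).low v)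
    have h4 := hbag ((layoutOf n N ls s).par ((layoutOf n N ls s).low v))
    omega
  exact ⟨hV, fun u _ => hbag u, fun v hv => hdeg v hv _ (h.pos_nodup v hv) fun y hy => Or.inl hy,
    fun v hv => hdeg v hv _ (h.neg_nodup v hv) fun y hy => Or.inr hy, rfl⟩

theorem answer_spec : Spec w answer s 4 fun s' => s'.var .ans = s.var .ans ∧
    s'.var .res = if s.var .ans < s.var .inf ∧ s.var .ans < s.var .k + 1 then 1 else 0 := by
  refine Spec.seq (T := 1) (T' := 3) (Spec.set (Spec.ite (T := 2) (fun h1 => Spec.ite (T := 1)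
    (fun h2 => Spec.set ?_) (fun h2 => Spec.skip ?_)) (fun h1 => (Spec.skip ?_).mono' (by omega))))
  all_goals simp only [Expr.eval, var_set, reduceCtorEq, if_true, if_false] at *
  · rw [if_pos ⟨h1, h2⟩]; exact ⟨trivial, rfl⟩
  · rw [if_neg fun h => h2 h.2]; exact ⟨trivial, rfl⟩
  · rw [if_neg fun h => h1 h.1]; exact ⟨trivial, rfl⟩

/-- A bound for the cost of the whole algorithm. -/
def mainCost (n N d : ℕ) : ℕ :=
  28 + 6 * n + 41 * N + 2 * d + 3 * (N * d) + 5 * 2 ^ d +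
    N * (2 ^ d * (1 + messageCost (2 ^ d) d))

theorem main_spec (hw : Encodes w n k N ls) (h : IsInstance n N ls T) :
    Spec w main ⟨fun _ => 0, fun _ _ => 0⟩ (mainCost n N (bagSize n N ls)) fun s' =>
      (∃ (L : Layout) (F : ℕ → ℕ → ℕ), L.n = n ∧ L.N = N ∧ L.pos = (fun v => ls (v + v)) ∧
        L.neg = (fun v => ls (v + v + 1)) ∧ L.Valid ∧ L.Inv F 0 (s'.var .ans) ∧
        ((∀ t < N, ls (n + n + t) ≠ []) → ∀ u, 1 ≤ u → u ≤ N → L.bag u ≠ [])) ∧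
      s'.var .res = if s'.var .ans < n + 1 ∧ s'.var .ans < k + 1 then 1 else 0 := by
  set s : Store Var Arr := ⟨fun _ => 0, fun _ _ => 0⟩ with hs
  set d := bagSize n N ls with hd
  refine (Spec.seq ((scan_spec hw).mono le_rfl fun s₁ hf₁ h₁ => Spec.seq ((width_spec hw h₁).mono
    le_rfl fun s₂ hf₂ h₂ => Spec.seq ((tables_spec (W := 2 ^ d)
    (h₁.frame hf₂).N_eq h₂.2).mono le_rfl fun s₃ hf₃ h₃ => Spec.seq ((traverse_spec hw
    ((h₁.frame hf₂).frame hf₃) h.one_le ?_ h.nbr_lt h.connected).mono le_rfl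
    fun s₄ hf₄ h₄ => Spec.seq ((solve_spec (h.sized h₄.1) ?_ ?_ ?_).mono
    (T' := 2 + N * (6 + 2 ^ d * (1 + messageCost (2 ^ d) d))) le_rfl
    fun s₅ hf₅ h₅ => answer_spec.mono le_rfl fun s₆ hf₆ h₆ => ?_)))))).mono' ?_
  · intro x
    rw [hf₃.2 _ (by decide), hf₂.2 _ (by decide), hf₁.2 _ (by decide)]
  · have hS₃ := (h₁.frame hf₂).frame hf₃
    have ptr4 : s₄.arr .ptr = s₃.arr .ptr := hf₄.2 _ (by decide)
    constructor
    · rw [hf₄.1 _ (by decide)]; exact hS₃.inf_eq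
    · rw [hf₄.1 _ (by decide)]; exact hS₃.N_eq
    · rw [hf₄.1 _ (by decide), hf₃.1 _ (by decide)]; exact h₂.2
    · rw [hf₄.2 _ (by decide)]; exact fun i hi => (h₃.1 i hi).1
    · rw [hf₄.2 _ (by decide)]; exact fun i hi => (h₃.1 i hi).2
    · rw [hf₄.2 _ (by decide)]; exact h₃.2
    · rfl
    · rfl
    · intro u hu
      rcases Nat.eq_zero_or_pos u with rfl | hu0
      · rw [h₄.2, hS₃.bp]
        exact ⟨by simpa [layoutOf] using hw.zero, fun j hj => by simp [layoutOf] at hj⟩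
      · have hu' : u ≤ N := hu
        rw [h₄.1.bp u hu0 hu]
        simp only [layoutOf, hu', and_true, if_pos (show 1 ≤ u from hu0)]
        exact hw.list _ (by
          have := (h₄.1.disc.lt u hu0 (hu'.trans_lt h₄.1.cnt_gt.2)).1
          omega)
    · intro v hv
      have hv' : v < n := hv
      rw [ptr4, hS₃.ptr _ (by omega)]
      exact hw.list _ (by omega)
    · intro v hv
      have hv' : v < n := hv
      rw [ptr4, hS₃.ptr _ (by omega)]
      exact hw.list _ (by omega)
  · intro x
    rw [hf₄.2 _ (by decide), hf₃.2 _ (by decide), hf₂.2 _ (by decide), hf₁.2 _ (by decide)]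
    simp [hs]
  · intro x
    rw [hf₄.2 _ (by decide), hf₃.2 _ (by decide), hf₂.2 _ (by decide), hf₁.2 _ (by decide)]
  · obtain ⟨F, hF⟩ := h₅
    have hk : s₅.var .k = k := by
      rw [hf₅.1 _ (by decide), hf₄.1 _ (by decide)]; exact ((h₁.frame hf₂).frame hf₃).k_eq
    have hinf : s₅.var .inf = n + 1 := by
      rw [hf₅.1 _ (by decide), hf₄.1 _ (by decide)]; exact ((h₁.frame hf₂).frame hf₃).inf_eq
    rw [h₆.2, h₆.1, hk, hinf]
    refine ⟨⟨_, F, rfl, rfl, rfl, rfl, h.valid h₄.1, hF, fun hne u h1 h2 => ?_⟩, rfl⟩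
    simp only [layoutOf, h1, h2, and_self, if_true]
    exact hne _ (h₄.1.disc.lt u h1 (h2.trans_lt h₄.1.cnt_gt.2)).1
  · have hE := h.sum_length
    simp only [mainCost, ← hd, Nat.mul_add, Nat.add_mul] at hE ⊢
    have h2 : N * (d * 3) = 3 * (N * d) := by ring
    rw [h2]
    omega

end

/-! ### From the input to its lists -/

/-- Lists, each preceded by its length, in one word. -/
def concat (ls : List (List ℕ)) : List ℕ := ls.flatMap fun l => l.length :: l

theorem start_eq (ls : List (List ℕ)) (i : ℕ) (hi : i ≤ ls.length) :
    start (fun i => ls.getD i []) i = 3 + (concat (ls.take i)).length := by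
  induction i with
  | zero => simp [start, concat]
  | succ i ih =>
    have hi' : i < ls.length := hi
    rw [start, ih (by omega), List.take_succ_eq_append_getElem hi']
    simp only [concat, List.flatMap_append, List.flatMap_cons, List.flatMap_nil,
      List.append_nil, List.length_append, List.length_cons,
      List.getD_eq_getElem _ _ hi']
    omega

theorem listAt_start (a b c : ℕ) (ls : List (List ℕ)) (i : ℕ) (hi : i < ls.length) :
    ListAt (fun j => ([a, b, c] ++ concat ls).getD j 0) (start (fun i => ls.getD i []) i)
      (ls.getD i []) := by
  have hsplit : [a, b, c] ++ concat ls = ([a, b, c] ++ concat (ls.take i)) ++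
      ((ls.getD i []).length :: (ls.getD i [] ++ concat (ls.drop (i + 1)))) := by
    have h : ls = ls.take i ++ ls[i] :: ls.drop (i + 1) := by simp
    conv_lhs => rw [h]
    rw [List.getD_eq_getElem _ _ hi]
    simp only [concat, List.flatMap_append, List.flatMap_cons, List.append_assoc, List.cons_append]
  have hlen : ([a, b, c] ++ concat (ls.take i)).length = start (fun i => ls.getD i []) i := by
    rw [start_eq ls i hi.le, List.length_append]; rfl
  rw [hsplit]
  constructor
  · simp only
    rw [List.getD_append_right _ _ _ _ hlen.le, hlen, Nat.sub_self]
    simp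
  · intro j hj
    simp only
    rw [List.getD_append_right _ _ _ _ (by omega), hlen, add_assoc, Nat.add_sub_cancel_left,
      Nat.add_comm 1 j, List.getD_cons_succ, List.getD_append _ _ _ _ hj,
      List.getD_eq_getElem _ _ hj]

variable {n N : ℕ} {G : SignedGraph (Fin n)} {D : TreeDecomposition G.underlying (Fin N)}

/-- The lists of the input, in the order of the input word. -/
def blocks (I : InputLists G D) : List (List ℕ) :=
  (List.finRange n).flatMap (fun v => [(I.posList v).map Fin.val, (I.negList v).map Fin.val])
    ++ ((List.finRange N).map (fun t => (I.bagList t).map Fin.val)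
    ++ (List.finRange N).map (fun t => (I.treeList t).map Fin.val))

theorem encode_eq (I : InputLists G D) (k : ℕ) : I.encode k = [n, k, N] ++ concat (blocks I) := by
  simp [InputLists.encode, concat, blocks, lengthPrefixed, List.flatMap_append, List.flatMap_map,
    List.flatMap_assoc]

theorem length_flatMap_pair {α β : Type*} (f g : α → β) (l : List α) :
    (l.flatMap fun v => [f v, g v]).length = l.length + l.length := by
  induction l with
  | nil => rfl
  | cons v l ih => simp only [List.flatMap_cons, List.length_append, ih, List.length_cons]; simp; omega

theorem getElem?_flatMap_pair {α β : Type*} (f g : α → β) (l : List α) (i : ℕ) :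
    (l.flatMap fun v => [f v, g v])[i + i]? = l[i]?.map f ∧
    (l.flatMap fun v => [f v, g v])[i + i + 1]? = l[i]?.map g := by
  induction l generalizing i with
  | nil => simp
  | cons v l ih =>
    cases i with
    | zero => simp
    | succ i =>
      have h : i + 1 + (i + 1) = i + i + 1 + 1 := by omega
      simpa [h] using ih i

theorem blocks_length (I : InputLists G D) : (blocks I).length = n + n + N + N := by
  simp only [blocks, List.length_append, length_flatMap_pair, List.length_map, List.length_finRange]
  omega

theorem blocks_pos (I : InputLists G D) (v : Fin n) :
    (blocks I).getD (v + v) [] = (I.posList v).map Fin.val := by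
  have h := (getElem?_flatMap_pair (fun v => (I.posList v).map Fin.val)
    (fun v => (I.negList v).map Fin.val) (List.finRange n) v).1
  rw [List.getD_eq_getElem?_getD, blocks, List.getElem?_append_left, h]
  · simp
  · rw [length_flatMap_pair, List.length_finRange]; omega

theorem blocks_neg (I : InputLists G D) (v : Fin n) :
    (blocks I).getD (v + v + 1) [] = (I.negList v).map Fin.val := by
  have h := (getElem?_flatMap_pair (fun v => (I.posList v).map Fin.val)
    (fun v => (I.negList v).map Fin.val) (List.finRange n) v).2
  rw [List.getD_eq_getElem?_getD, blocks, List.getElem?_append_left, h]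
  · simp
  · rw [length_flatMap_pair, List.length_finRange]; omega

theorem blocks_bag (I : InputLists G D) (t : Fin N) :
    (blocks I).getD (n + n + t) [] = (I.bagList t).map Fin.val := by
  rw [List.getD_eq_getElem?_getD, blocks, List.getElem?_append_right (by
    rw [length_flatMap_pair, List.length_finRange]; omega), length_flatMap_pair,
    List.length_finRange, Nat.add_sub_cancel_left, List.getElem?_append_left (by simp)]
  simp

theorem blocks_tree (I : InputLists G D) (t : Fin N) :
    (blocks I).getD (n + n + N + t) [] = (I.treeList t).map Fin.val := by
  rw [List.getD_eq_getElem?_getD, blocks, List.getElem?_append_right (by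
    rw [length_flatMap_pair, List.length_finRange]; omega), length_flatMap_pair,
    List.length_finRange, Nat.add_assoc, Nat.add_sub_cancel_left, List.getElem?_append_right (by simp)]
  simp

theorem encodes (I : InputLists G D) (k : ℕ) :
    Encodes (fun j => (I.encode k).getD j 0) n k N (fun i => (blocks I).getD i []) := by
  rw [encode_eq]
  refine ⟨rfl, rfl, rfl, fun i hi => listAt_start _ _ _ _ _ (by rwa [blocks_length]), ?_⟩
  rw [← blocks_length I, start_eq _ _ le_rfl, List.take_length]
  refine List.getD_eq_default _ _ ?_
  simp
  omega

/-- An upper bound for the length of the input word, which the machine can compute. -/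
theorem length_encode_le (I : InputLists G D) (k : ℕ) :
    (I.encode k).length ≤ (n + n + N + 3) * (n + n + N + 3) := by
  have hle : ∀ {m : ℕ} {l : List (Fin m)}, l.Nodup → l.length ≤ m := fun h => by
    simpa using h.length_le_card
  have h1 : ((List.finRange n).map fun v =>
      (lengthPrefixed (I.posList v) ++ lengthPrefixed (I.negList v)).length).sum ≤ n * (2 * n + 2) := by
    refine (List.sum_le_card_nsmul _ (2 * n + 2) fun x hx => ?_).trans (by simp)
    obtain ⟨v, -, rfl⟩ := List.mem_map.mp hx
    have h2 := hle (I.pos_spec v).1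
    have h3 := hle (I.neg_spec v).1
    simp only [lengthPrefixed, List.length_append, List.length_cons, List.length_map]
    omega
  have h2 : ((List.finRange N).map fun t => (lengthPrefixed (I.bagList t)).length).sum ≤
      N * (n + 1) := by
    refine (List.sum_le_card_nsmul _ (n + 1) fun x hx => ?_).trans (by simp)
    obtain ⟨t, -, rfl⟩ := List.mem_map.mp hx
    have h2 := hle (I.bag_spec t).1
    simp only [lengthPrefixed, List.length_cons, List.length_map]
    omega
  have h3 : ((List.finRange N).map fun t => (lengthPrefixed (I.treeList t)).length).sum ≤
      N * (N + 1) := by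
    refine (List.sum_le_card_nsmul _ (N + 1) fun x hx => ?_).trans (by simp)
    obtain ⟨t, -, rfl⟩ := List.mem_map.mp hx
    have h2 := hle (I.tree_spec t).1
    simp only [lengthPrefixed, List.length_cons, List.length_map]
    omega
  simp only [InputLists.encode, List.length_append, List.length_flatMap, List.length_cons,
    List.length_nil] at h1 ⊢
  nlinarith [Nat.zero_le (n * n), Nat.zero_le (n * N)]

theorem isInstance (I : InputLists G D) (hD : D.IsDomino) :
    IsInstance n N (fun i => (blocks I).getD i []) D.tree := by
  have hnd : ∀ {m : ℕ} {l : List (Fin m)}, l.Nodup → (l.map Fin.val).Nodup := fun h =>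
    h.map Fin.val_injective
  have hmem : ∀ {m : ℕ} {l : List (Fin m)} {x : Fin m}, x.val ∈ l.map Fin.val ↔ x ∈ l := by
    intro m l x
    simp [Fin.val_inj]
  have hb : ∀ {t : Fin N} {v : Fin n}, v.val ∈ (blocks I).getD (n + n + t) [] ↔ v ∈ D.bag t := by
    intro t v
    rw [blocks_bag, hmem]
    exact (I.bag_spec t).2 v
  constructor
  · exact D.isTree
  · intro t ht x hx
    have := blocks_tree I ⟨t, ht⟩
    rw [this] at hx
    obtain ⟨y, -, rfl⟩ := List.mem_map.mp hx
    exact y.2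
  · intro t x
    rw [blocks_tree, hmem]
    exact (I.tree_spec t).2 x
  · intro t ht
    have := blocks_tree I ⟨t, ht⟩
    rw [this]
    exact hnd (I.tree_spec _).1
  · intro t ht x hx
    have := blocks_bag I ⟨t, ht⟩
    rw [this] at hx
    obtain ⟨y, -, rfl⟩ := List.mem_map.mp hx
    exact y.2
  · intro t ht
    have := blocks_bag I ⟨t, ht⟩
    rw [this]
    exact hnd (I.bag_spec _).1
  · intro v hv
    obtain ⟨t, ht⟩ := D.vertex_mem ⟨v, hv⟩
    exact ⟨t, t.2, (hb (v := ⟨v, hv⟩)).mpr ht⟩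
  · intro t t' v ht ht' hne hv hv'
    have hvn : v < n := by
      have := blocks_bag I ⟨t, ht⟩
      rw [this] at hv
      obtain ⟨y, -, rfl⟩ := List.mem_map.mp hv
      exact y.2
    have h1 := (hb (t := ⟨t, ht⟩) (v := ⟨v, hvn⟩)).mp hv
    have h2 := (hb (t := ⟨t', ht'⟩) (v := ⟨v, hvn⟩)).mp hv'
    have hadj : D.tree.Adj ⟨t, ht⟩ ⟨t', ht'⟩ := by
      by_contra hadj
      exact Finset.disjoint_left.mp (hD _ _ (by simpa using hne) hadj) h1 h2
    have := blocks_tree I ⟨t, ht⟩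
    rw [this]
    exact hmem (x := ⟨t', ht'⟩).mpr (((I.tree_spec _).2 _).mpr hadj)
  · intro v hv y hy
    have h1 := blocks_pos I ⟨v, hv⟩
    have h2 := blocks_neg I ⟨v, hv⟩
    rw [h1, h2] at hy
    have : ∃ hy : y < n, G.underlying.Adj ⟨v, hv⟩ ⟨y, hy⟩ := by
      rcases hy with hy | hy
      · obtain ⟨u, hu, rfl⟩ := List.mem_map.mp hy
        exact ⟨u.2, Or.inl (((I.pos_spec _).2 _).mp hu)⟩
      · obtain ⟨u, hu, rfl⟩ := List.mem_map.mp hy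
        exact ⟨u.2, Or.inr (((I.neg_spec _).2 _).mp hu)⟩
    obtain ⟨hyn, hadj⟩ := this
    obtain ⟨t, h3, h4⟩ := D.edge_mem _ _ hadj
    exact ⟨t, t.2, (hb (v := ⟨v, hv⟩)).mpr h3, (hb (v := ⟨y, hyn⟩)).mpr h4⟩
  · intro v hv
    have := blocks_pos I ⟨v, hv⟩
    rw [this]
    exact hnd (I.pos_spec _).1
  · intro v hv
    have := blocks_neg I ⟨v, hv⟩
    rw [this]
    exact hnd (I.neg_spec _).1

theorem bagSize_eq (I : InputLists G D) :
    bagSize n N (fun i => (blocks I).getD i []) = Finset.univ.sup fun t => (D.bag t).card := by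
  have hcard : ∀ t, ((blocks I).getD (n + n + t.val) []).length = (D.bag t).card := by
    intro t
    rw [blocks_bag, List.length_map, ← List.toFinset_card_of_nodup (I.bag_spec t).1]
    congr 1
    ext v
    simp [(I.bag_spec t).2 v]
  apply le_antisymm
  · refine Finset.sup_le fun t ht => ?_
    have ht := Finset.mem_range.mp ht
    exact (hcard ⟨t, ht⟩).trans_le
      (Finset.le_sup (f := fun t => (D.bag t).card) (Finset.mem_univ _))
  · refine Finset.sup_le fun t _ => ?_
    rw [← hcard t]
    exact Finset.le_sup (f := fun t => ((blocks I).getD (n + n + t) []).length)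
      (Finset.mem_range.mpr t.2)

/-! ### Sets of vertices and their total cost -/

/-- The number of neighbours in a set, as computed from an adjacency list. -/
theorem sum_map_eq_card {l : List (Fin n)} {R : Fin n → Prop} [DecidablePred R]
    (hl : ListsSet l {u | R u}) {f : ℕ → ℕ} {S : Finset (Fin n)}
    (hf : ∀ v : Fin n, f v = if v ∈ S then 1 else 0) :
    ((l.map Fin.val).map f).sum = (S.filter R).card := by
  rw [List.map_map, ← List.sum_toFinset _ hl.1, Finset.card_filter,
    ← Finset.sum_filter]
  simp only [Function.comp_apply, hf]
  rw [Finset.sum_ite, Finset.sum_const_zero, add_zero]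
  refine Finset.sum_congr ?_ fun _ _ => rfl
  ext u
  simp only [Finset.mem_filter, List.mem_toFinset]
  rw [hl.2 u, Set.mem_ofPred_eq]
  exact and_comm

/-- The total cost of a set is its size if it is an offensive alliance, and larger than `n`
otherwise. -/
theorem total_spec (I : InputLists G D) {L : Layout} (hn : L.n = n)
    (hpos : L.pos = fun v => (blocks I).getD (v + v) [])
    (hneg : L.neg = fun v => (blocks I).getD (v + v + 1) []) {f : ℕ → ℕ} {S : Finset (Fin n)}
    (hf : ∀ v : Fin n, f v = if v ∈ S then 1 else 0) :
    (G.IsOffensiveAlliance S → L.total f = S.card) ∧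
    (L.total f ≤ n → G.IsOffensiveAlliance S ∧ S.card ≤ L.total f) := by
  classical
  have htot : L.total f = S.card + ∑ v : Fin n, L.defect f v := by
    rw [Layout.total, hn, ← Fin.sum_univ_eq_sum_range (fun v => f v + L.defect f v),
      Finset.sum_add_distrib]
    congr 1
    simp only [hf]
    simp
  have hdef : ∀ v : Fin n, L.defect f v = if v ∈ G.boundary S ∧
      ¬ (G.posDeg S v ≤ G.negDeg S v ∧ G.posDeg Sᶜ v + 1 ≤ G.negDeg S v) then n + 1 else 0 := by
    intro v
    have h1 : ((L.pos v).map f).sum = G.posDeg S v := by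
      rw [hpos]
      simp only
      rw [blocks_pos, sum_map_eq_card (I.pos_spec v) hf, SignedGraph.posDeg]
    have h2 : ((L.neg v).map f).sum = G.negDeg S v := by
      rw [hneg]
      simp only
      rw [blocks_neg, sum_map_eq_card (I.neg_spec v) hf, SignedGraph.negDeg]
    have h3 : (L.pos v).length = G.posDeg S v + G.posDeg Sᶜ v := by
      rw [hpos]
      simp only
      rw [blocks_pos, List.length_map, ← List.toFinset_card_of_nodup (I.pos_spec v).1,
        SignedGraph.posDeg, SignedGraph.posDeg, ← Finset.card_union_of_disjoint
          (Finset.disjoint_filter_filter disjoint_compl_right), ← Finset.filter_union,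
        Finset.union_compl]
      congr 1
      ext u
      simp [(I.pos_spec v).2 u]
    have h4 : v ∈ G.boundary S ↔ f v = 0 ∧ 0 < G.posDeg S v + G.negDeg S v := by
      rw [SignedGraph.boundary, Set.mem_ofPred_eq, hf v]
      simp only [ite_eq_right_iff, one_ne_zero, imp_false, Nat.add_pos_iff_pos_or_pos,
        SignedGraph.posDeg, SignedGraph.negDeg, Finset.card_pos, Finset.filter_nonempty_iff]
      refine and_congr_right fun _ => ?_
      rw [← exists_or]
      refine exists_congr fun u => ?_
      rw [← and_or_left, G.underlying.adj_comm u v]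
      rfl
    unfold Layout.defect
    rw [h1, h2, h3, hn, h4]
    split_ifs <;> first | rfl | omega
  constructor
  · intro hS
    rw [htot, Finset.sum_eq_zero, add_zero]
    intro v _
    rw [hdef, if_neg]
    rintro ⟨h1, h2⟩
    exact h2 (hS v h1)
  · intro hle
    refine ⟨fun v hv => ?_, by omega⟩
    by_contra hcon
    have h1 : L.defect f v = n + 1 := by rw [hdef, if_pos ⟨hv, hcon⟩]
    have h2 := Finset.single_le_sum (f := fun v : Fin n => L.defect f v)
      (fun _ _ => Nat.zero_le _) (Finset.mem_univ v)
    omega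

/-- The value `ans` of the dynamic program is the alliance number if `1 ≤ n`. If `n = 0`, it is not
less than `n + 1`, which distinguishes this case in the decision for `k`. -/
theorem ans_correct (I : InputLists G D) {L : Layout} (hn : L.n = n)
    (hpos : L.pos = fun v => (blocks I).getD (v + v) [])
    (hneg : L.neg = fun v => (blocks I).getD (v + v + 1) []) (hL : L.Valid) {F : ℕ → ℕ → ℕ}
    {ans : ℕ} (hF : L.Inv F 0 ans) (k : ℕ) :
    (G.HasOffensiveAlliance k ↔ ans < n + 1 ∧ ans < k + 1) ∧
    (1 ≤ n → G.IsAllianceNumber ans) := by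
  classical
  obtain ⟨hlow, hup⟩ := hL.ans_spec hF
  rw [hn] at hlow hup
  have h1 : ∀ S : Finset (Fin n), S.Nonempty → G.IsOffensiveAlliance S → ans ≤ S.card := by
    rintro S ⟨v, hv⟩ hS
    let f : ℕ → ℕ := fun v => if h : v < n then if (⟨v, h⟩ : Fin n) ∈ S then 1 else 0 else 0
    have hf : ∀ v : Fin n, f v = if v ∈ S then 1 else 0 := fun v => by simp [f]
    rw [← (total_spec I hn hpos hneg hf).1 hS]
    refine hlow f (fun v => ?_) ⟨v, v.2, by simp [hf, hv]⟩
    simp only [f]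
    split_ifs <;> simp
  have h2 : ans ≤ n → ∃ S : Finset (Fin n), S.Nonempty ∧ G.IsOffensiveAlliance S ∧
      S.card ≤ ans := by
    intro hle
    obtain ⟨f, hf, ⟨v, hv, hne⟩, htot⟩ := hup.resolve_left (by omega)
    let S : Finset (Fin n) := Finset.univ.filter fun v => f v ≠ 0
    have hfS : ∀ v : Fin n, f v = if v ∈ S then 1 else 0 := by
      intro v
      have := hf v
      simp only [S, Finset.mem_filter, Finset.mem_univ, true_and]
      split_ifs with h <;> omega
    obtain ⟨h3, h4⟩ := (total_spec I hn hpos hneg hfS).2 (htot.trans hle)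
    exact ⟨S, ⟨⟨v, hv⟩, by simpa [S] using hne⟩, h3, h4.trans htot⟩
  refine ⟨⟨fun ⟨S, hS, hc, hk⟩ => ?_, fun ⟨hn', hk⟩ => ?_⟩, fun hn1 => ?_⟩
  · have h3 := h1 S (Finset.card_pos.mp hc) hS
    have h4 := S.card_le_univ
    simp only [Fintype.card_fin] at h4
    omega
  · obtain ⟨S, h3, h4, h5⟩ := h2 (by omega)
    exact ⟨S, h4, Finset.card_pos.mpr h3, by omega⟩
  · -- the set of all vertices has an empty boundary
    have huniv : G.IsOffensiveAlliance Finset.univ := fun v hv => absurd (Finset.mem_univ v) hv.1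
    have h3 := h1 Finset.univ ⟨⟨0, hn1⟩, Finset.mem_univ _⟩ huniv
    simp only [Finset.card_univ, Fintype.card_fin] at h3
    obtain ⟨S, h4, h5, h6⟩ := h2 h3
    refine ⟨⟨S, h4, h5, le_antisymm h6 (h1 S h4 h5)⟩, ?_⟩
    rintro _ ⟨S', h7, h8, rfl⟩
    exact h1 S' h7 h8

/-! ### The machine program -/

/-- The number of a variable. -/
def Var.index : Var → ℕ
  | .res => 0 | .ans => 1 | .n => 2 | .k => 3 | .N => 4 | .p => 5 | .inf => 6 | .wd => 7 | .W => 8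
  | .r => 9 | .pw => 10 | .cnt => 11 | .i => 12 | .j => 13 | .x => 14 | .y => 15 | .u => 16
  | .q => 17 | .bu => 18 | .bq => 19 | .a => 20 | .c => 21 | .m => 22 | .val => 23 | .v => 24
  | .e₁ => 25 | .e₂ => 26 | .sp => 27 | .sn => 28

/-- The number of an array. -/
def Arr.index : Arr → ℕ
  | .ptr => 0 | .half => 1 | .odd => 2 | .row => 3 | .order => 4 | .pp => 5 | .vis => 6 | .bp => 7
  | .low => 8 | .sel => 9 | .tab => 10

theorem Var.index_injective : Function.Injective Var.index := by
  intro x y h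
  cases x <;> cases y <;> first | rfl | cases h

theorem Arr.index_injective : Function.Injective Arr.index := by
  intro x y h
  cases x <;> cases y <;> first | rfl | cases h

theorem Arr.index_lt (a : Arr) : a.index < 16 := by
  cases a <;> decide

/-- Computes the address `(2 n + N + 3) ^ 2` above which the arrays are stored, in register `3`. -/
def allocate : RAM.Prog :=
  (RAM.Prog.const 5 0).seq <| (RAM.Prog.load 7 5).seq <| (RAM.Prog.const 5 2).seq <|
  (RAM.Prog.load 9 5).seq <| (RAM.Prog.sum 7 7 7).seq <| (RAM.Prog.sum 7 7 9).seq <|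
  (RAM.Prog.const 9 3).seq <| (RAM.Prog.sum 7 7 9).seq <| (RAM.Prog.const 5 0).seq <|
  (RAM.Prog.const 9 1).seq <|
  RAM.Prog.whileLt 5 7 ((RAM.Prog.sum 3 3 7).seq (RAM.Prog.sum 5 5 9))

theorem allocate_runs {σ : RAM.State} (hσ : ∀ r, σ.reg r = 0) :
    RAM.Runs allocate σ (11 + 3 * (σ.mem 0 + σ.mem 0 + σ.mem 2 + 3)) fun τ =>
      τ.reg 3 = (σ.mem 0 + σ.mem 0 + σ.mem 2 + 3) * (σ.mem 0 + σ.mem 0 + σ.mem 2 + 3) ∧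
      τ.mem = σ.mem ∧ ∀ r, τ.reg (2 * r) = 0 := by
  set b := σ.mem 0 + σ.mem 0 + σ.mem 2 + 3 with hb
  refine (RAM.Runs.seq <| RAM.Runs.const <| RAM.Runs.seq <| RAM.Runs.load <| RAM.Runs.seq <|
    RAM.Runs.const <| RAM.Runs.seq <| RAM.Runs.load <| RAM.Runs.seq <| RAM.Runs.sum <|
    RAM.Runs.seq <| RAM.Runs.sum <| RAM.Runs.seq <| RAM.Runs.const <| RAM.Runs.seq <|
    RAM.Runs.sum <| RAM.Runs.seq <| RAM.Runs.const <| RAM.Runs.seq <| RAM.Runs.const <|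
    RAM.Runs.mono (RAM.Runs.whileLt (m := b) (fun i τ => τ.reg 3 = i * b ∧ τ.reg 5 = i ∧
      τ.reg 7 = b ∧ τ.reg 9 = 1 ∧ τ.mem = σ.mem ∧ ∀ r, τ.reg (2 * r) = 0) (fun _ => 1 + 1)
      ?_ ?_ ?_) le_rfl fun τ hτ => ⟨hτ.1, hτ.2.2.2.2⟩ : RAM.Runs allocate σ _ _).mono
        ?_ fun _ h => h
  · rintro i hi τ ⟨h3, h5, h7, h9, hm, hz⟩
    refine ⟨by omega, RAM.Runs.seq <| RAM.Runs.sum <| RAM.Runs.sum ?_⟩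
    refine ⟨?_, ?_, ?_, ?_, hm, fun r => ?_⟩
    · simp [h3, h7, Nat.succ_mul]
    · simp [h5, h9]
    · simp [h7]
    · simp [h9]
    · have h1 : 2 * r ≠ 3 := by omega
      have h2 : 2 * r ≠ 5 := by omega
      simp [h1, h2, hz]
  · rintro τ ⟨-, h5, h7, -⟩
    omega
  · refine ⟨by simp [hσ], by simp, by simp [hb], by simp, rfl, fun r => ?_⟩
    have h1 : 2 * r ≠ 5 := by omega
    have h2 : 2 * r ≠ 7 := by omega
    have h3 : 2 * r ≠ 9 := by omega
    simp [h1, h2, h3, hσ]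
  · simp
    omega

/-- The machine program: allocation, the translated algorithm, and a copy of the result. -/
def program : RAM.Prog :=
  allocate.seq <| (main.compile Var.index Arr.index 0).seq <|
    (RAM.Prog.const 3 0).seq (RAM.Prog.sum 1 2 3)

theorem program_runs (I : InputLists G D) (hD : D.IsDomino) (k : ℕ) :
    RAM.Runs program (RAM.initial (I.encode k))
      (22 + 6 * n + 3 * N + main.weight *
        mainCost n N (Finset.univ.sup fun t => (D.bag t).card)) fun τ =>
      (G.HasOffensiveAlliance k → τ.reg 0 = 1) ∧ (¬ G.HasOffensiveAlliance k → τ.reg 0 = 0) ∧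
      (1 ≤ n → G.IsAllianceNumber (τ.reg 1)) ∧ 1 ≤ N ∧
      ((∀ t, (D.bag t).Nonempty) → N ≤ 2 * n) := by
  set x := I.encode k with hx
  have hw : Encodes (fun j => x.getD j 0) _ _ _ _ := encodes I k
  have hI := isInstance I hD
  have hlen : x.length ≤ _ := length_encode_le I k
  have hmem0 : (RAM.initial x).mem 0 = n := hw.n_eq
  have hmem2 : (RAM.initial x).mem 2 = N := hw.N_eq
  have hspec := main_spec hw hI
  rw [bagSize_eq I] at hspec
  refine (RAM.Runs.seq ((allocate_runs (σ := RAM.initial x) fun _ => rfl).mono le_rfl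
    fun τ₁ h₁ => RAM.Runs.seq ((Cmd.compile_runs (w := fun j => x.getD j 0)
    (B := (n + n + N + 3) * (n + n + N + 3)) (s := ⟨fun _ => 0, fun _ _ => 0⟩) (fun i hi => ?_)
    Var.index_injective Arr.index_injective Arr.index_lt main 0 ?_).mono le_rfl
    fun τ₂ h₂ => RAM.Runs.seq <| RAM.Runs.const <| RAM.Runs.sum ?_))).mono
      (T := _ + (_ + (1 + 1))) ?_ fun _ h => h
  · exact List.getD_eq_default _ _ (hlen.trans hi)
  · rw [hmem0, hmem2] at h₁
    refine ⟨fun y => h₁.2.2 _, h₁.1, fun i _ => by rw [h₁.2.1]; rfl, fun a i => ?_⟩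
    rw [h₁.2.1]
    exact List.getD_eq_default _ _ (by omega)
  · obtain ⟨⟨⟨L, F, hn, hN, hpos, hneg, hL, hF, hbag⟩, hres⟩, -⟩ := hspec
    have h3 := h₂.1.var .res
    have h4 := h₂.1.var .ans
    obtain ⟨h5, h6⟩ := ans_correct I hn hpos hneg hL hF k
    simp only [Var.index] at h3 h4
    have h7 : ∀ (f : ℕ → ℕ), Function.update (Function.update f 3 0) 1
        (Function.update f 3 0 2 + Function.update f 3 0 3) 0 = f 0 ∧
        Function.update (Function.update f 3 0) 1
        (Function.update f 3 0 2 + Function.update f 3 0 3) 1 = f 2 := fun f => by simp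
    refine ⟨fun h => ?_, fun h => ?_, fun h => ?_, hI.one_le, fun h => ?_⟩
    · dsimp only
      rw [(h7 _).1]
      exact h3.trans (by rw [hres, if_pos (h5.mp h)])
    · dsimp only
      rw [(h7 _).1]
      exact h3.trans (by rw [hres, if_neg fun h' => h (h5.mpr h')])
    · dsimp only
      rw [(h7 _).2]
      have : τ₂.reg 2 = _ := h4
      rw [this]
      exact h6 h
    · have hne : ∀ t < N, (blocks I).getD (n + n + t) [] ≠ [] := by
        intro t ht
        obtain ⟨v, hv⟩ := h ⟨t, ht⟩
        have h8 := blocks_bag I ⟨t, ht⟩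
        have h9 := ((I.bag_spec _).2 v).mpr hv
        rw [h8]
        simpa using List.ne_nil_of_mem h9
      have := hL.le_two_mul (by rw [hN]; exact hbag hne)
      rwa [hn, hN] at this
  · have := Nat.mul_le_mul_left main.weight hspec.2
    rw [hmem0, hmem2]
    omega

theorem mainCost_le {n N b d : ℕ} (hN : 1 ≤ N) (hd : 1 ≤ d) (hb : b ≤ 2 * d) :
    mainCost n N b ≤ 223 * (n + N) * (d ^ 2 * 2 ^ (4 * d ^ 2)) := by
  set W := 2 ^ b with hW
  have hW1 : 1 ≤ W := Nat.one_le_two_pow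
  have hWW : W * W ≤ 2 ^ (4 * d ^ 2) := by
    rw [hW, ← pow_add]
    exact Nat.pow_le_pow_right (by omega) (by nlinarith)
  have hdd : d ≤ d ^ 2 := Nat.le_self_pow (by omega) d
  have hd1 : 1 ≤ d ^ 2 := hd.trans hdd
  -- everything is bounded in terms of the product `Y`
  set Y := d ^ 2 * (W * W) with hY
  have hY1 : 1 ≤ Y := Nat.one_le_iff_ne_zero.mpr (by positivity)
  have hYd : d ≤ Y := hdd.trans (Nat.le_mul_of_pos_right _ (by positivity))
  have hYW : W ≤ Y := (Nat.le_mul_of_pos_right W hW1).trans (Nat.le_mul_of_pos_left _ hd1)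
  have hmsg : W * (1 + messageCost W b) ≤ 133 * Y := by
    have hbb : b * (12 + 12 * b) ≤ 24 * d ^ 2 + 48 * d ^ 2 := by nlinarith
    have h1 : 21 + 18 * b + b * (12 + 12 * b) ≤ 129 * d ^ 2 := by omega
    have h2 := Nat.mul_le_mul_left W h1
    have h3 : 1 + messageCost W b ≤ 4 + W * (129 * d ^ 2) := by unfold messageCost; omega
    have h4 : W * (4 + W * (129 * d ^ 2)) = 4 * W + 129 * Y := by rw [hY]; ring
    have h5 := Nat.mul_le_mul_left W h3
    omega
  have h1 : mainCost n N b ≤ 223 * (n + N) * Y := by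
    have h2 := Nat.mul_le_mul_left N hmsg
    have h3 : N * b ≤ N * (2 * Y) := Nat.mul_le_mul_left N (by omega)
    have h4 : N ≤ N * Y := Nat.le_mul_of_pos_right N hY1
    have h5 : n ≤ n * Y := Nat.le_mul_of_pos_right n hY1
    have h6 : Y ≤ N * Y := Nat.le_mul_of_pos_left Y hN
    have h7 : 223 * (n + N) * Y = 223 * (n * Y) + 223 * (N * Y) := by ring
    have h8 : N * (133 * Y) = 133 * (N * Y) := by ring
    have h9 : N * (2 * Y) = 2 * (N * Y) := by ring
    rw [mainCost, ← hW]
    omega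
  exact h1.trans (Nat.mul_le_mul_left _ (Nat.mul_le_mul_left _ hWW))

end AllianceProgram

theorem mainTheorem4 :
    ∃ (P : RAM.Prog) (C : ℕ),
      ∀ (n N : ℕ) (G : SignedGraph (Fin n)) (D : TreeDecomposition G.underlying (Fin N))
        (I : InputLists G D) (k d : ℕ),
        D.IsDomino → D.width = d → 1 ≤ k →
        ∃ (steps : ℕ) (τ : RAM.State),
          RAM.Exec P (RAM.initial (I.encode k)) steps τ ∧
          (G.HasOffensiveAlliance k → τ.reg 0 = 1) ∧
          (¬ G.HasOffensiveAlliance k → τ.reg 0 = 0) ∧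
          (1 ≤ n → G.IsAllianceNumber (τ.reg 1)) ∧
          steps ≤ C * (max d 1) ^ 2 * 2 ^ (C * (max d 1) ^ 2) * (n + N) ∧
          ((∀ t, (D.bag t).Nonempty) →
            steps ≤ C * (max d 1) ^ 2 * 2 ^ (C * (max d 1) ^ 2) * n) := by
  -- the factor `3` serves the second bound, where `n + N ≤ 3 n`
  refine ⟨AllianceProgram.program, 3 * (28 + 223 * AllianceProgram.main.weight), ?_⟩
  rintro n N G D I k d hD rfl -
  obtain ⟨t, τ, hexec, ht, h1, h0, ha, hN, hbag⟩ := AllianceProgram.program_runs I hD k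
  set c := 28 + 223 * AllianceProgram.main.weight with hc
  set e := max D.width 1 with he
  have hsup : (Finset.univ.sup fun t => (D.bag t).card) ≤ 2 * e := by
    have : (Finset.univ.sup fun t => (D.bag t).card) ≤ D.width + 1 := by
      unfold TreeDecomposition.width; omega
    omega
  set Z := e ^ 2 * 2 ^ (4 * e ^ 2) with hZ
  have hZ1 : 1 ≤ Z := Nat.one_le_iff_ne_zero.mpr (by positivity)
  have hsteps : t ≤ c * (n + N) * Z := by
    have h2 : AllianceProgram.main.weight * _ ≤ AllianceProgram.main.weight * (_ * Z) :=
      Nat.mul_le_mul_left _ (AllianceProgram.mainCost_le (n := n) hN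
        (le_max_right _ _) hsup)
    have h3 : 22 + 6 * n + 3 * N ≤ 28 * (n + N) * Z :=
      (by omega : _ ≤ 28 * (n + N)).trans (Nat.le_mul_of_pos_right _ hZ1)
    have h4 : c * (n + N) * Z = 28 * (n + N) * Z +
        AllianceProgram.main.weight * (223 * (n + N) * Z) := by rw [hc]; ring
    omega
  have hZC : Z ≤ e ^ 2 * 2 ^ (3 * c * e ^ 2) :=
    Nat.mul_le_mul_left _ (Nat.pow_le_pow_right (by omega) (Nat.mul_le_mul_right _ (by omega)))
  refine ⟨t, τ, hexec, h1, h0, ha, ?_, fun hne => ?_⟩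
  · calc t ≤ c * (n + N) * Z := hsteps
      _ ≤ 3 * c * (n + N) * (e ^ 2 * 2 ^ (3 * c * e ^ 2)) :=
        Nat.mul_le_mul (Nat.mul_le_mul_right _ (by omega)) hZC
      _ = _ := by ring
  · have h2 := hbag hne
    calc t ≤ c * (n + N) * Z := hsteps
      _ ≤ c * (3 * n) * (e ^ 2 * 2 ^ (3 * c * e ^ 2)) :=
        Nat.mul_le_mul (Nat.mul_le_mul_left _ (by omega)) hZC
      _ = _ := by ring
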